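/- Let $\mathbb{Q}^\theta\langle\langle x\rangle\rangle$ be the space of formal power series of bounded degree over $\mathbb{Q}$ in noncommuting variables $x_1,x_2,\dots$ and anticommuting variables $\theta_1,\theta_2,\dots$ ($\theta_i\theta_j=-\theta_j\theta_i$, $x_i\theta_j=\theta_jx_i$). Let $\mathbf{sNCSym}$ be the subspace of series invariant under all finitary permutations $s$ acting by $x_i\mapsto x_{s(i)}$, $\theta_i\mapsto\theta_{s(i)}$, and let $\mathbf{sNCSym}_{n,m}$ be the part of bidegree $(n,m)$, i.e. with $n$ $x$-variables and $m$ $\theta$-variables in each monomial. Let $\rho$ be the projection that makes the $x_i$ commute with each other, and $\mathbf{sSym}=\rho(\mathbf{sNCSym})$. A partial set supercomposition of bidegree $(n,m)$ is a tuple $K=(K_1,\dots,K_q)$ of nonempty subsets (blocks) of $\{0,\dots,n\}$, with pairwise intersections contained in $\{0\}$ and whose union contains $\{1,\dots,n\}$, such that exactly the blocks $K_1,\dots,K_m$ contain $0$ (the fermionic blocks) and $K_{m+1},\dots,K_q$ are ordered by increasing minimum. It is a set superpartition if $\min(K_i\setminus K_j)<\min(K_j\setminus K_i)$ for all $i<j$,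 where $\min\emptyset=0$. Let $M(K)$ be the set of monomials $\theta_{a_1}\cdots\theta_{a_m}x_{b_1}\cdots x_{b_n}$ such that $a_i=b_j$ iff $j\in K_i$, and $b_i=b_j$ iff $i,j$ are in a common block of $K$, and let $m_K=\sum_{u\in M(K)}u$. Let $h_K=\sum_u c_uu$, where $u=\theta_{a_1}\cdots\theta_{a_m}x_{b_1}\cdots x_{b_n}$ runs over the monomials with $a_1,\dots,a_m$ distinct and at most one element in $\{a_1,\dots,a_m\}\setminus\{b_1,\dots,b_n\}$, and $c_u$ is the product of the factorials of the sizes of the blocks of $K\sqcap L$, where $u\in M(L)$. Here $\sqcap$ is the meet for the order in which $L$ is coarser than $K$ if, for each $i\le m$, the $i$th fermionic block of $L$ is $K_i$ joined with some nonfermionic blocks of $K$, and the nonfermionic blocks of $L$ are unions of nonfermionic blocks of $K$. A superpartition of bidegree $(n,m)$ is $\Lambda=(\Lambda_1,\dots,\Lambda_m;\Lambda_{m+1},\dots,\Lambda_k)$ with $\Lambda_1>\dots>\Lambda_m\ge0$, $\Lambda_{m+1}\ge\dots\ge\Lambda_k\ge1$ and $\sum_i\Lambda_i=n$; put $\Lambda!=\prod_i\Lambda_i!$.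 In commuting $x$-variables, $m_\Lambda$ is the sum, without repeated terms, of all $\theta_{a_1}\cdots\theta_{a_m}x_{a_1}^{\Lambda_1}\cdots x_{a_k}^{\Lambda_k}$ with distinct $a_1,\dots,a_k$, and $h_\Lambda=\tilde h_{\Lambda_1}\cdots\tilde h_{\Lambda_m}h_{\Lambda_{m+1}}\cdots h_{\Lambda_k}$, where $\tilde h_r=\sum_\Omega(\Omega_1+1)m_\Omega$ over $\Omega$ of bidegree $(r,1)$ and $h_r=\sum_\Omega m_\Omega$ over $\Omega$ of bidegree $(r,0)$. A set superpartition $I$ of bidegree $(n,m)$ is of type $\Lambda$ if the numbers $|I_i|-1$ ($i\le m$) are a rearrangement of $\Lambda_1,\dots,\Lambda_m$ and the sizes $|I_i|$ ($i>m$) are a rearrangement of $\Lambda_{m+1},\dots,\Lambda_k$; then $\varepsilon(I)=\#\{i<j\le m: |I_i|<|I_j|\}$. Then the following hold. (1) All $m_I,h_I$ ($I$ a set superpartition) lie in $\mathbf{sNCSym}$ and all $m_\Lambda,h_\Lambda$ lie in $\mathbf{sSym}$. There are a unique bilinear form on $\mathbf{sNCSym}$ with $\langle m_I,h_J\rangle=(-1)^{\binom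 m2}n!\,\delta_{I,J}$ for all set superpartitions $I,J$, $(n,m)$ being the bidegree of $I$; a unique bilinear form on $\mathbf{sSym}$ with $\langle m_\Lambda,h_\Omega\rangle=(-1)^{\binom m2}\delta_{\Lambda,\Omega}$ for all superpartitions $\Lambda,\Omega$, $m$ being the fermionic degree of $\Lambda$; and a unique linear map $\tilde\rho:\mathbf{sSym}\to\mathbf{sNCSym}$ with $\tilde\rho(m_\Lambda)=\frac{\Lambda!}{n!}\sum_{I\text{ of type }\Lambda}(-1)^{\varepsilon(I)}m_I$ for all $\Lambda$, $n$ being the degree of $\Lambda$. (2) The form on $\mathbf{sNCSym}$ is an inner product, in the sense that it is symmetric and nondegenerate; more precisely, the components $\mathbf{sNCSym}_{n,m}$ are mutually orthogonal, and $(-1)^{\binom m2}\langle\,,\rangle$ is positive definite on $\mathbf{sNCSym}_{n,m}$. (3) $\rho\circ\tilde\rho$ is the identity of $\mathbf{sSym}$, and $\tilde\rho$ is an isometry: $\langle\tilde\rho(f),\tilde\rho(g)\rangle=\langle f,g\rangle$ for all $f,g\in\mathbf{sSym}$. -/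

import Mathlib

open Finset
open scoped Nat

noncomputable section

/-- A partial set supercomposition `(K_1, …, K_q)` of degree `n`
and fermionic degree `m`. The set `{0, 1, …, n}` is `Fin (n + 1)`. The fermionic blocks
`K_1, …, K_m` (those containing `0`) form the tuple `ferm`; the blocks `K_{m+1}, …, K_q` are
listed by increasing minimum, so that they carry the same information as the collection `bos`. -/
@[ext]
structure PartialSetSupercomposition (n m : ℕ) where
  ferm : Fin m → Finset (Fin (n + 1))
  bos : Finset (Finset (Fin (n + 1)))
  zero_mem_ferm : ∀ i, 0 ∈ ferm i
  zero_notMem_bos : ∀ B ∈ bos, 0 ∉ B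
  bos_nonempty : ∀ B ∈ bos, B.Nonempty
  ferm_inter_ferm : ∀ i j, i ≠ j → ferm i ∩ ferm j ⊆ {0}
  ferm_inter_bos : ∀ i, ∀ B ∈ bos, Disjoint (ferm i) B
  bos_inter_bos : ∀ B ∈ bos, ∀ C ∈ bos, B ≠ C → Disjoint B C
  cover : ∀ j, j ≠ 0 → (∃ i, j ∈ ferm i) ∨ ∃ B ∈ bos, j ∈ B

namespace PartialSetSupercomposition

variable {n m : ℕ}

/-- `i` and `j` lie in a common block of `K`. -/
def SameBlock (K : PartialSetSupercomposition n m) (i j : Fin (n + 1)) : Prop :=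
  (∃ k, i ∈ K.ferm k ∧ j ∈ K.ferm k) ∨ ∃ B ∈ K.bos, i ∈ B ∧ j ∈ B

/-- `K!`, the product of the factorials of the sizes of the blocks (the element `0` counts). -/
def blockFactorial (K : PartialSetSupercomposition n m) : ℕ :=
  (∏ i, (K.ferm i).card !) * ∏ B ∈ K.bos, B.card !

/-- The underlying set partition `K⁺` of `{1, …, n}`: remove `0` from every block and discard the
empty set. -/
def underlying (K : PartialSetSupercomposition n m) : Finset (Finset (Fin (n + 1))) :=
  ((univ.image K.ferm ∪ K.bos).image (fun B => B.erase 0)).erase ∅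

/-- The strong coarsening order: `L` is strongly coarser than `K` if the `i`th fermionic block
of `L` is the `i`th fermionic block of `K` joined with some nonfermionic blocks of `K`, and each
nonfermionic block of `L` is a union of nonfermionic blocks of `K`. -/
def StronglyFiner (K L : PartialSetSupercomposition n m) : Prop :=
  (∀ i, ∃ T ⊆ K.bos, L.ferm i = K.ferm i ∪ T.biUnion id) ∧
    ∀ B ∈ L.bos, ∃ T ⊆ K.bos, B = T.biUnion id

lemma mem_underlying (K : PartialSetSupercomposition n m) {X : Finset (Fin (n + 1))} :
    X ∈ K.underlying ↔ X.Nonempty ∧ ((∃ i, X = (K.ferm i).erase 0) ∨ X ∈ K.bos) := by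
  have h0 : ∀ B ∈ K.bos, B.erase 0 = B := fun B hB => erase_eq_of_notMem (K.zero_notMem_bos B hB)
  simp only [underlying, mem_erase, mem_image, mem_union, mem_univ, true_and, ne_eq,
    nonempty_iff_ne_empty]
  refine and_congr_right fun _ => ⟨?_, ?_⟩
  · rintro ⟨B, ⟨i, rfl⟩ | hB, rfl⟩
    · exact Or.inl ⟨i, rfl⟩
    · rw [h0 B hB]; exact Or.inr hB
  · rintro (⟨i, rfl⟩ | hB)
    · exact ⟨_, Or.inl ⟨i, rfl⟩, rfl⟩
    · exact ⟨X, Or.inr hB, h0 X hB⟩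

lemma zero_notMem_underlying (K : PartialSetSupercomposition n m) {X : Finset (Fin (n + 1))}
    (hX : X ∈ K.underlying) : 0 ∉ X := by
  obtain ⟨-, ⟨i, rfl⟩ | hB⟩ := K.mem_underlying.1 hX
  · simp
  · exact K.zero_notMem_bos X hB

lemma ferm_unique (K : PartialSetSupercomposition n m) {i k : Fin m} {j : Fin (n + 1)}
    (hj : j ≠ 0) (hi : j ∈ K.ferm i) (hk : j ∈ K.ferm k) : i = k := by
  by_contra h
  exact hj (mem_singleton.1 (K.ferm_inter_ferm i k h (mem_inter.2 ⟨hi, hk⟩)))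

lemma not_ferm_bos (K : PartialSetSupercomposition n m) {i : Fin m} {B : Finset (Fin (n + 1))}
    {j : Fin (n + 1)} (hB : B ∈ K.bos) (hi : j ∈ K.ferm i) (hk : j ∈ B) : False :=
  disjoint_left.1 (K.ferm_inter_bos i B hB) hi hk

lemma bos_unique (K : PartialSetSupercomposition n m) {B C : Finset (Fin (n + 1))}
    {j : Fin (n + 1)} (hB : B ∈ K.bos) (hC : C ∈ K.bos) (hi : j ∈ B) (hk : j ∈ C) : B = C := by
  by_contra h
  exact disjoint_left.1 (K.bos_inter_bos B hB C hC h) hi hk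

lemma eq_of_mem_underlying (K : PartialSetSupercomposition n m) {X Y : Finset (Fin (n + 1))}
    (hX : X ∈ K.underlying) (hY : Y ∈ K.underlying) {j : Fin (n + 1)} (hjX : j ∈ X)
    (hjY : j ∈ Y) : X = Y := by
  have hj : j ≠ 0 := fun h => K.zero_notMem_underlying hX (h ▸ hjX)
  obtain ⟨-, ⟨i, rfl⟩ | hB⟩ := K.mem_underlying.1 hX
  · obtain ⟨-, ⟨k, rfl⟩ | hC⟩ := K.mem_underlying.1 hY
    · rw [K.ferm_unique hj (mem_of_mem_erase hjX) (mem_of_mem_erase hjY)]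
    · exact (K.not_ferm_bos hC (mem_of_mem_erase hjX) hjY).elim
  · obtain ⟨-, ⟨k, rfl⟩ | hC⟩ := K.mem_underlying.1 hY
    · exact (K.not_ferm_bos hB (mem_of_mem_erase hjY) hjX).elim
    · exact K.bos_unique hB hC hjX hjY

lemma exists_mem_underlying (K : PartialSetSupercomposition n m) {j : Fin (n + 1)} (hj : j ≠ 0) :
    ∃ X ∈ K.underlying, j ∈ X := by
  obtain ⟨i, hi⟩ | ⟨B, hB, hjB⟩ := K.cover j hj
  · have : j ∈ (K.ferm i).erase 0 := mem_erase.2 ⟨hj, hi⟩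
    exact ⟨_, K.mem_underlying.2 ⟨⟨j, this⟩, Or.inl ⟨i, rfl⟩⟩, this⟩
  · exact ⟨B, K.mem_underlying.2 ⟨⟨j, hjB⟩, Or.inr hB⟩, hjB⟩

/-- The meet `K ⊓ L` for strong coarsening: its `i`th fermionic block is `K_i ∩ L_i`, and its
nonfermionic blocks are the nonempty intersections of a block of `K⁺` with a block of `L⁺`,
outside the union of the fermionic blocks. -/
def meet (K L : PartialSetSupercomposition n m) : PartialSetSupercomposition n m where
  ferm i := K.ferm i ∩ L.ferm i
  bos := (image₂ (fun X Y => (X ∩ Y) \ univ.biUnion fun i => K.ferm i ∩ L.ferm i)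
    K.underlying L.underlying).erase ∅
  zero_mem_ferm i := by simp [K.zero_mem_ferm, L.zero_mem_ferm]
  zero_notMem_bos := by
    intro B hB h
    obtain ⟨X, hX, Y, hY, rfl⟩ := mem_image₂.1 (mem_of_mem_erase hB)
    exact K.zero_notMem_underlying hX (mem_inter.1 (mem_sdiff.1 h).1).1
  bos_nonempty := fun B hB => nonempty_iff_ne_empty.2 (mem_erase.1 hB).1
  ferm_inter_ferm i j hij := fun x hx => K.ferm_inter_ferm i j hij (by
    simp only [mem_inter] at hx ⊢; exact ⟨hx.1.1, hx.2.1⟩)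
  ferm_inter_bos := by
    intro i B hB
    obtain ⟨X, hX, Y, hY, rfl⟩ := mem_image₂.1 (mem_of_mem_erase hB)
    exact disjoint_left.2 fun x hx hx' =>
      (mem_sdiff.1 hx').2 (mem_biUnion.2 ⟨i, mem_univ i, hx⟩)
  bos_inter_bos := by
    intro B hB C hC hBC
    obtain ⟨X, hX, Y, hY, rfl⟩ := mem_image₂.1 (mem_of_mem_erase hB)
    obtain ⟨X', hX', Y', hY', rfl⟩ := mem_image₂.1 (mem_of_mem_erase hC)
    refine disjoint_left.2 fun x hx hx' => hBC ?_
    simp only [mem_sdiff, mem_inter] at hx hx'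
    rw [K.eq_of_mem_underlying hX hX' hx.1.1 hx'.1.1, L.eq_of_mem_underlying hY hY' hx.1.2 hx'.1.2]
  cover := by
    intro j hj
    by_cases h : ∃ i, j ∈ K.ferm i ∩ L.ferm i
    · exact Or.inl h
    · obtain ⟨X, hX, hjX⟩ := K.exists_mem_underlying hj
      obtain ⟨Y, hY, hjY⟩ := L.exists_mem_underlying hj
      have hm : j ∈ (X ∩ Y) \ univ.biUnion fun i => K.ferm i ∩ L.ferm i :=
        mem_sdiff.2 ⟨mem_inter.2 ⟨hjX, hjY⟩, by simpa using h⟩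
      exact Or.inr ⟨_, mem_erase.2 ⟨ne_empty_of_mem hm, mem_image₂.2 ⟨X, hX, Y, hY, rfl⟩⟩, hm⟩

lemma meet_comm (K L : PartialSetSupercomposition n m) : K.meet L = L.meet K := by
  have h : (fun i => K.ferm i ∩ L.ferm i) = fun i => L.ferm i ∩ K.ferm i :=
    funext fun i => inter_comm _ _
  ext1
  · exact h
  · simp only [meet]
    rw [image₂_swap]
    simp only [h, inter_comm]

lemma meet_left (K L : PartialSetSupercomposition n m) : StronglyFiner (K.meet L) K := by
  have key : ∀ Z, (∀ X ∈ K.underlying, ∀ j ∈ X, j ∈ Z → X ⊆ Z) → ∀ j ∈ Z, j ≠ 0 →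
      (∀ i, j ∉ K.ferm i ∩ L.ferm i) → ∃ B ∈ (K.meet L).bos, B ⊆ Z ∧ j ∈ B := by
    intro Z hZ j hj hj0 h
    obtain ⟨i, hi⟩ | ⟨B, hB, hjB⟩ := (K.meet L).cover j hj0
    · exact (h i hi).elim
    · refine ⟨B, hB, ?_, hjB⟩
      obtain ⟨X, hX, Y, hY, rfl⟩ := mem_image₂.1 (mem_of_mem_erase hB)
      exact fun x hx => hZ X hX j (mem_inter.1 (mem_sdiff.1 hjB).1).1 hj
        (mem_inter.1 (mem_sdiff.1 hx).1).1
  constructor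
  · intro i
    refine ⟨(K.meet L).bos.filter (· ⊆ K.ferm i), filter_subset _ _, ?_⟩
    ext j
    simp only [mem_union, mem_biUnion, mem_filter, id]
    constructor
    · intro hj
      by_cases hL : j ∈ L.ferm i
      · exact Or.inl (mem_inter.2 ⟨hj, hL⟩)
      · right
        have hj0 : j ≠ 0 := fun h => hL (h ▸ L.zero_mem_ferm i)
        obtain ⟨B, hB, hBK, hjB⟩ := key (K.ferm i) (fun X hX k hkX hk => by
            have hk0 : k ≠ 0 := fun h => K.zero_notMem_underlying hX (h ▸ hkX)
            obtain ⟨-, ⟨i', rfl⟩ | hB⟩ := K.mem_underlying.1 hX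
            · rw [K.ferm_unique hk0 hk (mem_of_mem_erase hkX)]
              exact erase_subset _ _
            · exact (K.not_ferm_bos hB hk hkX).elim) j hj hj0
          (fun i' h => hL (by
            rw [K.ferm_unique hj0 hj (mem_inter.1 h).1]; exact (mem_inter.1 h).2))
        exact ⟨B, ⟨hB, hBK⟩, hjB⟩
    · rintro (h | ⟨B, ⟨-, hB⟩, hj⟩)
      · exact (mem_inter.1 h).1
      · exact hB hj
  · intro C hC
    refine ⟨(K.meet L).bos.filter (· ⊆ C), filter_subset _ _, ?_⟩
    ext j
    simp only [mem_biUnion, mem_filter, id]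
    constructor
    · intro hj
      obtain ⟨B, hB, hBK, hjB⟩ := key C (fun X hX k hkX hk => by
          rw [K.eq_of_mem_underlying hX (K.mem_underlying.2 ⟨⟨k, hk⟩, Or.inr hC⟩) hkX hk]) j hj
        (fun h => K.zero_notMem_bos C hC (h ▸ hj))
        (fun i h => K.not_ferm_bos hC (mem_inter.1 h).1 hj)
      exact ⟨B, ⟨hB, hBK⟩, hjB⟩
    · rintro ⟨B, ⟨-, hB⟩, hj⟩
      exact hB hj

lemma StronglyFiner.ferm_subset {N K : PartialSetSupercomposition n m} (h : StronglyFiner N K)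
    (i : Fin m) : N.ferm i ⊆ K.ferm i := by
  obtain ⟨T, -, hT⟩ := h.1 i
  rw [hT]; exact subset_union_left

lemma StronglyFiner.subset_ferm {N K : PartialSetSupercomposition n m} (h : StronglyFiner N K)
    {P : Finset (Fin (n + 1))} (hP : P ∈ N.bos) {j : Fin (n + 1)} (hj : j ∈ P) {i : Fin m}
    (hi : j ∈ K.ferm i) : P ⊆ K.ferm i := by
  obtain ⟨T, hTN, hT⟩ := h.1 i
  rw [hT] at hi ⊢
  rcases mem_union.1 hi with hi | hi
  · exact (N.not_ferm_bos hP hi hj).elim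
  · obtain ⟨Q, hQ, hjQ⟩ := mem_biUnion.1 hi
    rw [N.bos_unique hP (hTN hQ) hj hjQ]
    exact fun x hx => mem_union_right _ (mem_biUnion.2 ⟨Q, hQ, hx⟩)

lemma StronglyFiner.subset_underlying {N K : PartialSetSupercomposition n m}
    (h : StronglyFiner N K) {P : Finset (Fin (n + 1))} (hP : P ∈ N.bos) {j : Fin (n + 1)}
    (hj : j ∈ P) {X : Finset (Fin (n + 1))} (hX : X ∈ K.underlying) (hjX : j ∈ X) : P ⊆ X := by
  obtain ⟨-, ⟨i, rfl⟩ | hB⟩ := K.mem_underlying.1 hX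
  · intro x hx
    exact mem_erase.2 ⟨fun h0 => N.zero_notMem_bos P hP (h0 ▸ hx),
      h.subset_ferm hP hj (mem_of_mem_erase hjX) hx⟩
  · obtain ⟨T, hTN, rfl⟩ := h.2 X hB
    obtain ⟨Q, hQ, hjQ⟩ := mem_biUnion.1 hjX
    rw [N.bos_unique hP (hTN hQ) hj hjQ]
    exact fun x hx => mem_biUnion.2 ⟨Q, hQ, hx⟩

/-- The explicit formula in `meet` is the greatest lower bound for strong coarsening. -/
lemma meet_isGreatest (K L : PartialSetSupercomposition n m) :
    StronglyFiner (K.meet L) K ∧ StronglyFiner (K.meet L) L ∧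
      ∀ N, StronglyFiner N K → StronglyFiner N L → StronglyFiner N (K.meet L) := by
  refine ⟨meet_left K L, meet_comm K L ▸ meet_left L K, fun N hK hL => ⟨fun i => ?_, ?_⟩⟩
  · refine ⟨N.bos.filter (· ⊆ K.ferm i ∩ L.ferm i), filter_subset _ _, ?_⟩
    ext j
    simp only [mem_union, mem_biUnion, mem_filter, id]
    constructor
    · intro hj
      have hj' := mem_inter.1 hj
      by_cases hN : j ∈ N.ferm i
      · exact Or.inl hN
      · have hj0 : j ≠ 0 := fun h => hN (h ▸ N.zero_mem_ferm i)
        obtain ⟨k, hk⟩ | ⟨P, hP, hjP⟩ := N.cover j hj0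
        · rw [K.ferm_unique hj0 hj'.1 (hK.ferm_subset k hk)]
          exact Or.inl hk
        · exact Or.inr ⟨P, ⟨hP, subset_inter (hK.subset_ferm hP hjP hj'.1)
            (hL.subset_ferm hP hjP hj'.2)⟩, hjP⟩
    · rintro (h | ⟨B, ⟨-, hB⟩, hj⟩)
      · exact mem_inter.2 ⟨hK.ferm_subset i h, hL.ferm_subset i h⟩
      · exact hB hj
  · intro B hB
    refine ⟨N.bos.filter (· ⊆ B), filter_subset _ _, ?_⟩
    ext j
    simp only [mem_biUnion, mem_filter, id]
    constructor
    · intro hj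
      have hj0 : j ≠ 0 := fun h => (K.meet L).zero_notMem_bos B hB (h ▸ hj)
      obtain ⟨X, hX, Y, hY, rfl⟩ := mem_image₂.1 (mem_of_mem_erase hB)
      have hj' := mem_sdiff.1 hj
      obtain ⟨k, hk⟩ | ⟨P, hP, hjP⟩ := N.cover j hj0
      · exact (hj'.2 (mem_biUnion.2 ⟨k, mem_univ k,
          mem_inter.2 ⟨hK.ferm_subset k hk, hL.ferm_subset k hk⟩⟩)).elim
      · refine ⟨P, ⟨hP, fun x hx => mem_sdiff.2 ⟨mem_inter.2
          ⟨hK.subset_underlying hP hjP hX (mem_inter.1 hj'.1).1 hx,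
            hL.subset_underlying hP hjP hY (mem_inter.1 hj'.1).2 hx⟩, fun hA => ?_⟩⟩, hjP⟩
        obtain ⟨k, -, hk⟩ := mem_biUnion.1 hA
        exact hj'.2 (mem_biUnion.2 ⟨k, mem_univ k, mem_inter.2
          ⟨hK.subset_ferm hP hx (mem_inter.1 hk).1 hjP,
            hL.subset_ferm hP hx (mem_inter.1 hk).2 hjP⟩⟩)
    · rintro ⟨P, ⟨-, hP⟩, hj⟩
      exact hP hj

/-- The monomial `θ_{a_1} ⋯ θ_{a_m} x_{b_1} ⋯ x_{b_n}` belongs to `M(K)`: `a_i = b_j` if and only if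
`j ∈ K_i`, and `b_i = b_j` if and only if `i` and `j` are in the same block of `K`. -/
def Contains (K : PartialSetSupercomposition n m) (a : Fin m → ℕ) (b : Fin n → ℕ) : Prop :=
  (∀ i j, a i = b j ↔ j.succ ∈ K.ferm i) ∧ ∀ i j, b i = b j ↔ K.SameBlock i.succ j.succ

/-- The unique `L` such that the monomial `θ_{a_1} ⋯ θ_{a_m} x_{b_1} ⋯ x_{b_n}` belongs to
`M(L)`. -/
def ofMonomial (a : Fin m ↪ ℕ) (b : Fin n → ℕ) : PartialSetSupercomposition n m where
  ferm i := insert 0 ((univ.filter fun j => b j = a i).image Fin.succ)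
  bos := (univ.filter fun j => ∀ i, a i ≠ b j).image
    fun j => (univ.filter fun k => b k = b j).image Fin.succ
  zero_mem_ferm i := by simp
  zero_notMem_bos := by simp [Fin.succ_ne_zero]
  bos_nonempty := by
    intro B hB
    obtain ⟨j, -, rfl⟩ := mem_image.1 hB
    exact ⟨j.succ, by simp⟩
  ferm_inter_ferm := by
    intro i k hik x hx
    simp only [mem_inter, mem_insert, mem_image, mem_filter, mem_univ, true_and] at hx
    obtain ⟨rfl | ⟨j, hj, rfl⟩, h⟩ := hx
    · simp
    · obtain h | ⟨j', hj', h⟩ := h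
      · exact (Fin.succ_ne_zero j h).elim
      · rw [Fin.succ_inj] at h
        subst h
        exact (hik (a.injective (hj.symm.trans hj'))).elim
  ferm_inter_bos := by
    intro i B hB
    obtain ⟨k, hk, rfl⟩ := mem_image.1 hB
    simp only [mem_filter, mem_univ, true_and] at hk
    refine disjoint_left.2 fun x hx hx' => ?_
    simp only [mem_insert, mem_image, mem_filter, mem_univ, true_and] at hx hx'
    obtain ⟨j, hj, rfl⟩ := hx'
    obtain h | ⟨j', hj', h⟩ := hx
    · exact Fin.succ_ne_zero j h
    · rw [Fin.succ_inj] at h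
      subst h
      exact hk i (hj'.symm.trans hj)
  bos_inter_bos := by
    intro B hB C hC hBC
    obtain ⟨k, -, rfl⟩ := mem_image.1 hB
    obtain ⟨l, -, rfl⟩ := mem_image.1 hC
    refine disjoint_left.2 fun x hx hx' => hBC ?_
    simp only [mem_image, mem_filter, mem_univ, true_and] at hx hx'
    obtain ⟨j, hj, rfl⟩ := hx
    obtain ⟨j', hj', h⟩ := hx'
    rw [Fin.succ_inj] at h
    subst h
    rw [hj.symm.trans hj']
  cover := by
    intro j hj
    obtain ⟨j, rfl⟩ := Fin.exists_succ_eq.2 hj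
    by_cases h : ∃ i, a i = b j
    · obtain ⟨i, hi⟩ := h
      exact Or.inl ⟨i, by simp [hi]⟩
    · push Not at h
      exact Or.inr ⟨_, mem_image.2 ⟨j, by simpa using h, rfl⟩, by simp⟩

lemma contains_iff (K : PartialSetSupercomposition n m) (a : Fin m ↪ ℕ) (b : Fin n → ℕ) :
    K.Contains a b ↔ K = ofMonomial a b := by
  constructor
  · rintro ⟨h1, h2⟩
    have hb : ∀ j, (∀ i, a i ≠ b j) → ∀ B ∈ K.bos, j.succ ∈ B →
        B = (univ.filter fun k => b k = b j).image Fin.succ := by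
      intro j hj B hB hjB
      ext x
      simp only [mem_image, mem_filter, mem_univ, true_and]
      constructor
      · intro hx
        obtain ⟨k, rfl⟩ := Fin.exists_succ_eq.2 fun h => K.zero_notMem_bos B hB (h ▸ hx)
        exact ⟨k, (h2 k j).2 (Or.inr ⟨B, hB, hx, hjB⟩), rfl⟩
      · rintro ⟨k, hk, rfl⟩
        obtain ⟨i, hi, hi'⟩ | ⟨C, hC, hkC, hjC⟩ := (h2 k j).1 hk
        · exact (hj i ((h1 i j).2 hi')).elim
        · rwa [K.bos_unique hB hC hjB hjC]
    ext i x
    · simp only [ofMonomial, mem_insert, mem_image, mem_filter, mem_univ, true_and]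
      constructor
      · intro hx
        by_cases h0 : x = 0
        · exact Or.inl h0
        · obtain ⟨j, rfl⟩ := Fin.exists_succ_eq.2 h0
          exact Or.inr ⟨j, ((h1 i j).2 hx).symm, rfl⟩
      · rintro (rfl | ⟨j, hj, rfl⟩)
        · exact K.zero_mem_ferm i
        · exact (h1 i j).1 hj.symm
    · rename Finset (Fin (n + 1)) => B
      simp only [ofMonomial, mem_image, mem_filter, mem_univ, true_and]
      constructor
      · intro hB
        obtain ⟨x, hx⟩ := K.bos_nonempty B hB
        obtain ⟨j, rfl⟩ := Fin.exists_succ_eq.2 fun h => K.zero_notMem_bos B hB (h ▸ hx)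
        have hj : ∀ i, a i ≠ b j := fun i h => K.not_ferm_bos hB ((h1 i j).1 h) hx
        exact ⟨j, hj, ((hb j hj B hB hx).trans (by ext; simp)).symm⟩
      · rintro ⟨j, hj, rfl⟩
        obtain ⟨i, hi⟩ | ⟨C, hC, hjC⟩ := K.cover j.succ (Fin.succ_ne_zero j)
        · exact (hj i ((h1 i j).2 hi)).elim
        · have := hb j hj C hC hjC
          rwa [← this]
  · rintro rfl
    refine ⟨fun i j => ?_, fun i j => ?_⟩
    · simp [ofMonomial, Fin.succ_ne_zero, eq_comm]
    · constructor
      · intro h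
        obtain ⟨k, hk⟩ | ⟨B, hB, hi⟩ := (ofMonomial a b).cover i.succ (Fin.succ_ne_zero i)
        · refine Or.inl ⟨k, hk, ?_⟩
          simp [ofMonomial, Fin.succ_ne_zero] at hk ⊢
          exact h.symm.trans hk
        · refine Or.inr ⟨B, hB, hi, ?_⟩
          simp only [ofMonomial, mem_image, mem_filter, mem_univ, true_and] at hB
          obtain ⟨l, hl, rfl⟩ := hB
          simp at hi ⊢
          exact h.symm.trans hi
      · rintro (⟨k, hi, hj⟩ | ⟨B, hB, hi, hj⟩)
        · simp [ofMonomial, Fin.succ_ne_zero] at hi hj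
          exact hi.trans hj.symm
        · simp only [ofMonomial, mem_image, mem_filter, mem_univ, true_and] at hB
          obtain ⟨l, hl, rfl⟩ := hB
          simp at hi hj
          exact hi.trans hj.symm

end PartialSetSupercomposition

/-- A set superpartition: a partial set supercomposition with `I_i ≠ I_j` and
`min (I_i \ I_j) < min (I_j \ I_i)` for `i < j`, where `min ∅ = 0` (the strict inequality implies
`I_i ≠ I_j`). When `I_i` or `I_j` is not fermionic, this condition already holds by the ordering
of the blocks, so it is only required for fermionic blocks. -/
@[ext]
structure SetSuperpartition (n m : ℕ) extends PartialSetSupercomposition n m where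
  sorted : ∀ i j, i < j →
    (if h : (ferm i \ ferm j).Nonempty then (ferm i \ ferm j).min' h else 0) <
      (if h : (ferm j \ ferm i).Nonempty then (ferm j \ ferm i).min' h else 0)

instance (n m : ℕ) : Finite (SetSuperpartition n m) :=
  Finite.of_injective (fun I => (I.ferm, I.bos)) fun I J h => by
    simp only [Prod.mk.injEq] at h
    exact SetSuperpartition.ext h.1 h.2

instance (n m : ℕ) : Fintype (SetSuperpartition n m) := Fintype.ofFinite _

/-- A superpartition `(Λ_1, …, Λ_m ; Λ_{m+1}, …, Λ_k)` of degree `n` and fermionic degree `m`: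
`anti` is the strictly decreasing sequence `Λ_1, …, Λ_m` (a component may be `0`), and `sym` is
the partition `Λ_{m+1}, …, Λ_k` into positive components. -/
@[ext]
structure Superpartition (n m : ℕ) where
  anti : Fin m → ℕ
  sym : Multiset ℕ
  anti_strict : StrictAnti anti
  sym_pos : ∀ k ∈ sym, 0 < k
  sum_eq : (∑ i, anti i) + sym.sum = n

instance (n m : ℕ) : Finite (Superpartition n m) := by
  have hle : ∀ Λ : Superpartition n m, ∀ i, Λ.anti i < n + 1 := fun Λ i => by
    have := single_le_sum (f := Λ.anti) (fun _ _ => Nat.zero_le _) (mem_univ i)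
    have := Λ.sum_eq
    omega
  have hs : ∀ Λ : Superpartition n m, Λ.sym.sum < n + 1 := fun Λ => by
    have := Λ.sum_eq
    omega
  let F : Superpartition n m → (Fin m → Fin (n + 1)) × (Σ k : Fin (n + 1), Nat.Partition k) :=
    fun Λ => (fun i => ⟨Λ.anti i, hle Λ i⟩, ⟨⟨Λ.sym.sum, hs Λ⟩, ⟨Λ.sym, Λ.sym_pos _, rfl⟩⟩)
  let G : (Fin m → Fin (n + 1)) × (Σ k : Fin (n + 1), Nat.Partition k) →
    (Fin m → ℕ) × Multiset ℕ := fun p => (fun i => p.1 i, p.2.2.parts)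
  refine Finite.of_injective F fun Λ Ω h => ?_
  have h' : G (F Λ) = G (F Ω) := congrArg G h
  simp only [G, F, Prod.mk.injEq] at h'
  exact Superpartition.ext h'.1 h'.2

instance (n m : ℕ) : Fintype (Superpartition n m) := Fintype.ofFinite _

/-- `I` is of type `Λ`, that is `Λ(I) = Λ`: the numbers `|I_i| - 1` of the fermionic blocks sort
to `Λ_1 > ⋯ > Λ_m` (so the fermionic blocks have different sizes) and the sizes of the
nonfermionic blocks sort to `Λ_{m+1}, …, Λ_k`. -/
def SetSuperpartition.HasType {n m : ℕ} (I : SetSuperpartition n m) (Λ : Superpartition n m) :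
    Prop :=
  univ.val.map (fun i => (I.ferm i).card - 1) = univ.val.map Λ.anti ∧
    I.bos.val.map Finset.card = Λ.sym

/-- The number `ε(I)` of adjacent transpositions needed to sort `(|I_1| - 1, …, |I_m| - 1)` in
decreasing order, that is the number of pairs of positions in the wrong order. -/
def SetSuperpartition.epsilon {n m : ℕ} (I : SetSuperpartition n m) : ℕ :=
  #{p : Fin m × Fin m | p.1 < p.2 ∧ (I.ferm p.1).card < (I.ferm p.2).card}

/-- `Λ!`, the product of the factorials of the components. -/
def Superpartition.factorial {n m : ℕ} (Λ : Superpartition n m) : ℕ :=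
  (∏ i, (Λ.anti i)!) * (Λ.sym.map Nat.factorial).prod

/-- `(-1)` to the number of inversions of the injective map `s` on `S`: if `S = {c_1 < ⋯ < c_m}`,
then `θ_{s(c_1)} ⋯ θ_{s(c_m)}` is this sign times the increasing product of the `θ_i`,
`i ∈ s(S)`. -/
def inversionSign (s : ℕ → ℕ) (S : Finset ℕ) : ℚ :=
  (-1) ^ #{p ∈ S ×ˢ S | p.1 < p.2 ∧ s p.2 < s p.1}

/-- Formal series in noncommuting `x_0, x_1, …` and anticommuting `θ_0, θ_1, …`, where each `x_i`
commutes with each `θ_j`. The value `f S w` is the coefficient of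
`θ_{c_1} ⋯ θ_{c_m} x_{w_1} ⋯ x_{w_n}`, where `S = {c_1 < ⋯ < c_m}` and `w = [w_1, …, w_n]`; these
are the distinct monomials up to the relations. -/
abbrev NCSuperSeries : Type := Finset ℕ → List ℕ → ℚ

/-- The action `x_i ↦ x_{s(i)}`, `θ_i ↦ θ_{s(i)}` of a permutation `s` of the indices. -/
def permAction (s : Equiv.Perm ℕ) (f : NCSuperSeries) : NCSuperSeries := fun S w =>
  inversionSign s (S.map s.symm.toEmbedding) * f (S.map s.symm.toEmbedding) (w.map s.symm)

/-- `sNCSym`: the series of bounded degree that are invariant under the permutations of the indices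
moving finitely many of them. -/
def sNCSym : Submodule ℚ NCSuperSeries where
  carrier := {f | (∃ N, ∀ S w, f S w ≠ 0 → S.card + w.length ≤ N) ∧
    ∀ s : Equiv.Perm ℕ, {i | s i ≠ i}.Finite → permAction s f = f}
  zero_mem' := ⟨⟨0, by simp⟩, fun s _ => by ext; simp [permAction]⟩
  add_mem' := by
    rintro f g ⟨⟨N, hN⟩, hf⟩ ⟨⟨M, hM⟩, hg⟩
    refine ⟨⟨max N M, fun S w h => ?_⟩, fun s hs => ?_⟩
    · by_cases h' : f S w = 0
      · exact le_max_of_le_right (hM S w (by simpa [h'] using h))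
      · exact le_max_of_le_left (hN S w h')
    · ext S w
      conv_rhs => rw [← hf s hs, ← hg s hs]
      simp [permAction, mul_add]
  smul_mem' := by
    rintro c f ⟨⟨N, hN⟩, hf⟩
    refine ⟨⟨N, fun S w h => hN S w fun h' => h (by simp [h'])⟩, fun s hs => ?_⟩
    ext S w
    conv_rhs => rw [← hf s hs]
    simp only [permAction, Pi.smul_apply, smul_eq_mul]
    ring

/-- `f` has bidegree `(n, m)`: each of its monomials has `n` variables `x` and `m` variables
`θ`. -/
def HasBidegree (n m : ℕ) (f : NCSuperSeries) : Prop :=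
  ∀ S w, f S w ≠ 0 → w.length = n ∧ S.card = m

/-- The formal sum of `c(a, b) θ_{a_1} ⋯ θ_{a_m} x_{b_1} ⋯ x_{b_n}` over all tuples `(a, b)`.
If `S = {c_1 < ⋯ < c_m}`, the words in the `θ_i` that are nonzero multiples of
`θ_{c_1} ⋯ θ_{c_m}` are the `θ_{c_{σ(1)}} ⋯ θ_{c_{σ(m)}} = sign(σ) θ_{c_1} ⋯ θ_{c_m}`. -/
def formalSum {n m : ℕ} (c : (Fin m ↪ ℕ) → (Fin n → ℕ) → ℚ) : NCSuperSeries := fun S w =>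
  if h : S.card = m ∧ w.length = n then
    ∑ σ : Equiv.Perm (Fin m), ((Equiv.Perm.sign σ : ℤ) : ℚ) *
      c (σ.toEmbedding.trans (S.orderEmbOfFin h.1).toEmbedding) (fun j => w.getD j 0)
  else 0

open scoped Classical in
/-- The monomial function `m_K`: the sum of the `θ_{a_1} ⋯ θ_{a_m} x_{b_1} ⋯ x_{b_n}` that belong
to `M(K)`. -/
def monomialFn {n m : ℕ} (K : PartialSetSupercomposition n m) : NCSuperSeries :=
  formalSum fun a b => if K.Contains a b then 1 else 0

open scoped Classical in
/-- The complete homogeneous function `h_K = ∑ c_u u`, over the monomials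
`u = θ_{a_1} ⋯ θ_{a_m} x_{b_1} ⋯ x_{b_n}` for which `{a_1, …, a_m} \ {b_1, …, b_n}` has at most one
element, where `c_u = (K ⊓ L)!` and `L` is given by `u ∈ M(L)`. -/
def homogeneousFn {n m : ℕ} (K : PartialSetSupercomposition n m) : NCSuperSeries :=
  formalSum fun a b =>
    if (univ.image a \ univ.image b).card ≤ 1 then
      ((K.meet (.ofMonomial a b)).blockFactorial : ℚ)
    else 0

/-- Formal series in commuting `x_0, x_1, …` and anticommuting `θ_0, θ_1, …`: the power series `f S`
is the coefficient of `θ_{c_1} ⋯ θ_{c_m}`, where `S = {c_1 < ⋯ < c_m}`. -/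
abbrev SuperSeries : Type := Finset ℕ → MvPowerSeries ℕ ℚ

namespace SuperSeries

/-- The product, determined by `θ_T θ_U = (-1)^{#{(t, u) ∈ T × U | u < t}} θ_{T ∪ U}` for disjoint
`T`, `U`, and `θ_T θ_U = 0` otherwise. -/
protected def mul (f g : SuperSeries) : SuperSeries := fun S =>
  ∑ T ∈ S.powerset, (-1 : MvPowerSeries ℕ ℚ) ^ #{p ∈ T ×ˢ (S \ T) | p.2 < p.1} * (f T * g (S \ T))

/-- The unit series. -/
protected def one : SuperSeries := fun S => if S = ∅ then 1 else 0

open scoped Classical in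
/-- The monomial symmetric function `m_Λ`: the sum, without repeated terms, of the
`θ_{a_1} ⋯ θ_{a_m} x_{a_1}^{Λ_1} ⋯ x_{a_m}^{Λ_m} x_{a_{m+1}}^{Λ_{m+1}} ⋯ x_{a_k}^{Λ_k}` with distinct
`a_1, …, a_k`. -/
def monomialFn {n m : ℕ} (Λ : Superpartition n m) : SuperSeries := fun S α =>
  if h : S.card = m then
    ∑ σ : Equiv.Perm (Fin m), ((Equiv.Perm.sign σ : ℤ) : ℚ) *
      if (∀ i, α (S.orderEmbOfFin h (σ i)) = Λ.anti i) ∧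
          (α.support \ S).val.map α = Λ.sym then 1 else 0
  else 0

/-- `h̃_k`, the sum of the `(Λ_1 + 1) m_Λ` with `Λ` of degree `k` and fermionic degree `1`. -/
def hTilde (k : ℕ) : SuperSeries :=
  ∑ Λ : Superpartition k 1, ((Λ.anti 0 : ℚ) + 1) • monomialFn Λ

/-- `h_r`, the sum of the `m_Λ` with `Λ` of degree `r` and fermionic degree `0`. -/
def hPlain (r : ℕ) : SuperSeries :=
  ∑ Λ : Superpartition r 0, monomialFn Λ

/-- The complete homogeneous symmetric function
`h_Λ = h̃_{Λ_1} ⋯ h̃_{Λ_m} h_{Λ_{m+1}} ⋯ h_{Λ_k}`. -/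
def homogeneousFn {n m : ℕ} (Λ : Superpartition n m) : SuperSeries :=
  (List.ofFn (fun i => hTilde (Λ.anti i)) ++
    (Λ.sym.sort (fun a b => b ≤ a)).map hPlain).foldr SuperSeries.mul SuperSeries.one

end SuperSeries

/-- The projection `ρ` that makes the `x_i` commute: the coefficient of `θ_S x^α` in `ρ(f)` is the
sum of the coefficients of the `θ_S x_{w_1} ⋯ x_{w_n}` in `f`, over all words `w` with content
`α`. -/
def rho : NCSuperSeries →ₗ[ℚ] SuperSeries where
  toFun f S α := ∑ w ∈ (Multiset.lists (Finsupp.toMultiset α)).toFinset, f S w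
  map_add' f g := by
    ext S α
    exact sum_add_distrib
  map_smul' c f := by
    ext S α
    exact (mul_sum _ _ _).symm

/-- `sSym`, the image of `sNCSym` under `ρ`. -/
def sSym : Submodule ℚ SuperSeries := sNCSym.map rho

/-- A bilinear form on `sNCSym` with `⟨m_I, h_J⟩ = (-1)^{C(m, 2)} n! δ_{I,J}`, where `(n, m)` is the
bidegree of `I` and `I`, `J` are arbitrary set superpartitions. -/
def IsNCForm (B : LinearMap.BilinForm ℚ sNCSym) : Prop :=
  ∀ I J : (Σ d : ℕ × ℕ, SetSuperpartition d.1 d.2), ∀ f g : sNCSym,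
    (f : NCSuperSeries) = monomialFn I.2.toPartialSetSupercomposition →
    (g : NCSuperSeries) = homogeneousFn J.2.toPartialSetSupercomposition →
    (I = J → B f g = (-1) ^ (I.1.2.choose 2) * (I.1.1)!) ∧ (I ≠ J → B f g = 0)

/-- A bilinear form on `sSym` with `⟨m_Λ, h_Ω⟩ = (-1)^{C(m, 2)} δ_{Λ,Ω}`, where `m` is the fermionic
degree of `Λ` and `Λ`, `Ω` are arbitrary superpartitions. -/
def IsSymForm (B : LinearMap.BilinForm ℚ sSym) : Prop :=
  ∀ Λ Ω : (Σ d : ℕ × ℕ, Superpartition d.1 d.2), ∀ f g : sSym,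
    (f : SuperSeries) = SuperSeries.monomialFn Λ.2 →
    (g : SuperSeries) = SuperSeries.homogeneousFn Ω.2 →
    (Λ = Ω → B f g = (-1) ^ (Λ.1.2.choose 2)) ∧ (Λ ≠ Ω → B f g = 0)

open scoped Classical in
/-- A lifting map: `ρ̃(m_Λ) = (Λ! / n!) ∑_{Λ(I) = Λ} (-1)^{ε(I)} m_I`. -/
def IsLifting (L : sSym →ₗ[ℚ] sNCSym) : Prop :=
  ∀ (n m : ℕ) (Λ : Superpartition n m) (f : sSym),
    (f : SuperSeries) = SuperSeries.monomialFn Λ →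
    (L f : NCSuperSeries) = ((Λ.factorial : ℚ) / (n ! : ℚ)) •
      ∑ I : SetSuperpartition n m with I.HasType Λ,
        (-1 : ℚ) ^ I.epsilon • monomialFn I.toPartialSetSupercomposition

end

noncomputable section

/-! ### Signs and alternating functions of injective tuples -/

/-! A monomial `θ_{a_1} ⋯ θ_{a_m} x_{b_1} ⋯ x_{b_n}` is an index function on the `m + n` positions
`Fin m ⊕ Fin n`, injective on the `θ`-positions, and its type `ofMonomial a b` is the kernel of this
function, with the `i`th `θ`-position in the role of the element `0` of the `i`th fermionic block.
Functions with the same kernel differ by a finitary permutation, so an invariant series is a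
function of kernels that alternates under permutations of the fermionic blocks. Such a function is
determined by its values at sorted points (`SortedAction.eq_sum_orbitSign`), and this gives the
basis of the `m_I`. The same principle, with exponents instead of kernels, gives the basis of the
`m_Λ`.

The meet is the intersection of kernels, hence `(K ⊓ L)!` counts the permutations of the positions
that preserve both kernels: it is the inner product of the indicator functions of two Young
subgroups (`blockFactorial_meet`). The coefficient `gram J I` of `m_I` in `h_J` is an alternating
sum of such numbers, and `m! * gram J I` is the inner product of the antisymmetrized indicators
(`sum_altYoung_mul`). Indicators of different Young subgroups are linearly independent, as is seen
by testing at permutations that cycle every block. So `gram` is symmetric and positive definite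
(`gram_comm`, `gram_pos`), the `h_J` form a second basis, and the form exists, is unique, and has
the matrix `(-1)^{C(m, 2)} n! gram` in the basis of the `h_J`. This proves the statements on
`sNCSym`.

For the lifting map the point is that it is adjoint to `ρ` (`IsLifting.apply_eq`). The signed sum of
the `m_I` of type `Λ` is the sum of all monomials whose exponents have type `Λ`
(`ncTypeSum_eq_sum`), and each commutative monomial of that type comes from `n!/Λ!` words
(`rho_ncTypeSum`); so `ρ ∘ ρ̃` is the identity. In the other basis, the sum of `(K ⊓ L)!` over the
words with given content factors over the blocks of `K` (`sum_blockFactorial_meet`), the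
antisymmetrization produces a determinant, and its Laplace expansion is the product that defines
`h_Λ`. Hence `ρ(h_I) = (-1)^{ε(I)} Λ! h_Λ` if `I` has type `Λ`, and `ρ(h_I) = 0` if two fermionic
blocks have the same size. Comparing the two computations gives the adjunction, and the isometry
follows from it and from `ρ ∘ ρ̃ = id`. -/

lemma sign_eq_neg_one_pow_inversions {m : ℕ} (σ : Equiv.Perm (Fin m)) :
    ((Equiv.Perm.sign σ : ℤ) : ℚ) =
      (-1) ^ #{p : Fin m × Fin m | p.1 < p.2 ∧ σ p.2 < σ p.1} := by
  rw [Equiv.Perm.sign_eq_prod_prod_Ioi, card_filter, ← prod_pow_eq_pow_sum, Fintype.prod_prod_type]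
  push_cast
  refine prod_congr rfl fun i _ => ?_
  rw [← prod_filter_mul_prod_filter_not univ (fun j => j ∈ Ioi i)]
  have h2 : ∏ j with j ∉ Ioi i, (-1 : ℚ) ^ (if i < j ∧ σ j < σ i then 1 else 0) = 1 :=
    prod_eq_one fun j hj => by
      have : ¬ i < j := by simpa using hj
      simp [this]
  rw [h2, mul_one]
  refine prod_congr (by ext; simp) fun j hj => ?_
  have hij : i < j := by simpa using hj
  have hne : σ i ≠ σ j := fun h => hij.ne (σ.injective h)
  rcases lt_or_gt_of_ne hne with h | h
  · simp [h, h.not_gt]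
  · simp [h, h.not_gt, hij]

lemma sort_comp_perm {m : ℕ} {κ : Type*} [LinearOrder κ] {f : Fin m → κ}
    (hf : Function.Injective f) (σ : Equiv.Perm (Fin m)) :
    Tuple.sort (f ∘ σ) = σ⁻¹ * Tuple.sort f := by
  have h := Tuple.comp_perm_comp_sort_eq_comp_sort (f := f) (σ := σ)
  have h' : σ * Tuple.sort (f ∘ σ) = Tuple.sort f := Equiv.ext fun i => hf (congrFun h i)
  rw [← h', inv_mul_cancel_left]

lemma sort_eq_one_of_strictMono {m : ℕ} {κ : Type*} [LinearOrder κ] {f : Fin m → κ}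
    (hf : StrictMono f) : Tuple.sort f = 1 :=
  Tuple.sort_eq_refl_iff_monotone.2 hf.monotone

lemma strictMono_comp_sort {m : ℕ} {κ : Type*} [LinearOrder κ] {f : Fin m → κ}
    (hf : Function.Injective f) : StrictMono (f ∘ Tuple.sort f) :=
  (Tuple.monotone_sort f).strictMono_of_injective (hf.comp (Tuple.sort f).injective)

/-- Since `f ∘ Tuple.sort f` increases, the inverse of the sorting permutation orders the positions
as `f` does, so both have the same inversions. -/
lemma sign_sort_eq {m : ℕ} {κ : Type*} [LinearOrder κ] {f : Fin m → κ}
    (hf : Function.Injective f) :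
    ((Equiv.Perm.sign (Tuple.sort f) : ℤ) : ℚ) =
      (-1) ^ #{p : Fin m × Fin m | p.1 < p.2 ∧ f p.2 < f p.1} := by
  rw [← Equiv.Perm.sign_inv, sign_eq_neg_one_pow_inversions]
  congr 2
  ext p
  have h : ∀ i j, (Tuple.sort f)⁻¹ i < (Tuple.sort f)⁻¹ j ↔ f i < f j := fun i j => by
    rw [← (strictMono_comp_sort hf).lt_iff_lt]
    simp
  simp only [mem_filter, h]

/-- The sign of a permutation as a rational number. -/
def sgn {m : ℕ} (σ : Equiv.Perm (Fin m)) : ℚ := ((Equiv.Perm.sign σ : ℤ) : ℚ)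

@[simp] lemma sgn_one {m : ℕ} : sgn (1 : Equiv.Perm (Fin m)) = 1 := by simp [sgn]
@[simp] lemma sgn_mul {m : ℕ} (σ τ : Equiv.Perm (Fin m)) : sgn (σ * τ) = sgn σ * sgn τ := by
  simp [sgn]
@[simp] lemma sgn_inv {m : ℕ} (σ : Equiv.Perm (Fin m)) : sgn σ⁻¹ = sgn σ := by simp [sgn]
@[simp] lemma sgn_mul_self {m : ℕ} (σ : Equiv.Perm (Fin m)) : sgn σ * sgn σ = 1 := by
  rw [← sgn_mul, sgn]
  simp
lemma sgn_swap {m : ℕ} {i j : Fin m} (h : i ≠ j) : sgn (Equiv.swap i j) = -1 := by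
  simp [sgn, Equiv.Perm.sign_swap h]

/-- The injective tuple `a ∘ σ`. -/
abbrev reindex {m : ℕ} (a : Fin m ↪ ℕ) (σ : Equiv.Perm (Fin m)) : Fin m ↪ ℕ :=
  σ.toEmbedding.trans a

lemma map_reindex {m : ℕ} (a : Fin m ↪ ℕ) (σ : Equiv.Perm (Fin m)) :
    univ.map (reindex a σ) = univ.map a := by
  rw [reindex, ← map_map, map_univ_equiv]

lemma reindex_mul {m : ℕ} (a : Fin m ↪ ℕ) (σ τ : Equiv.Perm (Fin m)) :
    reindex a (σ * τ) = reindex (reindex a σ) τ := rfl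

/-- The coefficient of `θ_{a_1} ⋯ θ_{a_m}`. -/
def altCoeff {m : ℕ} (F : Finset ℕ → ℚ) (a : Fin m ↪ ℕ) : ℚ :=
  sgn (Tuple.sort a) * F (univ.map a)

lemma altCoeff_reindex {m : ℕ} (F : Finset ℕ → ℚ) (a : Fin m ↪ ℕ) (σ : Equiv.Perm (Fin m)) :
    altCoeff F (reindex a σ) = sgn σ * altCoeff F a := by
  have : Tuple.sort (reindex a σ) = σ⁻¹ * Tuple.sort a := sort_comp_perm a.injective σ
  rw [altCoeff, altCoeff, map_reindex, this, sgn_mul, sgn_inv, mul_assoc]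

/-- The increasing enumeration of a finite set of natural numbers. -/
abbrev enumEmb {m : ℕ} (S : Finset ℕ) (h : S.card = m) : Fin m ↪ ℕ :=
  (S.orderEmbOfFin h).toEmbedding

lemma map_enumEmb {m : ℕ} (S : Finset ℕ) (h : S.card = m) : univ.map (enumEmb S h) = S := by
  ext x
  rw [← mem_coe, coe_map]
  simp

lemma altCoeff_enumEmb {m : ℕ} (F : Finset ℕ → ℚ) (S : Finset ℕ) (h : S.card = m) :
    altCoeff F (enumEmb S h) = F S := by
  have h1 : Tuple.sort (enumEmb S h) = 1 :=
    sort_eq_one_of_strictMono (S.orderEmbOfFin h).strictMono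
  rw [altCoeff, map_enumEmb, h1, sgn_one, one_mul]

lemma exists_eq_reindex_enumEmb {m : ℕ} (a : Fin m ↪ ℕ) (h : (univ.map a).card = m) :
    a = reindex (enumEmb (univ.map a) h) (Tuple.sort a)⁻¹ := by
  have h1 : a ∘ Tuple.sort a = (univ.map a).orderEmbOfFin h :=
    orderEmbOfFin_unique h (fun x => by simp) (strictMono_comp_sort a.injective)
  ext i
  have := congrFun h1 ((Tuple.sort a)⁻¹ i)
  simpa using this

lemma eq_of_altCoeff_eq {F G : Finset ℕ → ℚ} {S : Finset ℕ}
    (h : ∀ a : Fin S.card ↪ ℕ, altCoeff F a = altCoeff G a) : F S = G S := by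
  rw [← altCoeff_enumEmb F S rfl, h, altCoeff_enumEmb]

/-- Every tuple is a rearrangement of the increasing enumeration of its image; shifting the
summation variable by the sorting permutation produces the sign in `altCoeff`. Through this lemma
series defined on sorted `θ`-words are evaluated on all of them. -/
lemma altCoeff_altSum {m : ℕ} (c : (Fin m ↪ ℕ) → ℚ) (a : Fin m ↪ ℕ) :
    altCoeff (fun S => if h : S.card = m then ∑ σ, sgn σ * c (reindex (enumEmb S h) σ) else 0) a
      = ∑ σ, sgn σ * c (reindex a σ) := by
  have h : (univ.map a).card = m := by simp
  rw [altCoeff]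
  simp only [h, dite_true]
  conv_rhs => rw [exists_eq_reindex_enumEmb a h]
  rw [mul_sum]
  refine Fintype.sum_equiv (Equiv.mulLeft (Tuple.sort a)) _ _ fun σ => ?_
  simp only [Equiv.coe_mulLeft, ← reindex_mul, inv_mul_cancel_left, sgn_mul, mul_assoc]

lemma sum_sgn_reindex {m : ℕ} (c : (Fin m ↪ ℕ) → ℚ) (a : Fin m ↪ ℕ) (τ : Equiv.Perm (Fin m)) :
    ∑ σ, sgn σ * c (reindex (reindex a τ) σ) = sgn τ * ∑ σ, sgn σ * c (reindex a σ) := by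
  rw [mul_sum]
  refine Fintype.sum_equiv (Equiv.mulLeft τ) _ _ fun σ => ?_
  simp only [Equiv.coe_mulLeft, ← reindex_mul, sgn_mul, ← mul_assoc, sgn_mul_self, one_mul]

/-- For the increasing enumeration `e` of the image, the inversions of `s ∘ e` are those of `s` on
the image; passing from `e` to `a` contributes the sign of `Tuple.sort a`. -/
lemma inversionSign_map {m : ℕ} (s : Equiv.Perm ℕ) (a : Fin m ↪ ℕ) :
    sgn (Tuple.sort a) * inversionSign s (univ.map a) =
      sgn (Tuple.sort (a.trans s.toEmbedding)) := by
  have h : (univ.map a).card = m := by simp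
  set e := enumEmb (univ.map a) h with he
  have ha := exists_eq_reindex_enumEmb a h
  have h1 : inversionSign s (univ.map a) = sgn (Tuple.sort (e.trans s.toEmbedding)) := by
    rw [sgn, sign_sort_eq (e.trans s.toEmbedding).injective, inversionSign]
    congr 1
    symm
    refine card_bij (fun p _ => (e p.1, e p.2)) ?_ ?_ ?_
    · rintro ⟨i, j⟩ hp
      simp only [mem_filter, mem_univ, true_and] at hp
      simp only [mem_filter, mem_product]
      refine ⟨⟨?_, ?_⟩, ((univ.map a).orderEmbOfFin h).strictMono hp.1, hp.2⟩ <;>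
      exact orderEmbOfFin_mem _ h _
    · rintro ⟨i, j⟩ _ ⟨i', j'⟩ _ hp
      simp only [Prod.mk.injEq, EmbeddingLike.apply_eq_iff_eq] at hp
      simp [hp.1, hp.2]
    · rintro ⟨x, y⟩ hp
      simp only [mem_filter, mem_product] at hp
      have hr : ∀ x ∈ univ.map a, ∃ i, e i = x := fun x hx => by
        rw [← map_enumEmb (univ.map a) h] at hx
        obtain ⟨i, -, hi⟩ := mem_map.1 hx
        exact ⟨i, hi⟩
      obtain ⟨i, rfl⟩ := hr x hp.1.1
      obtain ⟨j, rfl⟩ := hr y hp.1.2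
      refine ⟨(i, j), ?_, rfl⟩
      simp only [mem_filter, mem_univ, true_and]
      exact ⟨((univ.map a).orderEmbOfFin h).lt_iff_lt.1 hp.2.1, hp.2.2⟩
  have h2 : Tuple.sort (a.trans s.toEmbedding) =
      Tuple.sort a * Tuple.sort (e.trans s.toEmbedding) := by
    have : (a.trans s.toEmbedding : Fin m → ℕ) = (e.trans s.toEmbedding) ∘ ⇑(Tuple.sort a)⁻¹ := by
      funext i
      exact congrArg (fun b : Fin m ↪ ℕ => s (b i)) ha
    rw [this, sort_comp_perm (e.trans s.toEmbedding).injective, inv_inv]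
  rw [h1, h2, sgn_mul]

/-! ### Coefficients of series in noncommuting variables -/

/-- The coefficient of `θ_{a_1} ⋯ θ_{a_m} x_{b_1} ⋯ x_{b_n}`. -/
def ncCoeff {n m : ℕ} (f : NCSuperSeries) (a : Fin m ↪ ℕ) (b : Fin n → ℕ) : ℚ :=
  altCoeff (fun S => f S (List.ofFn b)) a

lemma getD_ofFn {n : ℕ} (b : Fin n → ℕ) : (fun j : Fin n => (List.ofFn b).getD j 0) = b := by
  funext j
  simp [List.getD_eq_getElem?_getD]

lemma ncCoeff_formalSum {n m : ℕ} (c : (Fin m ↪ ℕ) → (Fin n → ℕ) → ℚ) (a : Fin m ↪ ℕ)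
    (b : Fin n → ℕ) : ncCoeff (formalSum c) a b = ∑ σ, sgn σ * c (reindex a σ) b := by
  rw [← altCoeff_altSum (fun a => c a b)]
  simp only [ncCoeff, formalSum, List.length_ofFn, and_true, getD_ofFn]
  rfl

lemma ncCoeff_reindex {n m : ℕ} (f : NCSuperSeries) (a : Fin m ↪ ℕ) (b : Fin n → ℕ)
    (σ : Equiv.Perm (Fin m)) : ncCoeff f (reindex a σ) b = sgn σ * ncCoeff f a b :=
  altCoeff_reindex _ _ _

lemma ncCoeff_add {n m : ℕ} (f g : NCSuperSeries) (a : Fin m ↪ ℕ) (b : Fin n → ℕ) :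
    ncCoeff (f + g) a b = ncCoeff f a b + ncCoeff g a b := by
  simp [ncCoeff, altCoeff, mul_add]

lemma ncCoeff_smul {n m : ℕ} (c : ℚ) (f : NCSuperSeries) (a : Fin m ↪ ℕ) (b : Fin n → ℕ) :
    ncCoeff (c • f) a b = c * ncCoeff f a b := by
  simp [ncCoeff, altCoeff]; ring

/-- `ncCoeff` as a linear functional. -/
def ncCoeffₗ {n m : ℕ} (a : Fin m ↪ ℕ) (b : Fin n → ℕ) : NCSuperSeries →ₗ[ℚ] ℚ where
  toFun f := ncCoeff f a b
  map_add' f g := ncCoeff_add f g a b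
  map_smul' c f := ncCoeff_smul c f a b

lemma ncCoeff_sum {n m : ℕ} {ι : Type*} (s : Finset ι) (f : ι → NCSuperSeries) (a : Fin m ↪ ℕ)
    (b : Fin n → ℕ) : ncCoeff (∑ i ∈ s, f i) a b = ∑ i ∈ s, ncCoeff (f i) a b :=
  map_sum (ncCoeffₗ a b) f s

lemma ncSeries_ext {f g : NCSuperSeries}
    (h : ∀ (n m : ℕ) (a : Fin m ↪ ℕ) (b : Fin n → ℕ), ncCoeff f a b = ncCoeff g a b) : f = g := by
  funext S w
  refine eq_of_altCoeff_eq (F := fun S => f S w) (G := fun S => g S w) fun a => ?_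
  have := h w.length S.card a w.get
  simpa [ncCoeff] using this

lemma ncCoeff_eq_zero_of_hasBidegree {n m n' m' : ℕ} {f : NCSuperSeries} (hf : HasBidegree n' m' f)
    (h : (n, m) ≠ (n', m')) (a : Fin m ↪ ℕ) (b : Fin n → ℕ) : ncCoeff f a b = 0 := by
  by_contra h0
  have := hf (univ.map a) (List.ofFn b) (fun h' => h0 (by simp [ncCoeff, altCoeff, h']))
  simp at this
  exact h (by simp [this])

lemma hasBidegree_formalSum {n m : ℕ} (c : (Fin m ↪ ℕ) → (Fin n → ℕ) → ℚ) :
    HasBidegree n m (formalSum c) := by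
  intro S w h
  by_contra h'
  exact h (by rw [formalSum, dif_neg fun h'' => h' h''.symm])

/-- The sign in `permAction` is the one that sorts the `θ`'s again. On coefficients indexed by words
in the `θ`'s the action is therefore plain substitution, without sign. -/
lemma ncCoeff_permAction {n m : ℕ} (s : Equiv.Perm ℕ) (f : NCSuperSeries) (a : Fin m ↪ ℕ)
    (b : Fin n → ℕ) : ncCoeff (permAction s f) a b =
      ncCoeff f (a.trans s.symm.toEmbedding) (s.symm ∘ b) := by
  have h : univ.map (a.trans s.symm.toEmbedding) = (univ.map a).map s.symm.toEmbedding :=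
    (map_map _ _ _).symm
  have h2 := inversionSign_map s (a.trans s.symm.toEmbedding)
  have h3 : (a.trans s.symm.toEmbedding).trans s.toEmbedding = a := by ext; simp
  rw [h3, h] at h2
  simp only [ncCoeff, altCoeff, permAction, h, List.map_ofFn]
  rw [← h2]
  have h4 : inversionSign s ((univ.map a).map s.symm.toEmbedding) *
      inversionSign s ((univ.map a).map s.symm.toEmbedding) = 1 := by
    rw [inversionSign, ← mul_pow]; simp
  linear_combination (sgn (Tuple.sort (a.trans s.symm.toEmbedding)) *
    f ((univ.map a).map s.symm.toEmbedding) (List.ofFn (s.symm ∘ b))) * h4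

lemma ncCoeff_perm {n m : ℕ} {f : NCSuperSeries} (hf : f ∈ sNCSym) (s : Equiv.Perm ℕ)
    (hs : {i | s i ≠ i}.Finite) (a : Fin m ↪ ℕ) (b : Fin n → ℕ) :
    ncCoeff f (a.trans s.toEmbedding) (s ∘ b) = ncCoeff f a b := by
  conv_lhs => rw [← hf.2 s hs]
  rw [ncCoeff_permAction]
  congr 1
  · ext; simp
  · funext; simp

lemma formalSum_mem_sNCSym {n m : ℕ} {c : (Fin m ↪ ℕ) → (Fin n → ℕ) → ℚ}
    (hc : ∀ (s : Equiv.Perm ℕ) a b, c (a.trans s.toEmbedding) (s ∘ b) = c a b) :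
    formalSum c ∈ sNCSym := by
  refine ⟨⟨n + m, fun S w h => ?_⟩, fun s _ => ncSeries_ext fun n' m' a b => ?_⟩
  · have := hasBidegree_formalSum c S w h
    omega
  · rw [ncCoeff_permAction]
    by_cases h : (n', m') = (n, m)
    · obtain ⟨rfl, rfl⟩ := Prod.mk.inj h
      rw [ncCoeff_formalSum, ncCoeff_formalSum]
      exact sum_congr rfl fun σ _ => congrArg (sgn σ * ·) (hc s.symm (reindex a σ) b)
    · have := hasBidegree_formalSum c
      rw [ncCoeff_eq_zero_of_hasBidegree this h, ncCoeff_eq_zero_of_hasBidegree this h]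

/-! ### Partial set supercompositions as kernels -/

/-- Injective tuples extend to finitary permutations; more generally two maps from a finite type
with the same kernel differ by a finitary permutation. -/
lemma exists_finitary_perm {X : Type*} [Fintype X] (u v : X → ℕ)
    (h : ∀ x y, u x = u y ↔ v x = v y) :
    ∃ s : Equiv.Perm ℕ, {i | s i ≠ i}.Finite ∧ s ∘ u = v := by
  classical
  let D : Finset ℕ := univ.image u ∪ univ.image v
  have hu : ∀ x, u x ∈ D := fun x => mem_union_left _ (mem_image_of_mem _ (mem_univ _))
  have hv : ∀ x, v x ∈ D := fun x => mem_union_right _ (mem_image_of_mem _ (mem_univ _))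
  let p : D → Prop := fun d => ∃ x, u x = d
  let q : D → Prop := fun d => ∃ x, v x = d
  let F : {d // p d} → {d // q d} := fun d => ⟨⟨v d.2.choose, hv _⟩, d.2.choose, rfl⟩
  have hF : ∀ x, (F ⟨⟨u x, hu x⟩, x, rfl⟩ : ℕ) = v x := fun x => by
    have hp : p ⟨u x, hu x⟩ := ⟨x, rfl⟩
    exact (h _ _).1 hp.choose_spec
  have hbij : Function.Bijective F := by
    constructor
    · rintro ⟨⟨d, hd⟩, x, hx⟩ ⟨⟨e, he⟩, y, hy⟩ hde
      dsimp at hx hy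
      subst hx hy
      have h1 := congrArg (fun t : {d // q d} => (t : ℕ)) hde
      simp only [hF] at h1
      have := (h x y).2 h1
      simp [this]
    · rintro ⟨⟨d, hd⟩, x, hx⟩
      dsimp at hx
      subst hx
      exact ⟨⟨⟨u x, hu x⟩, x, rfl⟩, Subtype.ext (Subtype.ext (hF x))⟩
  -- `F` identifies the images of `u` and `v` inside the finite set `D`; it extends to a permutation
  -- of `D`, and then by the identity to `ℕ`.
  let e : Equiv.Perm D := (Equiv.ofBijective F hbij).extendSubtype
  refine ⟨Equiv.Perm.ofSubtype e, D.finite_toSet.subset fun i hi => ?_, funext fun x => ?_⟩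
  · by_contra hD
    exact hi (Equiv.Perm.ofSubtype_apply_of_not_mem e hD)
  · rw [Function.comp_apply, Equiv.Perm.ofSubtype_apply_of_mem e (hu x)]
    have : e ⟨u x, hu x⟩ = F ⟨⟨u x, hu x⟩, x, rfl⟩ :=
      Equiv.extendSubtype_apply_of_mem (Equiv.ofBijective F hbij) _ ⟨x, rfl⟩
    rw [this, hF]

namespace PartialSetSupercomposition

variable {n m : ℕ}

lemma sameBlock_ofMonomial (a : Fin m ↪ ℕ) (b : Fin n → ℕ) (i j : Fin n) :
    (ofMonomial a b).SameBlock i.succ j.succ ↔ b i = b j :=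
  ((((contains_iff _ a b).2 rfl).2) i j).symm

lemma mem_ferm_ofMonomial (a : Fin m ↪ ℕ) (b : Fin n → ℕ) (i : Fin m) (j : Fin n) :
    j.succ ∈ (ofMonomial a b).ferm i ↔ a i = b j :=
  ((((contains_iff _ a b).2 rfl).1) i j).symm

lemma ofMonomial_eq_iff {a a' : Fin m ↪ ℕ} {b b' : Fin n → ℕ} :
    ofMonomial a b = ofMonomial a' b' ↔
      (∀ i j, a i = b j ↔ a' i = b' j) ∧ ∀ i j, b i = b j ↔ b' i = b' j := by
  rw [← contains_iff]
  simp only [Contains, mem_ferm_ofMonomial, sameBlock_ofMonomial]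
  simp only [iff_comm]

/-- The type records no relation between two `θ`-positions, but none is lost, because `a` and `a'`
are injective. -/
lemma ofMonomial_eq_iff_kernel {a a' : Fin m ↪ ℕ} {b b' : Fin n → ℕ} :
    ofMonomial a b = ofMonomial a' b' ↔
      ∀ x y, Sum.elim a b x = Sum.elim a b y ↔ Sum.elim a' b' x = Sum.elim a' b' y := by
  rw [ofMonomial_eq_iff]
  constructor
  · rintro ⟨h1, h2⟩ (i | i) (j | j)
    · simp
    · exact h1 i j
    · simpa [eq_comm] using h1 j i
    · exact h2 i j
  · exact fun h => ⟨fun i j => h (.inl i) (.inr j), fun i j => h (.inr i) (.inr j)⟩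

lemma ofMonomial_perm (s : Equiv.Perm ℕ) (a : Fin m ↪ ℕ) (b : Fin n → ℕ) :
    ofMonomial (a.trans s.toEmbedding) (s ∘ b) = ofMonomial a b := by
  rw [ofMonomial_eq_iff]
  simp

lemma exists_perm_of_ofMonomial_eq {a a' : Fin m ↪ ℕ} {b b' : Fin n → ℕ}
    (h : ofMonomial a b = ofMonomial a' b') :
    ∃ s : Equiv.Perm ℕ, {i | s i ≠ i}.Finite ∧ a.trans s.toEmbedding = a' ∧ s ∘ b = b' := by
  obtain ⟨s, hs, hsu⟩ := exists_finitary_perm _ _ (ofMonomial_eq_iff_kernel.1 h)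
  refine ⟨s, hs, ?_, ?_⟩
  · ext i
    exact congrFun hsu (.inl i)
  · funext i
    exact congrFun hsu (.inr i)

/-- Every partial set supercomposition comes from a monomial. -/
lemma exists_eq_ofMonomial (K : PartialSetSupercomposition n m) :
    ∃ (a : Fin m ↪ ℕ) (b : Fin n → ℕ), ofMonomial a b = K := by
  classical
  -- Each `x`-position is labelled by the index of its fermionic block or by its nonfermionic block.
  -- An injection of the labels into `ℕ` then yields the monomial, and also separates fermionic
  -- blocks that are equal to `{0}`.
  let lab : Fin n → Fin m ⊕ Finset (Fin (n + 1)) := fun j =>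
    if h : ∃ i, j.succ ∈ K.ferm i then .inl h.choose
    else .inr ((K.cover j.succ (Fin.succ_ne_zero j)).resolve_left h).choose
  have h1 : ∀ i j, j.succ ∈ K.ferm i ↔ lab j = .inl i := by
    intro i j
    constructor
    · intro h
      have h' : ∃ i, j.succ ∈ K.ferm i := ⟨i, h⟩
      simp only [lab, h', dite_true, Sum.inl.injEq]
      exact K.ferm_unique (Fin.succ_ne_zero j) h'.choose_spec h
    · intro h
      by_cases h' : ∃ i, j.succ ∈ K.ferm i
      · simp only [lab, h', dite_true, Sum.inl.injEq] at h
        exact h ▸ h'.choose_spec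
      · simp [lab, h'] at h
  have h2 : ∀ B ∈ K.bos, ∀ j : Fin n, j.succ ∈ B ↔ lab j = .inr B := by
    intro B hB j
    constructor
    · intro h
      have h' : ¬ ∃ i, j.succ ∈ K.ferm i := fun ⟨i, hi⟩ => K.not_ferm_bos hB hi h
      simp only [lab, h', dite_false, Sum.inr.injEq]
      have hs := ((K.cover j.succ (Fin.succ_ne_zero j)).resolve_left h').choose_spec
      exact K.bos_unique hs.1 hB hs.2 h
    · intro h
      by_cases h' : ∃ i, j.succ ∈ K.ferm i
      · simp [lab, h'] at h
      · simp only [lab, h', dite_false, Sum.inr.injEq] at h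
        have hs := ((K.cover j.succ (Fin.succ_ne_zero j)).resolve_left h').choose_spec
        exact h ▸ hs.2
  let e : Fin m ⊕ Finset (Fin (n + 1)) ↪ ℕ := Encodable.encode' _
  refine ⟨(Function.Embedding.inl.trans e), e ∘ lab, ?_⟩
  symm
  rw [← contains_iff]
  refine ⟨fun i j => ?_, fun i j => ?_⟩
  · rw [h1]
    simp [eq_comm]
  · simp only [Function.comp_apply, EmbeddingLike.apply_eq_iff_eq]
    constructor
    · intro h
      rcases hi : lab i with k | B
      · exact .inl ⟨k, (h1 _ _).2 hi, (h1 _ _).2 (h ▸ hi)⟩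
      · obtain ⟨k, hk⟩ | ⟨C, hC, hiC⟩ := K.cover i.succ (Fin.succ_ne_zero i)
        · rw [h1, hi] at hk
          cases hk
        · exact .inr ⟨C, hC, hiC, (h2 C hC j).2 (h ▸ (h2 C hC i).1 hiC)⟩
    · rintro (⟨k, hi, hj⟩ | ⟨B, hB, hi, hj⟩)
      · rw [(h1 _ _).1 hi, (h1 _ _).1 hj]
      · rw [(h2 B hB _).1 hi, (h2 B hB _).1 hj]

lemma sameBlock_meet (K L : PartialSetSupercomposition n m) (i j : Fin n) :
    (K.meet L).SameBlock i.succ j.succ ↔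
      K.SameBlock i.succ j.succ ∧ L.SameBlock i.succ j.succ := by
  have hU : ∀ K : PartialSetSupercomposition n m, K.SameBlock i.succ j.succ ↔
      ∃ X ∈ K.underlying, i.succ ∈ X ∧ j.succ ∈ X := by
    intro K
    constructor
    · rintro (⟨k, hi, hj⟩ | ⟨B, hB, hi, hj⟩)
      · have : i.succ ∈ (K.ferm k).erase 0 := mem_erase.2 ⟨Fin.succ_ne_zero i, hi⟩
        exact ⟨(K.ferm k).erase 0, K.mem_underlying.2 ⟨⟨_, this⟩, .inl ⟨k, rfl⟩⟩, this,
          mem_erase.2 ⟨Fin.succ_ne_zero j, hj⟩⟩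
      · exact ⟨B, K.mem_underlying.2 ⟨⟨_, hi⟩, .inr hB⟩, hi, hj⟩
    · rintro ⟨X, hX, hi, hj⟩
      obtain ⟨-, ⟨k, rfl⟩ | hB⟩ := K.mem_underlying.1 hX
      · exact .inl ⟨k, mem_of_mem_erase hi, mem_of_mem_erase hj⟩
      · exact .inr ⟨X, hB, hi, hj⟩
  constructor
  · rintro (⟨k, hi, hj⟩ | ⟨B, hB, hi, hj⟩)
    · have hi' := mem_inter.1 hi
      have hj' := mem_inter.1 hj
      exact ⟨.inl ⟨k, hi'.1, hj'.1⟩, .inl ⟨k, hi'.2, hj'.2⟩⟩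
    · obtain ⟨X, hX, Y, hY, rfl⟩ := mem_image₂.1 (mem_of_mem_erase hB)
      simp only [mem_sdiff, mem_inter] at hi hj
      exact ⟨(hU K).2 ⟨X, hX, hi.1.1, hj.1.1⟩, (hU L).2 ⟨Y, hY, hi.1.2, hj.1.2⟩⟩
  · rintro ⟨hK, hL⟩
    obtain ⟨X, hX, hiX, hjX⟩ := (hU K).1 hK
    obtain ⟨Y, hY, hiY, hjY⟩ := (hU L).1 hL
    have key : ∀ (K : PartialSetSupercomposition n m) (X : Finset (Fin (n + 1))),
        X ∈ K.underlying → i.succ ∈ X → j.succ ∈ X → ∀ k, i.succ ∈ K.ferm k ↔ j.succ ∈ K.ferm k := by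
      intro K X hX hi hj k
      obtain ⟨-, ⟨l, rfl⟩ | hB⟩ := K.mem_underlying.1 hX
      · have hi' := mem_of_mem_erase hi
        have hj' := mem_of_mem_erase hj
        constructor
        · intro h
          rwa [K.ferm_unique (Fin.succ_ne_zero i) h hi']
        · intro h
          rwa [K.ferm_unique (Fin.succ_ne_zero j) h hj']
      · exact ⟨fun h => (K.not_ferm_bos hB h hi).elim, fun h => (K.not_ferm_bos hB h hj).elim⟩
    -- Either `i` lies in a fermionic block of the meet, which needs the same index `k` on both
    -- sides, or it avoids all of them; `j` behaves in the same way since it shares its blocks with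
    -- `i`.
    by_cases h : ∃ k, i.succ ∈ K.ferm k ∩ L.ferm k
    · obtain ⟨k, hk⟩ := h
      have hk' := mem_inter.1 hk
      exact .inl ⟨k, hk, mem_inter.2 ⟨(key K X hX hiX hjX k).1 hk'.1,
        (key L Y hY hiY hjY k).1 hk'.2⟩⟩
    · have hm : i.succ ∈ (X ∩ Y) \ univ.biUnion fun i => K.ferm i ∩ L.ferm i :=
        mem_sdiff.2 ⟨mem_inter.2 ⟨hiX, hiY⟩, by simpa using h⟩
      have hm' : j.succ ∈ (X ∩ Y) \ univ.biUnion fun i => K.ferm i ∩ L.ferm i := by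
        refine mem_sdiff.2 ⟨mem_inter.2 ⟨hjX, hjY⟩, fun hj => h ?_⟩
        obtain ⟨k, -, hk⟩ := mem_biUnion.1 hj
        have hk' := mem_inter.1 hk
        exact ⟨k, mem_inter.2 ⟨(key K X hX hiX hjX k).2 hk'.1, (key L Y hY hiY hjY k).2 hk'.2⟩⟩
      exact .inr ⟨_, mem_erase.2 ⟨ne_empty_of_mem hm, mem_image₂.2 ⟨X, hX, Y, hY, rfl⟩⟩, hm, hm'⟩

/-- The meet of two monomial types is the type of the monomial in pairs of indices. -/
lemma meet_ofMonomial (a a' : Fin m ↪ ℕ) (b b' : Fin n → ℕ) :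
    (ofMonomial a b).meet (ofMonomial a' b') =
      ofMonomial ⟨fun i => Nat.pair (a i) (a' i), fun _ _ h => a.injective (Nat.pair_eq_pair.1 h).1⟩
        fun j => Nat.pair (b j) (b' j) := by
  rw [← contains_iff]
  refine ⟨fun i j => ?_, fun i j => ?_⟩
  · simp only [meet, mem_inter, mem_ferm_ofMonomial]
    exact Nat.pair_eq_pair
  · rw [sameBlock_meet, sameBlock_ofMonomial, sameBlock_ofMonomial, Nat.pair_eq_pair]

end PartialSetSupercomposition

/-! ### Sizes of blocks -/

/-- The stabilizer of a labelling is the product of the symmetric groups of its fibers. Any `D`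
containing the image will do, because an empty fiber contributes `0! = 1`. -/
lemma card_perm_comp_eq {X : Type*} [Fintype X] [DecidableEq X] {ι : Type*} [DecidableEq ι]
    (f : X → ι) (D : Finset ι) (hD : ∀ x, f x ∈ D) :
    #{π : Equiv.Perm X | f ∘ π = f} = ∏ c ∈ D, (#{x | f x = c})! := by
  have h := DomMulAct.stabilizer_card' f
  rw [Fintype.card_subtype] at h
  rw [h]
  simp only [Fintype.card_subtype]
  refine prod_subset (fun c hc => ?_) fun c _ hc => ?_
  · obtain ⟨x, -, rfl⟩ := mem_image.1 hc
    exact hD x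
  · rw [filter_false_of_mem, card_empty, Nat.factorial_zero]
    intro x _ hx
    exact hc (mem_image.2 ⟨x, mem_univ x, hx⟩)

/-- The content of a word: the exponent of the commutative image of `x_{b_1} ⋯ x_{b_n}`. -/
def content {ι : Type*} [Fintype ι] (b : ι → ℕ) : ℕ →₀ ℕ := ∑ j, Finsupp.single (b j) 1

lemma content_apply {ι : Type*} [Fintype ι] (b : ι → ℕ) (c : ℕ) :
    content b c = #{j | b j = c} := by
  simp [content, Finsupp.single_apply]

lemma mem_support_content {ι : Type*} [Fintype ι] (b : ι → ℕ) (c : ℕ) :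
    c ∈ (content b).support ↔ ∃ j, b j = c := by
  rw [Finsupp.mem_support_iff, content_apply, card_ne_zero]
  simp [Finset.Nonempty]

/-- The type of a monomial `θ_{a_1} ⋯ θ_{a_m} x^α`: the exponents of the `x_{a_i}`, and the multiset
of the other exponents. -/
def contentType {m : ℕ} (a : Fin m ↪ ℕ) (α : ℕ →₀ ℕ) : (Fin m → ℕ) × Multiset ℕ :=
  (fun i => α (a i), (α.support \ univ.map a).val.map α)

lemma contentType_reindex {m : ℕ} (a : Fin m ↪ ℕ) (α : ℕ →₀ ℕ) (σ : Equiv.Perm (Fin m)) :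
    contentType (reindex a σ) α = ((contentType a α).1 ∘ σ, (contentType a α).2) := by
  simp only [contentType, map_reindex]
  rfl

namespace PartialSetSupercomposition

variable {n m : ℕ}

/-- The sizes of the blocks, not counting the element `0`. -/
def blockType (K : PartialSetSupercomposition n m) : (Fin m → ℕ) × Multiset ℕ :=
  (fun i => (K.ferm i).card - 1, K.bos.val.map card)

lemma card_ferm_ofMonomial (a : Fin m ↪ ℕ) (b : Fin n → ℕ) (i : Fin m) :
    ((ofMonomial a b).ferm i).card = content b (a i) + 1 := by
  simp only [ofMonomial]
  rw [card_insert_of_notMem (by simp [Fin.succ_ne_zero]),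
    card_image_of_injective _ (Fin.succ_injective n), content_apply]

lemma bos_ofMonomial (a : Fin m ↪ ℕ) (b : Fin n → ℕ) :
    (ofMonomial a b).bos = ((content b).support \ univ.map a).image
      fun c => (univ.filter fun k => b k = c).image Fin.succ := by
  ext B
  simp only [ofMonomial, mem_image, mem_filter, mem_univ, true_and, mem_sdiff, mem_support_content,
    mem_map, not_exists]
  constructor
  · rintro ⟨j, hj, rfl⟩
    exact ⟨b j, ⟨⟨j, rfl⟩, hj⟩, rfl⟩
  · rintro ⟨c, ⟨⟨j, rfl⟩, hc⟩, rfl⟩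
    exact ⟨j, hc, rfl⟩

lemma bos_ofMonomial_injOn (a : Fin m ↪ ℕ) (b : Fin n → ℕ) :
    Set.InjOn (fun c => (univ.filter fun k => b k = c).image Fin.succ)
      (((content b).support \ univ.map a : Finset ℕ) : Set ℕ) := by
  intro c hc d hd h
  obtain ⟨j, rfl⟩ := (mem_support_content b c).1 (mem_sdiff.1 (mem_coe.1 hc)).1
  have : j.succ ∈ (univ.filter fun k => b k = d).image Fin.succ := by
    dsimp only at h
    rw [← h]
    simp
  simpa using this

lemma card_bos_ofMonomial (b : Fin n → ℕ) (c : ℕ) :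
    ((univ.filter fun k => b k = c).image Fin.succ).card = content b c := by
  rw [card_image_of_injective _ (Fin.succ_injective n), content_apply]

lemma blockType_ofMonomial (a : Fin m ↪ ℕ) (b : Fin n → ℕ) :
    (ofMonomial a b).blockType = contentType a (content b) := by
  rw [blockType, contentType, bos_ofMonomial, image_val_of_injOn (bos_ofMonomial_injOn a b),
    Multiset.map_map]
  simp only [card_ferm_ofMonomial, Nat.add_sub_cancel, Function.comp_def, card_bos_ofMonomial]

lemma blockFactorial_ofMonomial (a : Fin m ↪ ℕ) (b : Fin n → ℕ) :
    (ofMonomial a b).blockFactorial =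
      (∏ i, (content b (a i) + 1)!) * ∏ c ∈ (content b).support \ univ.map a, (content b c)! := by
  rw [blockFactorial, bos_ofMonomial, prod_image (bos_ofMonomial_injOn a b)]
  simp only [card_ferm_ofMonomial, card_bos_ofMonomial]

lemma card_sumElim_fiber (a : Fin m ↪ ℕ) (b : Fin n → ℕ) (c : ℕ) :
    #{x | Sum.elim a b x = c} = content b c + if c ∈ univ.map a then 1 else 0 := by
  classical
  rw [card_filter, Fintype.sum_sum_type, add_comm, content_apply, card_filter]
  congr 1
  split_ifs with h
  · obtain ⟨i, -, rfl⟩ := mem_map.1 h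
    rw [sum_eq_single i]
    · simp
    · exact fun j _ hj => if_neg fun h' => hj (a.injective h')
    · simp
  · refine sum_eq_zero fun i _ => if_neg fun h' => h ?_
    exact mem_map.2 ⟨i, mem_univ i, h'⟩

/-- The position `inl i` stands for the element `0` of the `i`th fermionic block, so the fibers of
the index function have the sizes of the blocks. This is why `0` has to count in `blockFactorial`.
-/
lemma blockFactorial_ofMonomial_eq_card (a : Fin m ↪ ℕ) (b : Fin n → ℕ) :
    (ofMonomial a b).blockFactorial =
      #{π : Equiv.Perm (Fin m ⊕ Fin n) | Sum.elim a b ∘ π = Sum.elim a b} := by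
  rw [card_perm_comp_eq _ (univ.map a ∪ (content b).support), blockFactorial_ofMonomial,
    ← union_sdiff_self_eq_union, prod_union disjoint_sdiff, prod_map]
  · simp only [card_sumElim_fiber]
    congr 1
    · simp
    · exact prod_congr rfl fun c hc => by rw [if_neg (mem_sdiff.1 hc).2, add_zero]
  · rintro (i | j)
    · exact mem_union_left _ (by simp)
    · exact mem_union_right _ ((mem_support_content _ _).2 ⟨j, rfl⟩)

/-- `(K ⊓ L)!` counts the permutations that preserve the blocks of both `K` and `L`. -/
lemma blockFactorial_meet_ofMonomial (a a' : Fin m ↪ ℕ) (b b' : Fin n → ℕ) :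
    ((ofMonomial a b).meet (ofMonomial a' b')).blockFactorial =
      #{π : Equiv.Perm (Fin m ⊕ Fin n) | Sum.elim a b ∘ π = Sum.elim a b ∧
        Sum.elim a' b' ∘ π = Sum.elim a' b'} := by
  rw [meet_ofMonomial, blockFactorial_ofMonomial_eq_card]
  congr 1
  ext π
  have h : ∀ x, Sum.elim (⇑(⟨fun i => Nat.pair (a i) (a' i), fun _ _ h =>
      a.injective (Nat.pair_eq_pair.1 h).1⟩ : Fin m ↪ ℕ)) (fun j => Nat.pair (b j) (b' j)) x =
      Nat.pair (Sum.elim a b x) (Sum.elim a' b' x) := by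
    rintro (i | j) <;> rfl
  simp only [mem_filter, mem_univ, true_and, funext_iff, Function.comp_apply, h, Nat.pair_eq_pair,
    forall_and]

/-- The action of a permutation of the fermionic blocks. -/
def permFerm (σ : Equiv.Perm (Fin m)) (K : PartialSetSupercomposition n m) :
    PartialSetSupercomposition n m where
  ferm i := K.ferm (σ i)
  bos := K.bos
  zero_mem_ferm i := K.zero_mem_ferm _
  zero_notMem_bos := K.zero_notMem_bos
  bos_nonempty := K.bos_nonempty
  ferm_inter_ferm i j h := K.ferm_inter_ferm _ _ fun h' => h (σ.injective h')
  ferm_inter_bos i := K.ferm_inter_bos _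
  bos_inter_bos := K.bos_inter_bos
  cover j hj := (K.cover j hj).imp (fun ⟨i, hi⟩ => ⟨σ.symm i, by simpa using hi⟩) id

lemma permFerm_ofMonomial (σ : Equiv.Perm (Fin m)) (a : Fin m ↪ ℕ) (b : Fin n → ℕ) :
    permFerm σ (ofMonomial a b) = ofMonomial (reindex a σ) b := by
  ext1
  · rfl
  · ext B
    simp only [permFerm, bos_ofMonomial, map_reindex]

end PartialSetSupercomposition

/-! ### Alternating functions are determined by their values at sorted points -/

/-- An action of the permutations of `Fin m` on `T`, where the points with strictly increasing key
are listed by `J`, at least among those satisfying `P`, and a point with two equal keys is fixed by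
the corresponding transposition. -/
structure SortedAction (m : ℕ) (T J : Type*) where
  act : Equiv.Perm (Fin m) → T → T
  key : T → Fin m → ℤ
  incl : J → T
  P : T → Prop
  act_one : ∀ t, act 1 t = t
  key_act : ∀ σ t, key (act σ t) = key t ∘ σ
  act_swap : ∀ t i j, i ≠ j → key t i = key t j → act (Equiv.swap i j) t = t
  incl_injective : Function.Injective incl
  key_incl : ∀ j, StrictMono (key (incl j))
  P_act : ∀ σ t, P t → P (act σ t)
  surj : ∀ t, P t → StrictMono (key t) → ∃ j, incl j = t

namespace SortedAction

variable {m : ℕ} {T J : Type*} (X : SortedAction m T J)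

open scoped Classical in
/-- The value at `t` of the alternating function supported on the orbit of the point `j`. -/
def orbitSign (t : T) (j : J) : ℚ := ∑ σ, sgn σ * if X.act σ t = X.incl j then 1 else 0

/-- The keys at `X.incl j` increase strictly, so `σ` sorts the key of `t`, and a key without
repetitions has only one sorting permutation. -/
lemma key_injective_of_act_eq {t : T} {σ : Equiv.Perm (Fin m)} {j : J}
    (h : X.act σ t = X.incl j) : Function.Injective (X.key t) ∧ σ = Tuple.sort (X.key t) := by
  have h1 := X.key_incl j
  rw [← h, X.key_act] at h1
  have hinj : Function.Injective (X.key t) := by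
    have := h1.injective.comp σ.symm.injective
    simpa [Function.comp_def] using this
  refine ⟨hinj, Equiv.ext fun i => hinj ?_⟩
  exact congrFun (Tuple.comp_sort_eq_comp_iff_monotone.2 h1.monotone) i

lemma orbitSign_eq [DecidableEq J] {t : T} {σ : Equiv.Perm (Fin m)} {j : J}
    (h : X.act σ t = X.incl j) (k : J) : X.orbitSign t k = if k = j then sgn σ else 0 := by
  classical
  have hσ := (X.key_injective_of_act_eq h).2
  rw [orbitSign, sum_eq_single σ]
  · rw [h]
    by_cases hk : k = j
    · simp [hk]
    · rw [if_neg fun h' => hk (X.incl_injective h').symm, if_neg hk, mul_zero]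
  · intro τ _ hτ
    rw [if_neg, mul_zero]
    exact fun h' => hτ ((X.key_injective_of_act_eq h').2.trans hσ.symm)
  · simp

lemma orbitSign_incl [DecidableEq J] (j k : J) :
    X.orbitSign (X.incl j) k = if k = j then 1 else 0 := by
  rw [X.orbitSign_eq (X.act_one _) k, sgn_one]

lemma exists_act_eq {t : T} (ht : X.P t) (h : Function.Injective (X.key t)) :
    ∃ j, X.act (Tuple.sort (X.key t)) t = X.incl j := by
  obtain ⟨j, hj⟩ := X.surj (X.act (Tuple.sort (X.key t)) t) (X.P_act _ _ ht) (by
    rw [X.key_act]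
    exact strictMono_comp_sort h)
  exact ⟨j, hj.symm⟩

/-- If the key of `t` is injective, sorting it leads to a single listed point and only that term
survives. If two keys coincide, the transposition fixes `t`, so `F t = -F t`, and no point of the
orbit is listed. -/
lemma eq_sum_orbitSign [Fintype J] {F : T → ℚ} {t : T} (ht : X.P t)
    (hF : ∀ σ, F (X.act σ t) = sgn σ * F t) : F t = ∑ j, F (X.incl j) * X.orbitSign t j := by
  classical
  by_cases h : Function.Injective (X.key t)
  · obtain ⟨j, hj⟩ := X.exists_act_eq ht h
    simp only [X.orbitSign_eq hj, mul_ite, mul_zero, sum_ite_eq', mem_univ, if_true]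
    rw [← hj, hF, mul_right_comm, sgn_mul_self, one_mul]
  · have h0 : ∀ j, X.orbitSign t j = 0 := fun j => sum_eq_zero fun σ _ => by
      rw [if_neg, mul_zero]
      exact fun h' => h (X.key_injective_of_act_eq h').1
    simp only [Function.Injective, not_forall] at h
    obtain ⟨i, j, hij, hne⟩ := h
    have := hF (Equiv.swap i j)
    rw [X.act_swap t i j hne hij, sgn_swap hne] at this
    simp only [h0, mul_zero, sum_const_zero]
    linarith

end SortedAction

/-! ### Set superpartitions as sorted points -/

namespace PartialSetSupercomposition

variable {n m : ℕ}

/-- The minimum of a set, with `min ∅ = 0`. -/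
def minOrZero (s : Finset (Fin (n + 1))) : Fin (n + 1) := if h : s.Nonempty then s.min' h else 0

/-- Distinct fermionic blocks meet in `{0}` only, so the ordering condition of a set superpartition
just compares the least nonzero elements of the blocks. -/
lemma ferm_sdiff_ferm (K : PartialSetSupercomposition n m) {i j : Fin m} (h : i ≠ j) :
    K.ferm i \ K.ferm j = (K.ferm i).erase 0 := by
  ext x
  simp only [mem_sdiff, mem_erase]
  constructor
  · rintro ⟨hi, hj⟩
    exact ⟨fun h0 => hj (h0 ▸ K.zero_mem_ferm j), hi⟩
  · rintro ⟨h0, hi⟩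
    exact ⟨hi, fun hj => h (K.ferm_unique h0 hi hj)⟩

/-- The least nonzero element of a fermionic block. -/
def fermKey (K : PartialSetSupercomposition n m) (i : Fin m) : ℤ :=
  ((minOrZero ((K.ferm i).erase 0) : Fin (n + 1)) : ℕ)

lemma minOrZero_lt_iff (s t : Finset (Fin (n + 1))) :
    ((minOrZero s : ℕ) : ℤ) < (minOrZero t : ℕ) ↔ minOrZero s < minOrZero t := by
  rw [Nat.cast_lt, Fin.lt_def]

lemma strictMono_fermKey_iff (K : PartialSetSupercomposition n m) :
    StrictMono K.fermKey ↔ ∀ i j, i < j →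
    (if h : (K.ferm i \ K.ferm j).Nonempty then (K.ferm i \ K.ferm j).min' h else 0) <
      (if h : (K.ferm j \ K.ferm i).Nonempty then (K.ferm j \ K.ferm i).min' h else 0) := by
  refine forall_congr' fun i => forall_congr' fun j => forall_congr' fun hij => ?_
  change _ ↔ minOrZero (K.ferm i \ K.ferm j) < minOrZero (K.ferm j \ K.ferm i)
  rw [K.ferm_sdiff_ferm hij.ne, K.ferm_sdiff_ferm hij.ne']
  exact minOrZero_lt_iff _ _

/-- A nonzero minimum would lie in two different fermionic blocks. Hence the common key is `0`, the
value for an empty set, and both blocks are `{0}`. -/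
lemma ferm_eq_of_fermKey_eq (K : PartialSetSupercomposition n m) {i j : Fin m} (hij : i ≠ j)
    (h : K.fermKey i = K.fermKey j) : K.ferm i = K.ferm j := by
  have h' : minOrZero ((K.ferm i).erase 0) = minOrZero ((K.ferm j).erase 0) :=
    Fin.ext (Nat.cast_injective (R := ℤ) h)
  have h0 : ∀ k, minOrZero ((K.ferm k).erase 0) = 0 → K.ferm k = {0} := by
    intro k hk
    by_cases hn : ((K.ferm k).erase 0).Nonempty
    · rw [minOrZero, dif_pos hn] at hk
      exact absurd hk (mem_erase.1 (min'_mem _ hn)).1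
    · rw [not_nonempty_iff_eq_empty, erase_eq_empty_iff] at hn
      exact hn.resolve_left (ne_empty_of_mem (K.zero_mem_ferm k))
  have hm : ∀ k, minOrZero ((K.ferm k).erase 0) ≠ 0 →
      minOrZero ((K.ferm k).erase 0) ∈ K.ferm k := by
    intro k hk
    by_cases hn : ((K.ferm k).erase 0).Nonempty
    · rw [minOrZero, dif_pos hn]
      exact mem_of_mem_erase (min'_mem _ hn)
    · exact absurd (by rw [minOrZero, dif_neg hn]) hk
  by_cases hk : minOrZero ((K.ferm i).erase 0) = 0
  · rw [h0 i hk, h0 j (h' ▸ hk)]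
  · exact absurd (K.ferm_unique hk (hm i hk) (h' ▸ hm j (h' ▸ hk))) hij

/-- Set superpartitions are the partial set supercompositions with sorted fermionic blocks. -/
def sortedAction (n m : ℕ) :
    SortedAction m (PartialSetSupercomposition n m) (SetSuperpartition n m) where
  act := permFerm
  key := fermKey
  incl := SetSuperpartition.toPartialSetSupercomposition
  P _ := True
  act_one _ := rfl
  key_act _ _ := rfl
  act_swap K i j hij h := by
    have h' := K.ferm_eq_of_fermKey_eq hij h
    ext1
    · funext k
      change K.ferm (Equiv.swap i j k) = K.ferm k
      by_cases hi : k = i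
      · rw [hi, Equiv.swap_apply_left, h']
      · by_cases hj : k = j
        · rw [hj, Equiv.swap_apply_right, h']
        · rw [Equiv.swap_apply_of_ne_of_ne hi hj]
    · rfl
  incl_injective I J h := by
    cases I; cases J; simp_all
  key_incl I := (strictMono_fermKey_iff _).2 I.sorted
  P_act _ _ _ := trivial
  surj K _ h := ⟨⟨K, (strictMono_fermKey_iff _).1 h⟩, rfl⟩

end PartialSetSupercomposition

open PartialSetSupercomposition

/-! ### The monomial functions form a basis -/

section Monomials

variable {n m : ℕ}

lemma monomialFn_mem_sNCSym (K : PartialSetSupercomposition n m) : monomialFn K ∈ sNCSym := by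
  classical
  unfold monomialFn
  refine formalSum_mem_sNCSym fun s a b => ?_
  have : K.Contains (a.trans s.toEmbedding) (s ∘ b) ↔ K.Contains a b := by
    rw [contains_iff, contains_iff, ofMonomial_perm]
  simp only [this]

lemma hasBidegree_monomialFn (K : PartialSetSupercomposition n m) :
    HasBidegree n m (monomialFn K) := hasBidegree_formalSum _

lemma ncCoeff_monomialFn (I : SetSuperpartition n m) (a : Fin m ↪ ℕ) (b : Fin n → ℕ) :
    ncCoeff (monomialFn I.toPartialSetSupercomposition) a b =
      (sortedAction n m).orbitSign (ofMonomial a b) I := by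
  classical
  rw [monomialFn, ncCoeff_formalSum, SortedAction.orbitSign]
  refine sum_congr rfl fun σ _ => ?_
  congr 1
  have : Contains I.toPartialSetSupercomposition (reindex a σ) b ↔
      (sortedAction n m).act σ (ofMonomial a b) = (sortedAction n m).incl I := by
    rw [contains_iff, ← permFerm_ofMonomial, eq_comm]
    rfl
  simp only [this]

namespace PartialSetSupercomposition

/-- The indices of the `θ`-variables of a monomial in `M(K)`. -/
def repA (K : PartialSetSupercomposition n m) : Fin m ↪ ℕ := K.exists_eq_ofMonomial.choose

/-- The indices of the `x`-variables of a monomial in `M(K)`. -/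
def repB (K : PartialSetSupercomposition n m) : Fin n → ℕ :=
  K.exists_eq_ofMonomial.choose_spec.choose

@[simp] lemma ofMonomial_rep (K : PartialSetSupercomposition n m) :
    ofMonomial K.repA K.repB = K := K.exists_eq_ofMonomial.choose_spec.choose_spec

end PartialSetSupercomposition

/-- Monomials of the same type are related by a finitary permutation, and `f` is invariant under it.
-/
lemma ncCoeff_rep_ofMonomial {f : NCSuperSeries} (hf : f ∈ sNCSym) (a : Fin m ↪ ℕ)
    (b : Fin n → ℕ) :
    ncCoeff f (ofMonomial a b).repA (ofMonomial a b).repB = ncCoeff f a b := by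
  obtain ⟨s, hs, ha, hb⟩ := exists_perm_of_ofMonomial_eq (ofMonomial_rep (ofMonomial a b)).symm
  rw [← ncCoeff_perm hf s hs a b, ha, hb]

/-- The coefficient at a representative alternates as a function of the type, so it is governed by
the set superpartitions, and the orbit signs are the coefficients of the `m_I`. -/
lemma ncCoeff_eq_sum {f : NCSuperSeries} (hf : f ∈ sNCSym) (a : Fin m ↪ ℕ) (b : Fin n → ℕ) :
    ncCoeff f a b = ∑ I : SetSuperpartition n m,
      ncCoeff f I.repA I.repB * ncCoeff (monomialFn I.toPartialSetSupercomposition) a b := by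
  have h := (sortedAction n m).eq_sum_orbitSign (F := fun K => ncCoeff f K.repA K.repB)
    (t := ofMonomial a b) trivial (fun σ => by
      change ncCoeff f (permFerm σ (ofMonomial a b)).repA (permFerm σ (ofMonomial a b)).repB = _
      rw [permFerm_ofMonomial, ncCoeff_rep_ofMonomial hf, ncCoeff_rep_ofMonomial hf,
        ncCoeff_reindex])
  rw [ncCoeff_rep_ofMonomial hf] at h
  rw [h]
  exact sum_congr rfl fun I _ => by rw [ncCoeff_monomialFn]; rfl

end Monomials

/-- A family with a dual family of functionals that spans is a basis. -/
def basisOfDual {ι V : Type*} [AddCommGroup V] [Module ℚ V] (v : ι → V)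
    (lam : ι → V →ₗ[ℚ] ℚ) (h : ∀ i, lam i (v i) = 1)
    (h0 : ∀ i j, i ≠ j → lam i (v j) = 0)
    (hs : ⊤ ≤ Submodule.span ℚ (Set.range v)) : Module.Basis ι ℚ V :=
  Module.Basis.mk (v := v) (by
    rw [linearIndependent_iff]
    intro l hl
    ext i
    have := congrArg (lam i) hl
    rw [Finsupp.linearCombination_apply, map_finsuppSum,
      Finsupp.sum_eq_single i (fun j _ hj => by rw [map_smul, h0 i j hj.symm, smul_zero])
        (fun _ => by simp)] at this
    simpa [h] using this) hs

@[simp] lemma basisOfDual_apply {ι V : Type*} [AddCommGroup V] [Module ℚ V]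
    (v : ι → V) (lam : ι → V →ₗ[ℚ] ℚ) (h : ∀ i, lam i (v i) = 1)
    (h0 : ∀ i j, i ≠ j → lam i (v j) = 0)
    (hs : ⊤ ≤ Submodule.span ℚ (Set.range v)) (i : ι) : basisOfDual v lam h h0 hs i = v i :=
  Module.Basis.mk_apply _ _ _

/-- The index type of the monomial basis of `sNCSym`. -/
abbrev BidegSetSuperpartition : Type := Σ d : ℕ × ℕ, SetSuperpartition d.1 d.2

/-- The monomial function as an element of `sNCSym`. -/
def ncMonomial (I : BidegSetSuperpartition) : sNCSym :=
  ⟨monomialFn I.2.toPartialSetSupercomposition, monomialFn_mem_sNCSym _⟩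

/-- The coefficient of `m_I`. -/
def ncDual (I : BidegSetSuperpartition) : sNCSym →ₗ[ℚ] ℚ :=
  (ncCoeffₗ I.2.repA I.2.repB).comp sNCSym.subtype

lemma ncDual_apply (I : BidegSetSuperpartition) (f : sNCSym) :
    ncDual I f = ncCoeff (f : NCSuperSeries) I.2.repA I.2.repB := rfl

open scoped Classical in
lemma ncDual_ncMonomial (I J : BidegSetSuperpartition) :
    ncDual I (ncMonomial J) = if I = J then 1 else 0 := by
  rw [ncDual_apply]
  obtain ⟨d, I⟩ := I
  obtain ⟨e, J⟩ := J
  by_cases hde : d = e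
  · subst hde
    rw [ncMonomial, ncCoeff_monomialFn, ofMonomial_rep]
    have := (sortedAction d.1 d.2).orbitSign_incl I J
    simp only [sortedAction] at this ⊢
    rw [this]
    simp [eq_comm]
  · rw [if_neg (by simp [hde])]
    exact ncCoeff_eq_zero_of_hasBidegree (hasBidegree_monomialFn _) (by simpa using hde) _ _

lemma eq_sum_ncMonomial_of_hasBidegree {n m : ℕ} {f : sNCSym}
    (hf : HasBidegree n m (f : NCSuperSeries)) :
    f = ∑ I : SetSuperpartition n m, ncDual ⟨(n, m), I⟩ f • ncMonomial ⟨(n, m), I⟩ := by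
  apply Subtype.ext
  refine ncSeries_ext fun n' m' a b => ?_
  simp only [AddSubmonoidClass.coe_finsetSum, SetLike.val_smul, ncCoeff_sum, ncCoeff_smul]
  by_cases h : (n', m') = (n, m)
  · obtain ⟨rfl, rfl⟩ := Prod.mk.inj h
    exact ncCoeff_eq_sum f.2 a b
  · rw [ncCoeff_eq_zero_of_hasBidegree hf h]
    refine (sum_eq_zero fun I _ => ?_).symm
    rw [ncMonomial, ncCoeff_eq_zero_of_hasBidegree (hasBidegree_monomialFn _) h, mul_zero]

/-- Bounded degree leaves finitely many bidegrees, each with finitely many set superpartitions; this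
is where the bound in the definition of `sNCSym` is needed. -/
lemma span_ncMonomial : ⊤ ≤ Submodule.span ℚ (Set.range ncMonomial) := by
  rintro f -
  obtain ⟨N, hN⟩ := f.2.1
  have : f = ∑ d ∈ range (N + 1) ×ˢ range (N + 1), ∑ I : SetSuperpartition d.1 d.2,
      ncDual ⟨d, I⟩ f • ncMonomial ⟨d, I⟩ := by
    apply Subtype.ext
    refine ncSeries_ext fun n m a b => ?_
    simp only [AddSubmonoidClass.coe_finsetSum, SetLike.val_smul, ncCoeff_sum, ncCoeff_smul]
    have h0 : ∀ d, d ≠ (n, m) → ∑ I : SetSuperpartition d.1 d.2,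
        ncDual ⟨d, I⟩ f * ncCoeff (ncMonomial ⟨d, I⟩ : NCSuperSeries) a b = 0 := by
      intro d hd
      refine sum_eq_zero fun I _ => ?_
      rw [ncMonomial, ncCoeff_eq_zero_of_hasBidegree (hasBidegree_monomialFn _) (by simpa using hd.symm),
        mul_zero]
    by_cases h : (n, m) ∈ range (N + 1) ×ˢ range (N + 1)
    · rw [sum_eq_single_of_mem _ h fun d _ hd => h0 d hd]
      exact ncCoeff_eq_sum f.2 a b
    · rw [sum_eq_zero fun d hd => h0 d fun h' => h (h' ▸ hd)]
      by_contra hne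
      have := hN (univ.map a) (List.ofFn b) (fun h' => hne (by simp [ncCoeff, altCoeff, h']))
      simp at this
      simp at h
      omega
  rw [this]
  exact Submodule.sum_mem _ fun d _ => Submodule.sum_mem _ fun I _ =>
    Submodule.smul_mem _ _ (Submodule.subset_span ⟨_, rfl⟩)

open scoped Classical in
/-- The monomial basis of `sNCSym`. -/
def ncMonomialBasis : Module.Basis BidegSetSuperpartition ℚ sNCSym :=
  basisOfDual ncMonomial ncDual (fun I => by simp [ncDual_ncMonomial])
    (fun I J h => by simp [ncDual_ncMonomial, h]) span_ncMonomial

@[simp] lemma ncMonomialBasis_apply (I : BidegSetSuperpartition) :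
    ncMonomialBasis I = ncMonomial I := basisOfDual_apply _ _ _ _ _ _

/-! ### Independence of the indicator functions of Young subgroups -/

/-- The permutation runs through each fiber of `u` in one cycle, so whatever is invariant under it
is constant on the fibers. -/
lemma exists_perm_cycle_fibers {X : Type*} [Fintype X] (u : X → ℕ) :
    ∃ π : Equiv.Perm X, u ∘ π = u ∧
      ∀ v : X → ℕ, v ∘ π = v → ∀ x y, u x = u y → v x = v y := by
  classical
  choose f hf _ using fun c : ℕ => (univ.filter fun x => u x = c).exists_cycleOn
  have hmem : ∀ c x, u (f c x) = c ↔ u x = c := fun c x => by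
    simpa using (hf c).apply_mem_iff (x := x)
  have hu : ∀ x, u (f (u x) x) = u x := fun x => (hmem _ _).2 rfl
  have hinj : Function.Injective fun x => f (u x) x := by
    intro x y h
    dsimp only at h
    have hxy : u x = u y := by rw [← hu x, ← hu y, h]
    rw [hxy] at h
    exact (f (u y)).injective h
  let π : Equiv.Perm X := Equiv.ofBijective _ (Finite.injective_iff_bijective.1 hinj)
  have hπ : ∀ x, π x = f (u x) x := fun _ => rfl
  refine ⟨π, funext hu, fun v hv x y hxy => ?_⟩
  obtain ⟨k, -, hk⟩ := (hf (u x)).exists_pow_eq (a := x) (b := y) (by simp) (by simp [hxy])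
  have hpow : ∀ k : ℕ, u ((f (u x) ^ k) x) = u x ∧ v ((f (u x) ^ k) x) = v x := by
    intro k
    induction k with
    | zero => simp
    | succ k ih =>
      rw [pow_succ', Equiv.Perm.mul_apply]
      refine ⟨(hmem _ _).2 ih.1, ?_⟩
      have := congrFun hv ((f (u x) ^ k) x)
      rw [Function.comp_apply, hπ, ih.1] at this
      rw [this, ih.2]
  rw [← hk, (hpow k).2]

/-- Take a maximally coarse kernel among those with nonzero coefficient and a permutation that
cycles each of its classes. A function invariant under this permutation has a kernel at least as
coarse, so only one term survives there. -/
lemma eq_zero_of_sum_comp_perm_eq_zero {X ι : Type*} [Fintype X] [Fintype ι] [DecidableEq X]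
    (u : ι → X → ℕ)
    (hu : ∀ k l, (∀ x y, u k x = u k y ↔ u l x = u l y) → k = l) (c : ι → ℚ)
    (hc : ∀ π : Equiv.Perm X, ∑ k, c k * (if u k ∘ π = u k then 1 else 0) = 0) : c = 0 := by
  classical
  by_contra hne
  obtain ⟨k₀, hk₀⟩ := Function.ne_iff.1 hne
  have hfin : (univ.filter fun k => c k ≠ 0).Nonempty := ⟨k₀, by simpa using hk₀⟩
  -- Coarseness is measured by the number of identified pairs: a kernel that contains another one
  -- and has no more pairs is equal to it.
  obtain ⟨k, hk, hmax⟩ := exists_max_image (univ.filter fun k => c k ≠ 0)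
    (fun k => #{p : X × X | u k p.1 = u k p.2}) hfin
  obtain ⟨π, hπ, hπv⟩ := exists_perm_cycle_fibers (u k)
  have h := hc π
  rw [sum_eq_single k] at h
  · simp [hπ] at h
    simp [h] at hk
  · intro l _ hl
    by_cases hcl : c l = 0
    · rw [hcl, zero_mul]
    · rw [if_neg, mul_zero]
      intro hlπ
      have hle := hπv _ hlπ
      have hsub : (univ.filter fun p : X × X => u k p.1 = u k p.2) ⊆
          univ.filter fun p : X × X => u l p.1 = u l p.2 := fun p hp => by
        simp only [mem_filter, mem_univ, true_and] at hp ⊢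
        exact hle _ _ hp
      have heq := eq_of_subset_of_card_le hsub (hmax l (by simpa using hcl))
      refine hl (hu l k fun x y => ?_)
      have := congrArg (fun s => (x, y) ∈ s) heq
      simp only [mem_filter, mem_univ, true_and, eq_iff_iff] at this
      exact this.symm
  · simp

namespace PartialSetSupercomposition

variable {n m : ℕ}

instance : Finite (PartialSetSupercomposition n m) :=
  Finite.of_injective (fun K => (K.ferm, K.bos)) fun K L h => by
    simp only [Prod.mk.injEq] at h
    exact PartialSetSupercomposition.ext h.1 h.2

instance : Fintype (PartialSetSupercomposition n m) := Fintype.ofFinite _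

/-- The indices of a monomial in `M(K)`. -/
abbrev rep (K : PartialSetSupercomposition n m) : Fin m ⊕ Fin n → ℕ := Sum.elim K.repA K.repB

/-- The indicator function of the permutations that preserve the blocks of `K`. -/
def young (K : PartialSetSupercomposition n m) (π : Equiv.Perm (Fin m ⊕ Fin n)) : ℚ :=
  if K.rep ∘ π = K.rep then 1 else 0

lemma young_ofMonomial (a : Fin m ↪ ℕ) (b : Fin n → ℕ) (π : Equiv.Perm (Fin m ⊕ Fin n)) :
    (ofMonomial a b).young π = if Sum.elim a b ∘ π = Sum.elim a b then 1 else 0 := by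
  have h := ofMonomial_eq_iff_kernel.1 (ofMonomial_rep (ofMonomial a b))
  simp only [young, funext_iff, Function.comp_apply, h]

lemma blockFactorial_meet (K L : PartialSetSupercomposition n m) :
    ((K.meet L).blockFactorial : ℚ) = ∑ π, K.young π * L.young π := by
  conv_lhs => rw [← ofMonomial_rep K, ← ofMonomial_rep L, blockFactorial_meet_ofMonomial]
  simp only [young, ← ite_and, mul_ite, mul_one, mul_zero, sum_boole, and_comm]

/-- Permuting the fermionic blocks relabels the `θ`-positions, which conjugates the Young subgroup.
-/
lemma young_permFerm (σ : Equiv.Perm (Fin m)) (K : PartialSetSupercomposition n m)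
    (π : Equiv.Perm (Fin m ⊕ Fin n)) :
    (permFerm σ K).young π =
      K.young (Equiv.sumCongr σ (Equiv.refl _) * π * (Equiv.sumCongr σ (Equiv.refl _) : Equiv.Perm (Fin m ⊕ Fin n))⁻¹) := by
  conv_lhs => rw [← ofMonomial_rep K, permFerm_ofMonomial, young_ofMonomial]
  rw [young]
  have h : Sum.elim (reindex K.repA σ) K.repB = K.rep ∘ (Equiv.sumCongr σ (Equiv.refl _)) := by
    funext x
    rcases x with i | j <;> rfl
  rw [h]
  congr 1
  rw [eq_iff_iff]
  constructor
  · intro h'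
    funext x
    have := congrFun h' ((Equiv.sumCongr σ (Equiv.refl _)).symm x)
    simpa using this
  · intro h'
    funext x
    have := congrFun h' ((Equiv.sumCongr σ (Equiv.refl _)) x)
    simpa using this

lemma permFerm_mul (σ τ : Equiv.Perm (Fin m)) (K : PartialSetSupercomposition n m) :
    permFerm (σ * τ) K = permFerm τ (permFerm σ K) := rfl

lemma sum_young_permFerm (σ : Equiv.Perm (Fin m)) (K L : PartialSetSupercomposition n m) :
    ∑ π, (permFerm σ K).young π * (permFerm σ L).young π = ∑ π, K.young π * L.young π := by
  simp only [young_permFerm]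
  exact Fintype.sum_equiv (MulAut.conj (Equiv.sumCongr σ (Equiv.refl _) : Equiv.Perm (Fin m ⊕ Fin n))).toEquiv
    _ _ fun π => rfl

/-- The antisymmetrization of `young` over the fermionic blocks. -/
def altYoung (K : PartialSetSupercomposition n m) (π : Equiv.Perm (Fin m ⊕ Fin n)) : ℚ :=
  ∑ σ, sgn σ * (permFerm σ K).young π

/-- The coefficient of `m_I` in `h_J`. -/
def gram (J I : PartialSetSupercomposition n m) : ℚ :=
  ∑ σ, sgn σ * ((J.meet (permFerm σ I)).blockFactorial : ℚ)

/-- The pairing of two indicators does not change when both arguments are permuted, so in the double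
sum only the relative permutation `ρ`, with `σ = ρ * τ`, matters; the factor `m!` counts the `τ`. -/
lemma sum_altYoung_mul (J I : PartialSetSupercomposition n m) :
    ∑ π, J.altYoung π * I.altYoung π = (m ! : ℚ) * gram J I := by
  simp only [altYoung, sum_mul_sum]
  rw [sum_comm]
  have h : ∀ τ : Equiv.Perm (Fin m), ∑ π, ∑ σ : Equiv.Perm (Fin m),
      sgn τ * (permFerm τ J).young π * (sgn σ * (permFerm σ I).young π) = gram J I := by
    intro τ
    rw [sum_comm, gram]
    symm
    refine Fintype.sum_equiv (Equiv.mulRight τ) _ _ fun ρ => ?_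
    rw [blockFactorial_meet, Equiv.coe_mulRight, ← sum_young_permFerm τ, mul_sum]
    refine sum_congr rfl fun π _ => ?_
    rw [permFerm_mul, sgn_mul]
    linear_combination (-sgn ρ * (permFerm τ J).young π *
      (permFerm τ (permFerm ρ I)).young π) * sgn_mul_self τ
  rw [sum_congr rfl fun τ _ => h τ]
  simp [Fintype.card_perm]

lemma gram_comm (J I : PartialSetSupercomposition n m) : gram J I = gram I J := by
  have h1 := sum_altYoung_mul J I
  have h2 := sum_altYoung_mul I J
  have h0 : (m ! : ℚ) ≠ 0 := by positivity
  refine mul_left_cancel₀ h0 ?_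
  rw [← h1, ← h2]
  exact sum_congr rfl fun π _ => mul_comm _ _

lemma eq_zero_of_sum_young_eq_zero {c : PartialSetSupercomposition n m → ℚ}
    (hc : ∀ π, ∑ K, c K * K.young π = 0) : c = 0 := by
  refine eq_zero_of_sum_comp_perm_eq_zero (fun K => K.rep) (fun K L h => ?_) c hc
  rw [← ofMonomial_rep K, ← ofMonomial_rep L]
  exact ofMonomial_eq_iff_kernel.2 h

/-- Rewritten in the independent functions `young K`, the combination has the coefficient `c I` at a
sorted `K = I`, because each orbit contains at most one sorted point and reaches it by the identity
only. -/
lemma eq_zero_of_sum_altYoung_eq_zero {c : SetSuperpartition n m → ℚ}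
    (hc : ∀ π, ∑ I, c I * altYoung I.toPartialSetSupercomposition π = 0) : c = 0 := by
  classical
  have h := eq_zero_of_sum_young_eq_zero (n := n) (m := m)
    (c := fun K => ∑ I : SetSuperpartition n m, c I *
      ∑ σ, sgn σ * if permFerm σ I.toPartialSetSupercomposition = K then 1 else 0) fun π => by
    refine Eq.trans ?_ (hc π)
    simp only [sum_mul]
    rw [sum_comm]
    refine sum_congr rfl fun I _ => ?_
    simp only [mul_assoc, ← mul_sum]
    congr 1
    simp only [altYoung, sum_mul]
    rw [sum_comm]
    refine sum_congr rfl fun σ _ => ?_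
    simp only [mul_assoc, ← mul_sum]
    congr 1
    simp
  funext I
  have hI := congrFun h I.toPartialSetSupercomposition
  have hδ : ∀ J : SetSuperpartition n m, (∑ σ, sgn σ *
      if permFerm σ J.toPartialSetSupercomposition = I.toPartialSetSupercomposition
        then (1 : ℚ) else 0) = if I = J then 1 else 0 := fun J => by
    rw [← (sortedAction n m).orbitSign_incl J I, SortedAction.orbitSign]
    refine sum_congr rfl fun σ _ => ?_
    simp only [sortedAction]
    congr
  simp only [hδ] at hI
  simpa using hI

/-- The matrix of the `h_J` in the `m_I` is positive definite. -/
lemma gram_pos {c : SetSuperpartition n m → ℚ} (hc : c ≠ 0) :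
    0 < ∑ J, ∑ I, c J * c I *
      gram J.toPartialSetSupercomposition I.toPartialSetSupercomposition := by
  have h0 : (0 : ℚ) < m ! := by positivity
  -- Up to the factor `m!` the quadratic form is a sum of squares over the permutations of the
  -- positions.
  have h : (m ! : ℚ) * ∑ J, ∑ I, c J * c I *
      gram J.toPartialSetSupercomposition I.toPartialSetSupercomposition =
      ∑ π, (∑ I, c I * altYoung I.toPartialSetSupercomposition π) ^ 2 := by
    simp only [sq, sum_mul_sum]
    rw [eq_comm, sum_comm, mul_sum]
    refine sum_congr rfl fun J _ => ?_
    rw [sum_comm, mul_sum]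
    refine sum_congr rfl fun I _ => ?_
    rw [mul_left_comm, ← sum_altYoung_mul, mul_sum]
    exact sum_congr rfl fun π _ => by ring
  refine pos_of_mul_pos_right (h ▸ ?_) h0.le
  refine lt_of_le_of_ne (sum_nonneg fun π _ => sq_nonneg _) fun h' => hc ?_
  refine eq_zero_of_sum_altYoung_eq_zero fun π => ?_
  have := (sum_eq_zero_iff_of_nonneg fun (π : Equiv.Perm (Fin m ⊕ Fin n)) _ =>
    sq_nonneg (∑ I, c I * altYoung I.toPartialSetSupercomposition π)).1 h'.symm π (mem_univ _)
  exact pow_eq_zero_iff (two_ne_zero) |>.1 this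

end PartialSetSupercomposition

/-! ### Bases in block form and dual pairs of bases -/

section Blocks

variable {D V : Type*} {J : D → Type*} [∀ d, Fintype (J d)] [AddCommGroup V] [Module ℚ V]

/-- The family obtained from a basis by a block diagonal matrix. -/
def blockFamily (b : Module.Basis (Σ d, J d) ℚ V) (A : ∀ d, Matrix (J d) (J d) ℚ)
    (x : Σ d, J d) : V := ∑ i, A x.1 x.2 i • b ⟨x.1, i⟩

lemma coord_blockFamily (b : Module.Basis (Σ d, J d) ℚ V) (A : ∀ d, Matrix (J d) (J d) ℚ)
    (d : D) (i j : J d) : b.coord ⟨d, i⟩ (blockFamily b A ⟨d, j⟩) = A d j i := by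
  rw [blockFamily, map_sum, sum_eq_single i]
  · simp
  · intro k _ hk
    simp [hk]
  · simp

lemma coord_blockFamily_of_ne (b : Module.Basis (Σ d, J d) ℚ V)
    (A : ∀ d, Matrix (J d) (J d) ℚ) {d e : D} (h : d ≠ e) (i : J d) (j : J e) :
    b.coord ⟨d, i⟩ (blockFamily b A ⟨e, j⟩) = 0 := by
  rw [blockFamily, map_sum]
  refine sum_eq_zero fun k _ => ?_
  have hne : (⟨d, i⟩ : Σ d, J d) ≠ ⟨e, k⟩ := fun h' => h (congrArg Sigma.fst h')
  rw [map_smul, Module.Basis.coord_apply, Module.Basis.repr_self, Finsupp.single_eq_of_ne hne,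
    smul_zero]

variable [∀ d, DecidableEq (J d)]

/-- A block diagonal matrix with invertible blocks transforms a basis into a basis. -/
def blockBasis (b : Module.Basis (Σ d, J d) ℚ V) (A : ∀ d, Matrix (J d) (J d) ℚ)
    (hA : ∀ d, IsUnit (A d)) : Module.Basis (Σ d, J d) ℚ V :=
  -- The functionals dual to the new family are read off from the columns of the inverse blocks.
  basisOfDual (blockFamily b A) (fun x => ∑ i, (A x.1)⁻¹ i x.2 • b.coord ⟨x.1, i⟩)
    (by
      rintro ⟨d, j⟩
      have h : (A d * (A d)⁻¹) j j = 1 := by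
        rw [Matrix.mul_nonsing_inv _ ((Matrix.isUnit_iff_isUnit_det _).1 (hA d)), Matrix.one_apply_eq]
      rw [← h, LinearMap.sum_apply, Matrix.mul_apply]
      refine sum_congr rfl fun i _ => ?_
      rw [LinearMap.smul_apply, coord_blockFamily, smul_eq_mul, mul_comm])
    (by
      rintro ⟨d, j⟩ ⟨e, k⟩ hne
      rw [LinearMap.sum_apply]
      by_cases hde : d = e
      · subst hde
        have h : (A d * (A d)⁻¹) k j = 0 := by
          rw [Matrix.mul_nonsing_inv _ ((Matrix.isUnit_iff_isUnit_det _).1 (hA d)),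
            Matrix.one_apply_ne]
          rintro rfl
          exact hne rfl
        rw [← h, Matrix.mul_apply]
        refine sum_congr rfl fun i _ => ?_
        rw [LinearMap.smul_apply, coord_blockFamily, smul_eq_mul, mul_comm]
      · refine sum_eq_zero fun i _ => ?_
        rw [LinearMap.smul_apply, coord_blockFamily_of_ne b A hde, smul_zero])
    (by
      rw [← b.span_eq]
      refine Submodule.span_le.2 ?_
      rintro _ ⟨⟨d, i⟩, rfl⟩
      have : b ⟨d, i⟩ = ∑ j, (A d)⁻¹ i j • blockFamily b A ⟨d, j⟩ := by
        simp only [blockFamily, smul_sum, smul_smul]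
        change _ = ∑ j : J d, ∑ k : J d, ((A d)⁻¹ i j * A d j k) • b ⟨d, k⟩
        rw [sum_comm]
        simp only [← sum_smul, ← Matrix.mul_apply]
        rw [Matrix.nonsing_inv_mul _ ((Matrix.isUnit_iff_isUnit_det _).1 (hA d))]
        simp [Matrix.one_apply]
      rw [this]
      exact Submodule.sum_mem _ fun j _ => Submodule.smul_mem _ _
        (Submodule.subset_span ⟨_, rfl⟩))

@[simp] lemma blockBasis_apply (b : Module.Basis (Σ d, J d) ℚ V) (A : ∀ d, Matrix (J d) (J d) ℚ)
    (hA : ∀ d, IsUnit (A d)) (x : Σ d, J d) : blockBasis b A hA x = blockFamily b A x :=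
  basisOfDual_apply _ _ _ _ _ _

end Blocks

lemma existsUnique_bilinForm {ι V : Type*} [DecidableEq ι] [AddCommGroup V] [Module ℚ V]
    (b b' : Module.Basis ι ℚ V) (w : ι → ℚ) :
    ∃! B : LinearMap.BilinForm ℚ V, ∀ i j, B (b i) (b' j) = if i = j then w i else 0 := by
  refine ⟨b.constr ℚ fun i => b'.constr ℚ fun j => if i = j then w i else 0, ?_, ?_⟩
  · intro i j
    simp only [Module.Basis.constr_basis]
  · intro B hB
    refine b.ext fun i => b'.ext fun j => ?_
    simp only [Module.Basis.constr_basis, hB]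

open PartialSetSupercomposition

/-! ### The complete homogeneous basis of `sNCSym` -/

section Homogeneous

variable {n m : ℕ}

/-- The restriction to monomials with at most one `θ` whose index is missing among the `x`'s changes
nothing: two such `θ`'s can be exchanged without changing the type of the monomial, so the
alternating sum vanishes anyway. -/
lemma ncCoeff_homogeneousFn (K : PartialSetSupercomposition n m) (a : Fin m ↪ ℕ) (b : Fin n → ℕ) :
    ncCoeff (homogeneousFn K) a b =
      ∑ σ, sgn σ * ((K.meet (ofMonomial (reindex a σ) b)).blockFactorial : ℚ) := by
  rw [homogeneousFn, ncCoeff_formalSum]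
  have himg : ∀ σ : Equiv.Perm (Fin m), univ.image (reindex a σ) = univ.image a := fun σ => by
    rw [← map_eq_image, ← map_eq_image, map_reindex]
  by_cases h : (univ.image a \ univ.image b).card ≤ 1
  · exact sum_congr rfl fun σ _ => by rw [himg, if_pos h]
  · rw [sum_eq_zero fun σ _ => by rw [himg, if_neg h, mul_zero]]
    obtain ⟨x, hx, y, hy, hxy⟩ := one_lt_card.1 (not_le.1 h)
    simp only [mem_sdiff, mem_image, mem_univ, true_and, not_exists] at hx hy
    obtain ⟨⟨i, rfl⟩, hi⟩ := hx
    obtain ⟨⟨j, rfl⟩, hj⟩ := hy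
    have hij : i ≠ j := fun h => hxy (h ▸ rfl)
    have hfix : ofMonomial (reindex a (Equiv.swap i j)) b = ofMonomial a b := by
      rw [ofMonomial_eq_iff]
      refine ⟨fun k l => ?_, fun _ _ => Iff.rfl⟩
      change a (Equiv.swap i j k) = b l ↔ a k = b l
      by_cases hki : k = i
      · rw [hki, Equiv.swap_apply_left]
        exact iff_of_false (fun h => hj l h.symm) fun h => hi l h.symm
      · by_cases hkj : k = j
        · rw [hkj, Equiv.swap_apply_right]
          exact iff_of_false (fun h => hi l h.symm) fun h => hj l h.symm
        · rw [Equiv.swap_apply_of_ne_of_ne hki hkj]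
    have hs := sum_sgn_reindex
      (fun a => ((K.meet (ofMonomial a b)).blockFactorial : ℚ)) a (Equiv.swap i j)
    simp only [← permFerm_ofMonomial _ _ b] at hs ⊢
    rw [permFerm_ofMonomial, hfix, sgn_swap hij] at hs
    linarith

lemma homogeneousFn_mem_sNCSym (K : PartialSetSupercomposition n m) :
    homogeneousFn K ∈ sNCSym := by
  unfold homogeneousFn
  refine formalSum_mem_sNCSym fun s a b => ?_
  have h : univ.image (a.trans s.toEmbedding) \ univ.image (s ∘ b) =
      (univ.image a \ univ.image b).image s := by
    rw [image_sdiff _ _ s.injective, image_image, image_image]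
    rfl
  rw [ofMonomial_perm, h, card_image_of_injective _ s.injective]

lemma hasBidegree_homogeneousFn (K : PartialSetSupercomposition n m) :
    HasBidegree n m (homogeneousFn K) := hasBidegree_formalSum _

end Homogeneous

instance (n m : ℕ) : DecidableEq (SetSuperpartition n m) := Classical.decEq _

/-- The complete homogeneous function as an element of `sNCSym`. -/
def ncHomogeneous (I : BidegSetSuperpartition) : sNCSym :=
  ⟨homogeneousFn I.2.toPartialSetSupercomposition, homogeneousFn_mem_sNCSym _⟩

/-- The matrix of the `h_J` in the `m_I`, in one bidegree. -/
def gramMatrix (d : ℕ × ℕ) : Matrix (SetSuperpartition d.1 d.2) (SetSuperpartition d.1 d.2) ℚ :=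
  fun J I => gram J.toPartialSetSupercomposition I.toPartialSetSupercomposition

/-- A vector in the kernel would be a zero of the positive definite quadratic form. -/
lemma isUnit_gramMatrix (d : ℕ × ℕ) : IsUnit (gramMatrix d) := by
  rw [← Matrix.mulVec_injective_iff_isUnit]
  refine (injective_iff_map_eq_zero (gramMatrix d).mulVecLin).2 fun c hc => ?_
  by_contra hne
  refine (gram_pos hne).ne' ?_
  refine sum_eq_zero fun J _ => ?_
  have := congrFun hc J
  simp only [Matrix.mulVecLin_apply, Matrix.mulVec, dotProduct, gramMatrix, Pi.zero_apply] at this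
  rw [← mul_zero (c J), ← this, mul_sum]
  exact sum_congr rfl fun I _ => by ring

lemma blockFamily_gramMatrix (I : BidegSetSuperpartition) :
    blockFamily ncMonomialBasis gramMatrix I = ncHomogeneous I := by
  obtain ⟨⟨n, m⟩, I⟩ := I
  rw [eq_sum_ncMonomial_of_hasBidegree (f := ncHomogeneous ⟨(n, m), I⟩)
    (hasBidegree_homogeneousFn I.toPartialSetSupercomposition), blockFamily]
  refine sum_congr rfl fun J _ => ?_
  rw [ncMonomialBasis_apply]
  congr 1
  rw [ncDual_apply, ncHomogeneous, ncCoeff_homogeneousFn, gramMatrix, gram]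
  simp only [← permFerm_ofMonomial, ofMonomial_rep]

/-- The complete homogeneous basis of `sNCSym`. -/
def ncHomogeneousBasis : Module.Basis BidegSetSuperpartition ℚ sNCSym :=
  blockBasis ncMonomialBasis gramMatrix isUnit_gramMatrix

@[simp] lemma ncHomogeneousBasis_apply (I : BidegSetSuperpartition) :
    ncHomogeneousBasis I = ncHomogeneous I := by
  rw [ncHomogeneousBasis, blockBasis_apply, blockFamily_gramMatrix]

lemma ncHomogeneous_eq_sum {n m : ℕ} (J : SetSuperpartition n m) :
    ncHomogeneous ⟨(n, m), J⟩ = ∑ I : SetSuperpartition n m,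
      gram J.toPartialSetSupercomposition I.toPartialSetSupercomposition •
        ncMonomial ⟨(n, m), I⟩ := by
  classical
  rw [← blockFamily_gramMatrix, blockFamily]
  simp only [ncMonomialBasis_apply, gramMatrix]

/-! ### The bilinear form on `sNCSym`: existence, symmetry, orthogonality and definiteness -/

lemma isNCForm_iff (B : LinearMap.BilinForm ℚ sNCSym) : IsNCForm B ↔
    ∀ I J, B (ncMonomialBasis I) (ncHomogeneousBasis J) =
      if I = J then (-1 : ℚ) ^ (I.1.2.choose 2) * (I.1.1)! else 0 := by
  simp only [ncMonomialBasis_apply, ncHomogeneousBasis_apply]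
  constructor
  · intro h I J
    have := h I J (ncMonomial I) (ncHomogeneous J) rfl rfl
    split_ifs with hIJ
    · exact this.1 hIJ
    · exact this.2 hIJ
  · intro h I J f g hf hg
    have hf' : f = ncMonomial I := Subtype.ext hf
    have hg' : g = ncHomogeneous J := Subtype.ext hg
    rw [hf', hg', h]
    exact ⟨fun h => if_pos h, fun h => if_neg h⟩

lemma existsUnique_isNCForm : ∃! B : LinearMap.BilinForm ℚ sNCSym, IsNCForm B := by
  simp only [isNCForm_iff]
  exact existsUnique_bilinForm ncMonomialBasis ncHomogeneousBasis _

namespace IsNCForm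

variable {B : LinearMap.BilinForm ℚ sNCSym}

lemma apply_monomial_homogeneous (hB : IsNCForm B) (I J : BidegSetSuperpartition) :
    B (ncMonomial I) (ncHomogeneous J) =
      if I = J then (-1 : ℚ) ^ (I.1.2.choose 2) * (I.1.1)! else 0 := by
  rw [← ncMonomialBasis_apply, ← ncHomogeneousBasis_apply, (isNCForm_iff B).1 hB]

lemma apply_of_ne (hB : IsNCForm B) {d e : ℕ × ℕ} (h : d ≠ e) (I : SetSuperpartition d.1 d.2)
    (J : SetSuperpartition e.1 e.2) : B (ncMonomial ⟨d, I⟩) (ncHomogeneous ⟨e, J⟩) = 0 := by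
  rw [hB.apply_monomial_homogeneous, if_neg fun h' => h (congrArg Sigma.fst h')]

/-- Expanding the first argument in the `m_K`, only `m_J` pairs nontrivially with `h_J`. The matrix
of the form in the basis of the `h_J` is thus a multiple of `gram` and inherits its symmetry and
definiteness. -/
lemma apply_homogeneous (hB : IsNCForm B) {n m : ℕ} (I J : SetSuperpartition n m) :
    B (ncHomogeneous ⟨(n, m), I⟩) (ncHomogeneous ⟨(n, m), J⟩) =
      (-1 : ℚ) ^ (m.choose 2) * n ! *
        gram I.toPartialSetSupercomposition J.toPartialSetSupercomposition := by
  rw [ncHomogeneous_eq_sum I, map_sum, LinearMap.sum_apply, sum_eq_single J]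
  · rw [map_smul, LinearMap.smul_apply, hB.apply_monomial_homogeneous, if_pos rfl, smul_eq_mul]
    ring
  · intro K _ hK
    rw [map_smul, LinearMap.smul_apply, hB.apply_monomial_homogeneous, if_neg, smul_zero]
    simpa using hK
  · simp

lemma apply_homogeneous_of_ne (hB : IsNCForm B) {n m : ℕ} (I : SetSuperpartition n m)
    {e : ℕ × ℕ} (h : (n, m) ≠ e) (J : SetSuperpartition e.1 e.2) :
    B (ncHomogeneous ⟨(n, m), I⟩) (ncHomogeneous ⟨e, J⟩) = 0 := by
  rw [ncHomogeneous_eq_sum I, map_sum, LinearMap.sum_apply]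
  refine sum_eq_zero fun K _ => ?_
  rw [map_smul, LinearMap.smul_apply, hB.apply_of_ne h, smul_zero]

lemma isSymm (hB : IsNCForm B) : B.IsSymm := by
  refine ⟨fun f g => ?_⟩
  have h : B = LinearMap.BilinForm.flip B := by
    refine ncHomogeneousBasis.ext fun I => ncHomogeneousBasis.ext fun J => ?_
    rw [LinearMap.BilinForm.flip_apply, ncHomogeneousBasis_apply, ncHomogeneousBasis_apply]
    obtain ⟨⟨n, m⟩, I⟩ := I
    obtain ⟨e, J⟩ := J
    by_cases hde : (n, m) = e
    · subst hde
      rw [hB.apply_homogeneous, hB.apply_homogeneous, gram_comm]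
    · rw [hB.apply_homogeneous_of_ne I hde]
      exact (hB.apply_homogeneous_of_ne (n := e.1) (m := e.2) J (Ne.symm hde) I).symm
  conv_lhs => rw [h]
  rw [LinearMap.BilinForm.flip_apply]

/-- A series of bidegree `(n, m)` is a combination of complete homogeneous functions. -/
lemma _root_.eq_sum_ncHomogeneous_of_hasBidegree {n m : ℕ} {f : sNCSym}
    (hf : HasBidegree n m (f : NCSuperSeries)) :
    ∃ c : SetSuperpartition n m → ℚ, f = ∑ J, c J • ncHomogeneous ⟨(n, m), J⟩ := by
  refine ⟨fun J => ∑ I, ncDual ⟨(n, m), I⟩ f * (gramMatrix (n, m))⁻¹ I J, ?_⟩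
  conv_lhs => rw [eq_sum_ncMonomial_of_hasBidegree hf]
  simp only [sum_smul]
  rw [sum_comm]
  refine sum_congr rfl fun I _ => ?_
  simp only [mul_smul, ← smul_sum, ncHomogeneous_eq_sum]
  congr 1
  simp only [smul_sum, smul_smul]
  rw [sum_comm]
  simp only [← sum_smul]
  have h := Matrix.nonsing_inv_mul (gramMatrix (n, m))
    ((Matrix.isUnit_iff_isUnit_det _).1 (isUnit_gramMatrix (n, m)))
  have h' : ∀ K, ∑ J, (gramMatrix (n, m))⁻¹ I J *
      gram J.toPartialSetSupercomposition K.toPartialSetSupercomposition =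
      if I = K then 1 else 0 := fun K => by
    rw [← Matrix.one_apply, ← h, Matrix.mul_apply]
    rfl
  simp [h']

lemma apply_eq_zero_of_hasBidegree (hB : IsNCForm B) {n m n' m' : ℕ} {f g : sNCSym}
    (hf : HasBidegree n m (f : NCSuperSeries)) (hg : HasBidegree n' m' (g : NCSuperSeries))
    (h : (n, m) ≠ (n', m')) : B f g = 0 := by
  obtain ⟨c, rfl⟩ := eq_sum_ncHomogeneous_of_hasBidegree hf
  obtain ⟨c', rfl⟩ := eq_sum_ncHomogeneous_of_hasBidegree hg
  simp only [map_sum, LinearMap.sum_apply, map_smul, LinearMap.smul_apply]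
  refine sum_eq_zero fun J _ => ?_
  rw [sum_eq_zero fun I _ => ?_, smul_zero]
  rw [hB.apply_homogeneous_of_ne _ h, smul_zero]

lemma pos (hB : IsNCForm B) {n m : ℕ} {f : sNCSym} (hf : HasBidegree n m (f : NCSuperSeries))
    (h0 : f ≠ 0) : 0 < (-1) ^ (m.choose 2) * B f f := by
  obtain ⟨c, rfl⟩ := eq_sum_ncHomogeneous_of_hasBidegree hf
  have hc : c ≠ 0 := by
    rintro rfl
    exact h0 (by simp)
  have h : (-1) ^ (m.choose 2) * B (∑ J, c J • ncHomogeneous ⟨(n, m), J⟩)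
      (∑ J, c J • ncHomogeneous ⟨(n, m), J⟩) = (n ! : ℚ) * ∑ J, ∑ I, c J * c I *
      gram J.toPartialSetSupercomposition I.toPartialSetSupercomposition := by
    have hs : (-1 : ℚ) ^ (m.choose 2) * (-1) ^ (m.choose 2) = 1 := by
      rw [← mul_pow]; simp
    simp only [map_sum, LinearMap.sum_apply, map_smul, LinearMap.smul_apply, mul_sum,
      hB.apply_homogeneous, smul_eq_mul]
    rw [sum_comm]
    refine sum_congr rfl fun J _ => sum_congr rfl fun I _ => ?_
    linear_combination (c J * c I * n ! *
      gram J.toPartialSetSupercomposition I.toPartialSetSupercomposition) * hs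
  rw [h]
  exact mul_pos (by positivity) (gram_pos hc)

lemma nondegenerate (hB : IsNCForm B) : B.Nondegenerate := by
  have key : ∀ f, (∀ g, B f g = 0) → f = 0 := by
    intro f hf
    rw [← ncMonomialBasis.forall_coord_eq_zero_iff]
    intro I
    -- Pairing with `h_I` extracts the coefficient of `m_I`, up to a nonzero factor.
    have h : LinearMap.BilinForm.flip B (ncHomogeneous I) =
        ((-1 : ℚ) ^ (I.1.2.choose 2) * (I.1.1)!) • ncMonomialBasis.coord I := by
      refine ncMonomialBasis.ext fun J => ?_
      rw [LinearMap.BilinForm.flip_apply, ncMonomialBasis_apply, hB.apply_monomial_homogeneous,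
        LinearMap.smul_apply, ← ncMonomialBasis_apply, Module.Basis.coord_apply,
        Module.Basis.repr_self, Finsupp.single_apply]
      by_cases hJI : J = I
      · simp [hJI]
      · simp [hJI]
    have h' := LinearMap.congr_fun h f
    rw [LinearMap.BilinForm.flip_apply, hf, LinearMap.smul_apply, smul_eq_mul] at h'
    exact (mul_eq_zero.1 h'.symm).resolve_left
      (mul_ne_zero (pow_ne_zero _ (by norm_num)) (by positivity))
  exact ⟨key, fun g hg => key g fun f => by rw [← hB.isSymm.eq]; simpa using hg f⟩

end IsNCForm

/-! ### Words with given content -/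

lemma toMultiset_inj {α β : ℕ →₀ ℕ} :
    Finsupp.toMultiset α = Finsupp.toMultiset β ↔ α = β :=
  (Multiset.toFinsupp (α := ℕ)).symm.injective.eq_iff

lemma toMultiset_content {n : ℕ} (b : Fin n → ℕ) :
    Finsupp.toMultiset (content b) = (List.ofFn b : Multiset ℕ) := by
  rw [content, map_sum]
  simp only [Finsupp.toMultiset_single, one_smul]
  rw [← Fin.univ_val_map, ← Multiset.sum_map_singleton (univ.val.map b), Multiset.map_map]
  rfl

lemma degree_content {n : ℕ} (b : Fin n → ℕ) : (content b).degree = n := by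
  simp [content]

/-- The words of length `n` with content `α`. -/
def fnWords (n : ℕ) (α : ℕ →₀ ℕ) : Finset (Fin n → ℕ) :=
  (Fintype.piFinset fun _ => α.support).filter fun b => content b = α

lemma mem_fnWords {n : ℕ} {α : ℕ →₀ ℕ} {b : Fin n → ℕ} : b ∈ fnWords n α ↔ content b = α := by
  rw [fnWords, mem_filter, Fintype.mem_piFinset]
  refine ⟨fun h => h.2, fun h => ⟨fun j => ?_, h⟩⟩
  rw [← h, mem_support_content]
  exact ⟨j, rfl⟩

lemma content_get_iff (α : ℕ →₀ ℕ) (w : List ℕ) :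
    content w.get = α ↔ w ∈ (Multiset.lists (Finsupp.toMultiset α)).toFinset := by
  rw [Multiset.mem_toFinset, Multiset.mem_lists_iff, Multiset.quot_mk_to_coe,
    ← toMultiset_inj, toMultiset_content, List.ofFn_get, eq_comm]

lemma exists_content_eq (α : ℕ →₀ ℕ) {n : ℕ} (hn : α.degree = n) :
    ∃ b : Fin n → ℕ, content b = α := by
  have hw : content (Finsupp.toMultiset α).toList.get = α := by
    rw [← toMultiset_inj, toMultiset_content, List.ofFn_get,
      Multiset.coe_toList]
  have hl : (Finsupp.toMultiset α).toList.length = n := by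
    rw [← hn]
    conv_rhs => rw [← hw]
    rw [degree_content]
  subst hl
  exact ⟨_, hw⟩

lemma rho_apply (f : NCSuperSeries) (S : Finset ℕ) (α : ℕ →₀ ℕ) {n : ℕ} (hn : α.degree = n) :
    rho f S α = ∑ b ∈ fnWords n α, f S (List.ofFn b) := by
  symm
  refine sum_bij (fun b _ => List.ofFn b) (fun b hb => ?_) (fun b _ c _ h => ?_)
    (fun w hw => ?_) (fun _ _ => rfl)
  · rw [Multiset.mem_toFinset, Multiset.mem_lists_iff, Multiset.quot_mk_to_coe,
      ← toMultiset_content, mem_fnWords.1 hb]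
  · exact List.ofFn_injective h
  · have h := (content_get_iff α w).2 hw
    have hl : w.length = n := by rw [← hn, ← h, degree_content]
    subst hl
    exact ⟨w.get, mem_fnWords.2 h, List.ofFn_get w⟩

/-- If `p` and `b` are labellings, the words with the same joint distribution as `b` relative to `p`
form an orbit of the permutations that preserve `p`. -/
lemma sum_card_stabilizer {A ι : Type*} [Fintype A] [DecidableEq A] [DecidableEq ι] (p : A → ι)
    (b₀ : A → ℕ) (Y : Finset (A → ℕ))
    (hY : ∀ b, b ∈ Y ↔ ∀ β c, #{j | p j = β ∧ b j = c} = #{j | p j = β ∧ b₀ j = c}) :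
    ∑ b ∈ Y, #{π : Equiv.Perm A | p ∘ π = p ∧ b ∘ π = b} = #{π : Equiv.Perm A | p ∘ π = p} := by
  -- Orbit counting: the permutations `π` preserving `p` are grouped by the word `b₀ ∘ π`, and the
  -- group of `b` is a left coset of the joint stabilizer of `p` and `b`.
  rw [card_eq_sum_card_fiberwise (f := fun π : Equiv.Perm A => b₀ ∘ π) (t := Y)]
  · refine sum_congr rfl fun b hb => ?_
    obtain ⟨τ, hτp, hτb⟩ : ∃ τ : Equiv.Perm A, p ∘ τ = p ∧ b₀ ∘ τ = b := by
      have hcard : ∀ x : ι × ℕ, Nonempty ({j // (p j, b j) = x} ≃ {j // (p j, b₀ j) = x}) := by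
        rintro ⟨β, c⟩
        rw [← Fintype.card_eq, Fintype.card_subtype, Fintype.card_subtype]
        simpa only [Prod.mk.injEq] using (hY b).1 hb β c
      let e := fun x => (hcard x).some
      have h := Equiv.ofFiberEquiv_map (f := fun j => (p j, b j)) (g := fun j => (p j, b₀ j)) e
      refine ⟨Equiv.ofFiberEquiv e, funext fun j => ?_, funext fun j => ?_⟩
      · exact congrArg Prod.fst (h j)
      · exact congrArg Prod.snd (h j)
    refine card_bij (fun π _ => τ * π) ?_ ?_ ?_
    · intro π hπ
      simp only [mem_filter, mem_univ, true_and] at hπ ⊢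
      refine ⟨?_, ?_⟩
      · rw [Equiv.Perm.coe_mul, ← Function.comp_assoc, hτp, hπ.1]
      · rw [Equiv.Perm.coe_mul, ← Function.comp_assoc, hτb, hπ.2]
    · exact fun π _ π' _ h => mul_left_cancel h
    · intro π hπ
      simp only [mem_filter, mem_univ, true_and] at hπ
      refine ⟨τ⁻¹ * π, ?_, by simp⟩
      have h1 : p ∘ ⇑τ⁻¹ = p := by
        conv_lhs => rw [← hτp]
        funext j; simp
      have h2 : b ∘ ⇑τ⁻¹ = b₀ := by
        rw [← hτb]
        funext j; simp
      simp only [mem_filter, mem_univ, true_and, Equiv.Perm.coe_mul, ← Function.comp_assoc, h1, h2]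
      exact hπ
  · intro π hπ
    simp only [coe_filter, mem_univ, true_and, Set.mem_ofPred_eq] at hπ
    rw [mem_coe, hY]
    intro β c
    refine card_bij (fun j _ => π j) ?_ (fun _ _ _ _ h => π.injective h) ?_
    · intro j hj
      simp only [mem_filter, mem_univ, true_and, Function.comp_apply] at hj ⊢
      exact ⟨(congrFun hπ j).trans hj.1, hj.2⟩
    · intro j hj
      refine ⟨π.symm j, ?_, by simp⟩
      simp only [mem_filter, mem_univ, true_and, Function.comp_apply, Equiv.apply_symm_apply]
        at hj ⊢
      refine ⟨?_, hj.2⟩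
      rw [← hj.1, ← congrFun hπ]
      simp

/-- `α! = ∏ α_c!`. -/
def contentFactorial (α : ℕ →₀ ℕ) : ℕ := ∏ c ∈ α.support, (α c)!

/-- With a single label every permutation preserves the labelling, and the orbit count becomes the
multinomial formula. -/
lemma card_fnWords (α : ℕ →₀ ℕ) {n : ℕ} (hn : α.degree = n) :
    (fnWords n α).card * contentFactorial α = n ! := by
  obtain ⟨b₀, hb₀⟩ := exists_content_eq α hn
  have h := sum_card_stabilizer (fun _ : Fin n => ()) b₀ (fnWords n α) (fun b => by
    rw [mem_fnWords, ← hb₀]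
    simp only [true_and, forall_const, ← content_apply, Finsupp.ext_iff])
  have hπ : #{π : Equiv.Perm (Fin n) | (fun _ : Fin n => ()) ∘ π = fun _ : Fin n => ()} = n ! := by
    rw [filter_true_of_mem fun π _ => rfl, card_univ, Fintype.card_perm, Fintype.card_fin]
  rw [hπ] at h
  rw [← h, ← smul_eq_mul, ← sum_const]
  refine sum_congr rfl fun b hb => ?_
  have hb' := mem_fnWords.1 hb
  simp only [contentFactorial, ← hb', content_apply]
  rw [← card_perm_comp_eq b]
  · simp only [true_and]
  · exact fun j => (mem_support_content b _).2 ⟨j, rfl⟩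

/-! ### Coefficients of series in commuting variables -/

/-- The coefficient of `θ_{a_1} ⋯ θ_{a_m} x^α`. -/
def scCoeff {m : ℕ} (g : SuperSeries) (a : Fin m ↪ ℕ) (α : ℕ →₀ ℕ) : ℚ :=
  altCoeff (fun S => g S α) a

/-- `scCoeff` as a linear functional. -/
def scCoeffₗ {m : ℕ} (a : Fin m ↪ ℕ) (α : ℕ →₀ ℕ) : SuperSeries →ₗ[ℚ] ℚ where
  toFun g := scCoeff g a α
  map_add' _ _ := mul_add _ _ _
  map_smul' _ _ := mul_left_comm _ _ _

lemma scCoeff_smul {m : ℕ} (c : ℚ) (g : SuperSeries) (a : Fin m ↪ ℕ) (α : ℕ →₀ ℕ) :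
    scCoeff (c • g) a α = c * scCoeff g a α := map_smul (scCoeffₗ a α) c g

lemma scCoeff_sum {m : ℕ} {ι : Type*} (s : Finset ι) (f : ι → SuperSeries) (a : Fin m ↪ ℕ)
    (α : ℕ →₀ ℕ) : scCoeff (∑ i ∈ s, f i) a α = ∑ i ∈ s, scCoeff (f i) a α :=
  map_sum (scCoeffₗ a α) f s

lemma superSeries_ext {f g : SuperSeries}
    (h : ∀ (m : ℕ) (a : Fin m ↪ ℕ) (α : ℕ →₀ ℕ), scCoeff f a α = scCoeff g a α) : f = g := by
  funext S α
  exact eq_of_altCoeff_eq (F := fun S => f S α) (G := fun S => g S α) fun a => h _ a α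

lemma scCoeff_reindex {m : ℕ} (g : SuperSeries) (a : Fin m ↪ ℕ) (α : ℕ →₀ ℕ)
    (σ : Equiv.Perm (Fin m)) : scCoeff g (reindex a σ) α = sgn σ * scCoeff g a α :=
  altCoeff_reindex _ _ _

lemma scCoeff_rho {m : ℕ} (f : NCSuperSeries) (a : Fin m ↪ ℕ) (α : ℕ →₀ ℕ) {n : ℕ}
    (hn : α.degree = n) : scCoeff (rho f) a α = ∑ b ∈ fnWords n α, ncCoeff f a b := by
  simp only [scCoeff, altCoeff, rho_apply f _ α hn, mul_sum, ncCoeff]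

lemma content_comp {n : ℕ} (s : ℕ → ℕ) (b : Fin n → ℕ) :
    content (s ∘ b) = Finsupp.mapDomain s (content b) := by
  simp only [content, Finsupp.mapDomain_finsetSum, Finsupp.mapDomain_single, Function.comp_apply]

lemma scCoeff_rho_perm {m : ℕ} {f : NCSuperSeries} (hf : f ∈ sNCSym) (s : Equiv.Perm ℕ)
    (hs : {i | s i ≠ i}.Finite) (a : Fin m ↪ ℕ) (α : ℕ →₀ ℕ) :
    scCoeff (rho f) (a.trans s.toEmbedding) (Finsupp.mapDomain s α) = scCoeff (rho f) a α := by
  have hd : (Finsupp.mapDomain s α).degree = α.degree := by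
    obtain ⟨b, hb⟩ := exists_content_eq α rfl
    conv_lhs => rw [← hb, ← content_comp, degree_content]
  rw [scCoeff_rho f _ _ hd, scCoeff_rho f _ _ rfl]
  symm
  refine sum_bij (fun b _ => s ∘ b) (fun b hb => ?_) (fun b _ c _ h => ?_) (fun b hb => ?_)
    (fun b _ => (ncCoeff_perm hf s hs a b).symm)
  · rw [mem_fnWords, content_comp, mem_fnWords.1 hb]
  · exact s.injective.comp_left h
  · refine ⟨s.symm ∘ b, ?_, by funext; simp⟩
    rw [mem_fnWords, content_comp, mem_fnWords.1 hb, ← Finsupp.mapDomain_comp]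
    simp [Finsupp.mapDomain_id]

/-- The `θ`-indices are matched position by position and the remaining variables by equal exponents,
which is possible because the two multisets agree. The resulting bijection of finite sets extends to
a finitary permutation. -/
lemma exists_perm_of_contentType_eq {m : ℕ} {a a' : Fin m ↪ ℕ} {α α' : ℕ →₀ ℕ}
    (h : contentType a α = contentType a' α') :
    ∃ s : Equiv.Perm ℕ, {i | s i ≠ i}.Finite ∧ a.trans s.toEmbedding = a' ∧
      Finsupp.mapDomain s α = α' := by
  classical
  obtain ⟨h1, h2⟩ := Prod.mk.inj h
  set T := α.support \ univ.map a with hT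
  set T' := α'.support \ univ.map a' with hT'
  have hcard : ∀ c : ℕ, Nonempty ({x : T // α x = c} ≃ {x : T' // α' x = c}) := by
    have hc : ∀ (U : Finset ℕ) (β : ℕ →₀ ℕ) (c : ℕ),
        Fintype.card {x : U // β x = c} = (U.val.map β).count c := by
      intro U β c
      rw [Multiset.count_map, Fintype.card_subtype, ← filter_val, ← card_def]
      refine card_bij (fun x _ => x) (fun x hx => ?_) (fun _ _ _ _ h => Subtype.ext h)
        fun x hx => ?_
      · simp only [mem_filter, mem_univ, true_and] at hx
        exact mem_filter.2 ⟨x.2, hx.symm⟩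
      · obtain ⟨hxU, hx⟩ := mem_filter.1 hx
        exact ⟨⟨x, hxU⟩, by simpa using hx.symm, rfl⟩
    intro c
    rw [← Fintype.card_eq, hc, hc, h2]
  let e := fun x => (hcard x).some
  have he := Equiv.ofFiberEquiv_map (f := fun x : T => α x) (g := fun x : T' => α' x) e
  set E : T ≃ T' := Equiv.ofFiberEquiv e
  let u : Fin m ⊕ T → ℕ := Sum.elim a (↑)
  let u' : Fin m ⊕ T → ℕ := Sum.elim a' fun x => E x
  have hu : Function.Injective u := a.injective.sumElim Subtype.val_injective fun i x hx =>
    (mem_sdiff.1 x.2).2 (mem_map.2 ⟨i, mem_univ i, hx⟩)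
  have hu' : Function.Injective u' := a'.injective.sumElim
    (Subtype.val_injective.comp E.injective) fun i x hx =>
    (mem_sdiff.1 (E x).2).2 (mem_map.2 ⟨i, mem_univ i, hx⟩)
  obtain ⟨s, hs, hsu⟩ := exists_finitary_perm u u' fun x y => by rw [hu.eq_iff, hu'.eq_iff]
  have hval : ∀ x, α' (s x) = α x := by
    intro x
    by_cases hx : ∃ y, u y = x
    · obtain ⟨y, rfl⟩ := hx
      rw [← Function.comp_apply (f := s), hsu]
      rcases y with i | y
      · exact (congrFun h1 i).symm
      · exact he y
    -- An index outside the matched set has exponent `0`, and `s` cannot send it to an index with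
    -- nonzero exponent, since those are already images of matched indices.
    · have hx0 : α x = 0 := by
        by_contra h0
        refine hx ?_
        by_cases hxa : x ∈ univ.map a
        · obtain ⟨i, -, hi⟩ := mem_map.1 hxa
          exact ⟨.inl i, hi⟩
        · exact ⟨.inr ⟨x, mem_sdiff.2 ⟨Finsupp.mem_support_iff.2 h0, hxa⟩⟩, rfl⟩
      rw [hx0]
      by_contra h0
      have : ∃ y, u' y = s x := by
        by_cases hxa : s x ∈ univ.map a'
        · obtain ⟨i, -, hi⟩ := mem_map.1 hxa
          exact ⟨.inl i, hi⟩
        · refine ⟨.inr (E.symm ⟨s x, mem_sdiff.2 ⟨Finsupp.mem_support_iff.2 h0, hxa⟩⟩), ?_⟩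
          simp [u']
      obtain ⟨y, hy⟩ := this
      rw [← hsu] at hy
      exact hx ⟨y, s.injective hy⟩
  refine ⟨s, hs, ?_, ?_⟩
  · ext i
    exact congrFun hsu (.inl i)
  · ext y
    obtain ⟨x, rfl⟩ := s.surjective y
    rw [Finsupp.mapDomain_apply s.injective, hval]

/-! ### Superpartitions as sorted points -/

lemma strictAnti_iff_strictMono_neg {m : ℕ} (A : Fin m → ℕ) :
    StrictAnti A ↔ StrictMono fun i => -(A i : ℤ) := by
  constructor
  · intro h i j hij
    have := h hij
    simp only
    omega
  · intro h i j hij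
    have := h hij
    simp only at this
    omega

/-- Superpartitions are the pairs of a sequence and a multiset with decreasing sequence. -/
def typeAction (n m : ℕ) : SortedAction m ((Fin m → ℕ) × Multiset ℕ) (Superpartition n m) where
  act σ t := (t.1 ∘ σ, t.2)
  key t i := -(t.1 i : ℤ)
  incl Λ := (Λ.anti, Λ.sym)
  P t := (∀ k ∈ t.2, 0 < k) ∧ (∑ i, t.1 i) + t.2.sum = n
  act_one _ := rfl
  key_act _ _ := rfl
  act_swap t i j hij h := by
    have h' : t.1 i = t.1 j := by simpa using h
    refine Prod.ext (funext fun k => ?_) rfl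
    change t.1 (Equiv.swap i j k) = t.1 k
    by_cases hi : k = i
    · rw [hi, Equiv.swap_apply_left, h']
    · by_cases hj : k = j
      · rw [hj, Equiv.swap_apply_right, h']
      · rw [Equiv.swap_apply_of_ne_of_ne hi hj]
  incl_injective Λ Ω h := Superpartition.ext (congrArg Prod.fst h) (congrArg Prod.snd h)
  key_incl Λ := (strictAnti_iff_strictMono_neg _).1 Λ.anti_strict
  P_act σ t h := ⟨h.1, by
    rw [← h.2]
    congr 1
    exact Equiv.sum_comp σ t.1⟩
  surj t h hm := ⟨⟨t.1, t.2, (strictAnti_iff_strictMono_neg _).2 hm, h.1, h.2⟩, rfl⟩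

/-- Summing over the union of the `θ`-indices and the support is harmless, since a `θ`-index outside
the support has exponent `0`. -/
lemma degree_eq_contentType {m : ℕ} (a : Fin m ↪ ℕ) (α : ℕ →₀ ℕ) :
    α.degree = (∑ i, (contentType a α).1 i) + (contentType a α).2.sum := by
  rw [Finsupp.degree_apply, sum_subset (subset_union_right (s₁ := univ.map a)) fun c _ hc =>
    Finsupp.notMem_support_iff.1 hc, ← union_sdiff_self_eq_union, sum_union disjoint_sdiff, sum_map]
  rfl

lemma contentFactorial_eq_contentType {m : ℕ} (a : Fin m ↪ ℕ) (α : ℕ →₀ ℕ) :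
    contentFactorial α =
      (∏ i, ((contentType a α).1 i)!) * ((contentType a α).2.map Nat.factorial).prod := by
  rw [contentFactorial, prod_subset (subset_union_right (s₁ := univ.map a)) fun c _ hc => by
    rw [Finsupp.notMem_support_iff.1 hc, Nat.factorial_zero], ← union_sdiff_self_eq_union,
    prod_union disjoint_sdiff, prod_map, contentType, Multiset.map_map]
  rfl

lemma typeAction_P_contentType {n m : ℕ} (a : Fin m ↪ ℕ) {α : ℕ →₀ ℕ} (hα : α.degree = n) :
    (typeAction n m).P (contentType a α) := by
  refine ⟨fun k hk => ?_, by rw [← degree_eq_contentType, hα]⟩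
  obtain ⟨c, hc, rfl⟩ := Multiset.mem_map.1 hk
  exact Nat.pos_of_ne_zero (Finsupp.mem_support_iff.1 (mem_sdiff.1 (mem_def.2 hc)).1)

lemma typeAction_act_contentType {n m : ℕ} (a : Fin m ↪ ℕ) (α : ℕ →₀ ℕ)
    (σ : Equiv.Perm (Fin m)) :
    (typeAction n m).act σ (contentType a α) = contentType (reindex a σ) α :=
  (contentType_reindex a α σ).symm

/-- Every superpartition is the type of a monomial. -/
lemma exists_contentType_eq {n m : ℕ} (Λ : Superpartition n m) :
    ∃ p : (Fin m ↪ ℕ) × (ℕ →₀ ℕ), contentType p.1 p.2 = (Λ.anti, Λ.sym) := by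
  classical
  set l := Λ.sym.toList with hl
  have hlpos : ∀ k ∈ l, 0 < k := fun k hk => Λ.sym_pos k (Multiset.mem_toList.1 hk)
  -- The indices below `m` carry the `θ`'s and the exponents `Λ_1, …, Λ_m`; the following ones carry
  -- the parts of `Λ.sym`, and all others have exponent `0`.
  let α : ℕ →₀ ℕ := Finsupp.onFinset (range (m + l.length))
    (fun x => if h : x < m then Λ.anti ⟨x, h⟩ else l.getD (x - m) 0) (fun x hx => by
      by_contra h
      rw [mem_range, not_lt] at h
      refine hx ?_
      rw [dif_neg (by omega), List.getD_eq_default _ _ (by omega)])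
  have hα : ∀ x, α x = if h : x < m then Λ.anti ⟨x, h⟩ else l.getD (x - m) 0 := fun _ => rfl
  have hT : α.support \ univ.map (Fin.valEmbedding : Fin m ↪ ℕ) = (range l.length).map (addLeftEmbedding m) := by
    ext x
    simp only [mem_sdiff, Finsupp.mem_support_iff, mem_map, mem_univ, true_and, mem_range,
      addLeftEmbedding_apply, not_exists, hα]
    constructor
    · rintro ⟨h1, h2⟩
      have hx : ¬ x < m := fun h => h2 ⟨x, h⟩ rfl
      rw [dif_neg hx] at h1
      refine ⟨x - m, ?_, by omega⟩
      by_contra h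
      exact h1 (List.getD_eq_default _ _ (by omega))
    · rintro ⟨y, hy, rfl⟩
      refine ⟨?_, fun i hi => ?_⟩
      · rw [dif_neg (by omega), Nat.add_sub_cancel_left, List.getD_eq_getElem _ _ hy]
        exact (hlpos _ (List.getElem_mem hy)).ne'
      · have := i.2
        simp at hi
        omega
  refine ⟨(Fin.valEmbedding, α), Prod.ext (funext fun i => ?_) ?_⟩
  · change α i = _
    rw [hα, dif_pos i.2]
  · change (α.support \ univ.map (Fin.valEmbedding : Fin m ↪ ℕ)).val.map α = Λ.sym
    rw [hT, map_val, Multiset.map_map]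
    have h : ∀ x ∈ (range l.length).val, (α ∘ addLeftEmbedding m) x = l.getD x 0 := by
      intro x _
      rw [Function.comp_apply, addLeftEmbedding_apply, hα, dif_neg (by omega),
        Nat.add_sub_cancel_left]
    rw [Multiset.map_congr rfl h, ← Multiset.coe_toList Λ.sym, ← hl, range_val, Multiset.range,
      Multiset.map_coe]
    congr 1
    refine List.ext_getElem (by simp) fun i h1 h2 => ?_
    simp [List.getElem?_eq_getElem h2]

/-- A monomial of the given type, when there is one. -/
def repType {m : ℕ} (t : (Fin m → ℕ) × Multiset ℕ) : (Fin m ↪ ℕ) × (ℕ →₀ ℕ) :=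
  @Classical.epsilon _ ⟨(Fin.valEmbedding, 0)⟩ fun p => contentType p.1 p.2 = t

lemma contentType_repType {m : ℕ} {t : (Fin m → ℕ) × Multiset ℕ}
    (h : ∃ p : (Fin m ↪ ℕ) × (ℕ →₀ ℕ), contentType p.1 p.2 = t) :
    contentType (repType t).1 (repType t).2 = t :=
  Classical.epsilon_spec_aux _ _ h

/-! ### The monomial basis of `sSym` -/

section

variable {n m : ℕ}

lemma scCoeff_symMonomialFn (Λ : Superpartition n m) (a : Fin m ↪ ℕ) (α : ℕ →₀ ℕ) :
    scCoeff (SuperSeries.monomialFn Λ) a α = (typeAction n m).orbitSign (contentType a α) Λ := by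
  classical
  refine Eq.trans ?_ ((altCoeff_altSum (fun a =>
    if contentType a α = (Λ.anti, Λ.sym) then (1 : ℚ) else 0) a).trans ?_)
  swap
  · rw [SortedAction.orbitSign]
    refine sum_congr rfl fun σ _ => ?_
    rw [typeAction_act_contentType]
    congr
  rw [scCoeff]
  congr 1
  funext S
  rw [SuperSeries.monomialFn]
  split_ifs with h
  · refine sum_congr rfl fun σ _ => ?_
    rw [sgn]
    congr 1
    have : contentType (reindex (enumEmb S h) σ) α = (Λ.anti, Λ.sym) ↔
        ((∀ i, α (S.orderEmbOfFin h (σ i)) = Λ.anti i) ∧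
          (α.support \ S).val.map α = Λ.sym) := by
      rw [contentType, map_reindex, map_enumEmb, Prod.mk.injEq, funext_iff]
      rfl
    simp only [this]
  · rfl

lemma orbitSign_eq_zero_of_degree_ne (Λ : Superpartition n m) (a : Fin m ↪ ℕ) {α : ℕ →₀ ℕ}
    (h : α.degree ≠ n) : (typeAction n m).orbitSign (contentType a α) Λ = 0 := by
  refine sum_eq_zero fun σ _ => ?_
  rw [if_neg, mul_zero]
  rw [typeAction_act_contentType]
  intro h'
  refine h ?_
  rw [degree_eq_contentType (reindex a σ), h']
  exact Λ.sum_eq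

lemma scCoeff_symMonomialFn_of_ne {n' m' : ℕ} (Λ : Superpartition n m) (a : Fin m' ↪ ℕ)
    {α : ℕ →₀ ℕ} (hα : α.degree = n') (h : (n', m') ≠ (n, m)) :
    scCoeff (SuperSeries.monomialFn Λ) a α = 0 := by
  by_cases hm : m' = m
  · subst hm
    rw [scCoeff_symMonomialFn, orbitSign_eq_zero_of_degree_ne]
    rintro rfl
    exact h (by rw [hα])
  · rw [scCoeff, altCoeff, SuperSeries.monomialFn, dif_neg (by simpa using hm), mul_zero]

/-- The sum of the `m_K` over all `K` of type `Λ`. -/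
def ncTypeSum (Λ : Superpartition n m) : NCSuperSeries :=
  formalSum fun (a : Fin m ↪ ℕ) (b : Fin n → ℕ) =>
    if contentType a (content b) = (Λ.anti, Λ.sym) then 1 else 0

lemma ncTypeSum_mem_sNCSym (Λ : Superpartition n m) : ncTypeSum Λ ∈ sNCSym := by
  unfold ncTypeSum
  refine formalSum_mem_sNCSym fun s a b => ?_
  rw [← blockType_ofMonomial, ofMonomial_perm, blockType_ofMonomial]

/-- The coefficient depends on a word only through its content, and an exponent of type `Λ` is the
content of `n!/Λ!` words. -/
lemma rho_ncTypeSum (Λ : Superpartition n m) :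
    rho (ncTypeSum Λ) = ((n ! : ℚ) / Λ.factorial) • SuperSeries.monomialFn Λ := by
  classical
  refine superSeries_ext fun m' a α => ?_
  rw [scCoeff_smul]
  by_cases h : (α.degree, m') = (n, m)
  · obtain ⟨hα, rfl⟩ := Prod.mk.inj h
    rw [scCoeff_rho _ _ _ hα, scCoeff_symMonomialFn, SortedAction.orbitSign]
    simp only [ncTypeSum, ncCoeff_formalSum]
    rw [sum_comm, mul_sum]
    refine sum_congr rfl fun σ _ => ?_
    rw [← mul_sum, mul_left_comm]
    congr 1
    rw [typeAction_act_contentType]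
    have hb : ∀ b ∈ fnWords n α, (if contentType (reindex a σ) (content b) = (Λ.anti, Λ.sym)
        then (1 : ℚ) else 0) =
        if contentType (reindex a σ) α = (typeAction n m').incl Λ then 1 else 0 := by
      intro b hb
      rw [mem_fnWords.1 hb]
      rfl
    rw [sum_congr rfl hb, sum_const, nsmul_eq_mul]
    by_cases ht : contentType (reindex a σ) α = (typeAction n m').incl Λ
    · rw [if_pos ht, if_pos ht, mul_one, mul_one]
      have hf : contentFactorial α = Λ.factorial := by
        rw [contentFactorial_eq_contentType (reindex a σ), ht]
        rfl
      have hc := card_fnWords α hα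
      rw [hf] at hc
      have h0 : (Λ.factorial : ℚ) ≠ 0 := by
        intro h0
        have h0' : Λ.factorial = 0 := by exact_mod_cast h0
        rw [h0', mul_zero] at hc
        exact (Nat.factorial_pos n).ne hc
      rw [eq_div_iff h0]
      exact_mod_cast hc
    · rw [if_neg ht, if_neg ht, mul_zero, mul_zero]
  · rw [scCoeff_symMonomialFn_of_ne Λ a rfl h, mul_zero, scCoeff_rho _ _ _ rfl]
    exact sum_eq_zero fun b _ => ncCoeff_eq_zero_of_hasBidegree (hasBidegree_formalSum _) h _ _

lemma factorial_pos (Λ : Superpartition n m) : 0 < Λ.factorial := by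
  refine Nat.mul_pos (prod_pos fun i _ => Nat.factorial_pos _) (Nat.pos_of_ne_zero ?_)
  rw [Ne, Multiset.prod_eq_zero_iff, Multiset.mem_map]
  rintro ⟨k, -, hk⟩
  exact Nat.factorial_ne_zero k hk

lemma symMonomialFn_mem_sSym (Λ : Superpartition n m) : SuperSeries.monomialFn Λ ∈ sSym := by
  have h : SuperSeries.monomialFn Λ = ((Λ.factorial : ℚ) / n !) • rho (ncTypeSum Λ) := by
    have h1 : (Λ.factorial : ℚ) ≠ 0 := by exact_mod_cast (factorial_pos Λ).ne'
    have h2 : (n ! : ℚ) ≠ 0 := by positivity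
    rw [rho_ncTypeSum, smul_smul, div_mul_div_cancel₀ h2, div_self h1, one_smul]
  rw [h]
  exact Submodule.smul_mem _ _ (Submodule.mem_map_of_mem (ncTypeSum_mem_sNCSym Λ))

lemma scCoeff_perm {g : SuperSeries} (hg : g ∈ sSym) (s : Equiv.Perm ℕ)
    (hs : {i | s i ≠ i}.Finite) (a : Fin m ↪ ℕ) (α : ℕ →₀ ℕ) :
    scCoeff g (a.trans s.toEmbedding) (Finsupp.mapDomain s α) = scCoeff g a α := by
  obtain ⟨f, hf, rfl⟩ := hg
  exact scCoeff_rho_perm hf s hs a α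

lemma scCoeff_repType {g : SuperSeries} (hg : g ∈ sSym) (a : Fin m ↪ ℕ) (α : ℕ →₀ ℕ) :
    scCoeff g (repType (contentType a α)).1 (repType (contentType a α)).2 = scCoeff g a α := by
  obtain ⟨s, hs, ha, hα⟩ := exists_perm_of_contentType_eq
    (contentType_repType ⟨(a, α), rfl⟩).symm
  rw [← scCoeff_perm hg s hs a α, ha, hα]

lemma scCoeff_eq_sum {g : SuperSeries} (hg : g ∈ sSym) (a : Fin m ↪ ℕ) {α : ℕ →₀ ℕ}
    (hα : α.degree = n) : scCoeff g a α = ∑ Λ : Superpartition n m,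
      scCoeff g (repType (Λ.anti, Λ.sym)).1 (repType (Λ.anti, Λ.sym)).2 *
        scCoeff (SuperSeries.monomialFn Λ) a α := by
  have h := (typeAction n m).eq_sum_orbitSign
    (F := fun t => scCoeff g (repType t).1 (repType t).2) (typeAction_P_contentType a hα)
    (fun σ => by
      rw [typeAction_act_contentType]
      rw [scCoeff_repType hg, scCoeff_repType hg, scCoeff_reindex])
  rw [scCoeff_repType hg] at h
  rw [h]
  exact sum_congr rfl fun Λ _ => by rw [scCoeff_symMonomialFn]; rfl

end

/-- The index type of the monomial basis of `sSym`. -/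
abbrev BidegSuperpartition : Type := Σ d : ℕ × ℕ, Superpartition d.1 d.2

instance (n m : ℕ) : DecidableEq (Superpartition n m) := Classical.decEq _

/-- The monomial function as an element of `sSym`. -/
def symMonomial (Λ : BidegSuperpartition) : sSym :=
  ⟨SuperSeries.monomialFn Λ.2, symMonomialFn_mem_sSym _⟩

/-- The coefficient of `m_Λ`. -/
def symDual (Λ : BidegSuperpartition) : sSym →ₗ[ℚ] ℚ :=
  (scCoeffₗ (repType (Λ.2.anti, Λ.2.sym)).1 (repType (Λ.2.anti, Λ.2.sym)).2).comp sSym.subtype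

lemma symDual_apply (Λ : BidegSuperpartition) (f : sSym) : symDual Λ f =
    scCoeff (f : SuperSeries) (repType (Λ.2.anti, Λ.2.sym)).1 (repType (Λ.2.anti, Λ.2.sym)).2 :=
  rfl

lemma symDual_symMonomial (Λ Ω : BidegSuperpartition) :
    symDual Λ (symMonomial Ω) = if Λ = Ω then 1 else 0 := by
  rw [symDual_apply]
  obtain ⟨d, Λ⟩ := Λ
  obtain ⟨e, Ω⟩ := Ω
  have hrep := contentType_repType (exists_contentType_eq Λ)
  by_cases hde : d = e
  · subst hde
    rw [symMonomial, scCoeff_symMonomialFn, hrep]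
    have := (typeAction d.1 d.2).orbitSign_incl Λ Ω
    simp only [typeAction] at this ⊢
    rw [this]
    simp [eq_comm]
  · rw [if_neg (by simp [hde])]
    refine scCoeff_symMonomialFn_of_ne (n' := d.1) _ _ ?_ (by simpa using hde)
    rw [degree_eq_contentType (repType (Λ.anti, Λ.sym)).1, hrep]
    exact Λ.sum_eq

lemma span_symMonomial : ⊤ ≤ Submodule.span ℚ (Set.range symMonomial) := by
  rintro ⟨f, hf⟩ -
  -- `ρ` preserves the number of variables of each kind, so a degree bound for a preimage also
  -- bounds the image.
  have hbound : ∃ N, ∀ (m : ℕ) (a : Fin m ↪ ℕ) (α : ℕ →₀ ℕ),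
      scCoeff f a α ≠ 0 → α.degree + m ≤ N := by
    obtain ⟨F, hF, rfl⟩ := hf
    obtain ⟨N, hN⟩ := hF.1
    refine ⟨N, fun m a α h => ?_⟩
    rw [scCoeff_rho _ _ _ rfl] at h
    obtain ⟨b, -, hb⟩ := exists_ne_zero_of_sum_ne_zero h
    have := hN (univ.map a) (List.ofFn b) (fun h' => hb (by simp [ncCoeff, altCoeff, h']))
    simp at this
    omega
  obtain ⟨N, hN⟩ := hbound
  have : (⟨f, hf⟩ : sSym) = ∑ d ∈ range (N + 1) ×ˢ range (N + 1),
      ∑ Λ : Superpartition d.1 d.2, symDual ⟨d, Λ⟩ ⟨f, hf⟩ • symMonomial ⟨d, Λ⟩ := by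
    apply Subtype.ext
    refine superSeries_ext fun m a α => ?_
    simp only [AddSubmonoidClass.coe_finsetSum, SetLike.val_smul, scCoeff_sum, scCoeff_smul]
    have h0 : ∀ d, d ≠ (α.degree, m) → ∑ Λ : Superpartition d.1 d.2,
        symDual ⟨d, Λ⟩ ⟨f, hf⟩ * scCoeff (symMonomial ⟨d, Λ⟩ : SuperSeries) a α = 0 := by
      intro d hd
      refine sum_eq_zero fun Λ _ => ?_
      rw [symMonomial, scCoeff_symMonomialFn_of_ne _ _ rfl (by simpa using hd.symm), mul_zero]
    by_cases h : (α.degree, m) ∈ range (N + 1) ×ˢ range (N + 1)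
    · rw [sum_eq_single_of_mem _ h fun d _ hd => h0 d hd]
      exact scCoeff_eq_sum hf a rfl
    · rw [sum_eq_zero fun d hd => h0 d fun h' => h (h' ▸ hd)]
      by_contra hne
      have := hN m a α hne
      simp at h
      omega
  rw [this]
  exact Submodule.sum_mem _ fun d _ => Submodule.sum_mem _ fun I _ =>
    Submodule.smul_mem _ _ (Submodule.subset_span ⟨_, rfl⟩)

/-- The monomial basis of `sSym`. -/
def symMonomialBasis : Module.Basis BidegSuperpartition ℚ sSym :=
  basisOfDual symMonomial symDual (fun Λ => by simp [symDual_symMonomial])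
    (fun Λ Ω h => by simp [symDual_symMonomial, h]) span_symMonomial

@[simp] lemma symMonomialBasis_apply (Λ : BidegSuperpartition) :
    symMonomialBasis Λ = symMonomial Λ := basisOfDual_apply _ _ _ _ _ _

/-! ### The sign of a set superpartition of given type -/

lemma exists_perm_comp_eq {A ι : Type*} [Fintype A] [DecidableEq ι] {f g : A → ι}
    (h : (univ : Finset A).val.map f = univ.val.map g) : ∃ τ : Equiv.Perm A, g ∘ τ = f := by
  have hc : ∀ (f : A → ι) (c : ι), Fintype.card {x // f x = c} = (univ.val.map f).count c := by
    intro f c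
    rw [Multiset.count_map, Fintype.card_subtype, ← filter_val, ← card_def]
    simp only [eq_comm]
  have e : ∀ c, {x // f x = c} ≃ {x // g x = c} := fun c =>
    Fintype.equivOfCardEq (by rw [hc, hc, h])
  exact ⟨Equiv.ofFiberEquiv e, funext (Equiv.ofFiberEquiv_map e)⟩

lemma SetSuperpartition.hasType_of_act_eq {n m : ℕ} {I : SetSuperpartition n m}
    {Λ : Superpartition n m} {σ : Equiv.Perm (Fin m)}
    (h : (typeAction n m).act σ I.blockType = (typeAction n m).incl Λ) : I.HasType Λ := by
  refine ⟨?_, congrArg Prod.snd h⟩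
  have h1 : I.blockType.1 ∘ σ = Λ.anti := congrArg Prod.fst h
  rw [← h1, ← Multiset.map_map, Multiset.map_univ_val_equiv]
  rfl

/-- The permutation that brings the fermionic sizes into decreasing order is the sorting permutation
of the negated sizes, and its inversions are the pairs counted by `ε(I)`. -/
lemma SetSuperpartition.HasType.exists_act_eq {n m : ℕ} {I : SetSuperpartition n m}
    {Λ : Superpartition n m} (h : I.HasType Λ) : ∃ σ : Equiv.Perm (Fin m),
      (typeAction n m).act σ I.blockType = (typeAction n m).incl Λ ∧
        sgn σ = (-1) ^ I.epsilon := by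
  obtain ⟨σ, hσ⟩ := exists_perm_comp_eq h.1.symm
  have hact : (typeAction n m).act σ I.blockType = (typeAction n m).incl Λ := Prod.ext hσ h.2
  refine ⟨σ, hact, ?_⟩
  obtain ⟨hinj, rfl⟩ := (typeAction n m).key_injective_of_act_eq hact
  rw [sgn, sign_sort_eq hinj, epsilon]
  congr 2
  ext p
  -- Every fermionic block contains `0`, so the truncated subtraction in `card - 1` preserves the
  -- comparison of sizes.
  have hpos : ∀ i, 0 < (I.ferm i).card := fun i => card_pos.2 ⟨0, I.zero_mem_ferm i⟩
  have h1 := hpos p.1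
  have h2 := hpos p.2
  have : (typeAction n m).key I.blockType p.2 < (typeAction n m).key I.blockType p.1 ↔
      (I.ferm p.1).card < (I.ferm p.2).card := by
    change -(((I.ferm p.2).card - 1 : ℕ) : ℤ) < -(((I.ferm p.1).card - 1 : ℕ) : ℤ) ↔ _
    omega
  rw [mem_filter, mem_filter, this]

open scoped Classical in
lemma SetSuperpartition.orbitSign_blockType {n m : ℕ} (I : SetSuperpartition n m)
    (Λ : Superpartition n m) : (typeAction n m).orbitSign I.blockType Λ =
      if I.HasType Λ then (-1 : ℚ) ^ I.epsilon else 0 := by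
  split_ifs with h
  · obtain ⟨σ, hσ, hs⟩ := h.exists_act_eq
    rw [(typeAction n m).orbitSign_eq hσ, if_pos rfl, hs]
  · refine sum_eq_zero fun σ _ => ?_
    rw [if_neg, mul_zero]
    exact fun h' => h (hasType_of_act_eq h')

-- The coefficient of `m_I` is obtained at a monomial of type `I`. There it is an alternating sum
-- over the orders of the fermionic sizes in which only the decreasing order counts, with the sign
-- `(-1)^{ε(I)}`.
open scoped Classical in
lemma ncTypeSum_eq_sum {n m : ℕ} (Λ : Superpartition n m) :
    ncTypeSum Λ = ∑ I : SetSuperpartition n m with I.HasType Λ,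
      (-1 : ℚ) ^ I.epsilon • monomialFn I.toPartialSetSupercomposition := by
  have hd : HasBidegree n m (ncTypeSum Λ) := hasBidegree_formalSum _
  refine ncSeries_ext fun n' m' a b => ?_
  rw [ncCoeff_sum]
  simp only [ncCoeff_smul]
  by_cases h : (n', m') = (n, m)
  · obtain ⟨rfl, rfl⟩ := Prod.mk.inj h
    rw [ncCoeff_eq_sum (ncTypeSum_mem_sNCSym Λ), sum_filter]
    refine sum_congr rfl fun I _ => ?_
    have hI : ncCoeff (ncTypeSum Λ) I.repA I.repB =
        (typeAction n' m').orbitSign I.blockType Λ := by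
      rw [ncTypeSum, ncCoeff_formalSum, SortedAction.orbitSign]
      refine sum_congr rfl fun σ _ => ?_
      have : I.blockType = contentType I.repA (content I.repB) := by
        rw [← blockType_ofMonomial, ofMonomial_rep]
      rw [this, typeAction_act_contentType]
      congr
    rw [hI, I.orbitSign_blockType]
    split_ifs <;> simp
  · rw [ncCoeff_eq_zero_of_hasBidegree hd h]
    refine (sum_eq_zero fun I _ => ?_).symm
    rw [ncCoeff_eq_zero_of_hasBidegree (hasBidegree_monomialFn _) h, mul_zero]

/-! ### Generating functions of the meets -/

/-- The series of the `(β_c + 1) x^β` with `β` of degree `r`. -/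
def markedComplete (r c : ℕ) : MvPowerSeries ℕ ℚ := fun β => if β.degree = r then (β c : ℚ) + 1 else 0

/-- The complete homogeneous symmetric series of degree `r`. -/
def complete (r : ℕ) : MvPowerSeries ℕ ℚ := fun β => if β.degree = r then 1 else 0

/-- The `θ`-positions add one element to the fibers over the distinct labels `(a₀ i, a i)`, and `(k
+ 1)! = (k + 1) k!`. These factors are the origin of the coefficient `Ω_1 + 1` in `h̃_r`. -/
lemma card_stabilizer_meet {n m : ℕ} (a₀ a : Fin m ↪ ℕ) (b₀ b : Fin n → ℕ) :
    #{π : Equiv.Perm (Fin m ⊕ Fin n) | Sum.elim a₀ b₀ ∘ π = Sum.elim a₀ b₀ ∧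
        Sum.elim a b ∘ π = Sum.elim a b} =
      #{π : Equiv.Perm (Fin n) | b₀ ∘ π = b₀ ∧ b ∘ π = b} *
        ∏ i, (#{j | b₀ j = a₀ i ∧ b j = a i} + 1) := by
  classical
  let U : Fin m ⊕ Fin n → ℕ × ℕ := fun x => (Sum.elim a₀ b₀ x, Sum.elim a b x)
  let V : Fin n → ℕ × ℕ := fun j => (b₀ j, b j)
  let E : Fin m ↪ ℕ × ℕ := ⟨fun i => (a₀ i, a i), fun i j h => a₀.injective (Prod.mk.inj h).1⟩
  let D : Finset (ℕ × ℕ) := univ.image U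
  have hE : univ.map E ⊆ D := fun x hx => by
    obtain ⟨i, -, rfl⟩ := mem_map.1 hx
    exact mem_image.2 ⟨.inl i, mem_univ _, rfl⟩
  have hU : #{π : Equiv.Perm (Fin m ⊕ Fin n) | Sum.elim a₀ b₀ ∘ π = Sum.elim a₀ b₀ ∧
      Sum.elim a b ∘ π = Sum.elim a b} = ∏ d ∈ D, (#{x | U x = d})! := by
    rw [← card_perm_comp_eq U D fun x => mem_image_of_mem _ (mem_univ x)]
    congr 1
    ext π
    simp only [mem_filter, mem_univ, true_and, funext_iff, Function.comp_apply, U, Prod.mk.injEq,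
      forall_and]
  have hV : #{π : Equiv.Perm (Fin n) | b₀ ∘ π = b₀ ∧ b ∘ π = b} = ∏ d ∈ D, (#{j | V j = d})! := by
    rw [← card_perm_comp_eq V D fun j => mem_image.2 ⟨.inr j, mem_univ _, rfl⟩]
    congr 1
    ext π
    simp only [mem_filter, mem_univ, true_and, funext_iff, Function.comp_apply, V, Prod.mk.injEq,
      forall_and]
  have hk : ∀ d, #{x | U x = d} = #{j | V j = d} + if d ∈ univ.map E then 1 else 0 := by
    intro d
    rw [card_filter, Fintype.sum_sum_type, add_comm, card_filter]
    congr 1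
    split_ifs with h
    · obtain ⟨i, -, rfl⟩ := mem_map.1 h
      rw [sum_eq_single i]
      · exact if_pos rfl
      · exact fun j _ hj => if_neg fun h' => hj (E.injective h')
      · simp
    · refine sum_eq_zero fun i _ => if_neg fun h' => h ?_
      exact mem_map.2 ⟨i, mem_univ i, h'⟩
  have hprod : ∏ i, (#{j | b₀ j = a₀ i ∧ b j = a i} + 1) =
      ∏ d ∈ D, if d ∈ univ.map E then #{j | V j = d} + 1 else 1 := by
    rw [prod_ite_mem, inter_eq_right.2 hE, prod_map]
    change _ = ∏ i, (#{j | (b₀ j, b j) = (a₀ i, a i)} + 1)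
    simp only [Prod.mk.injEq]
  rw [hU, hV, hprod, ← prod_mul_distrib]
  refine prod_congr rfl fun d _ => ?_
  rw [hk]
  split_ifs
  · rw [Nat.factorial_succ, mul_comm]
  · rw [add_zero, mul_one]

/-- The contents of the restrictions of the word `b` to the fibers of `b₀`. -/
def jointContent {n : ℕ} (b₀ b : Fin n → ℕ) : ℕ →₀ ℕ →₀ ℕ :=
  ∑ j, Finsupp.single (b₀ j) (Finsupp.single (b j) 1)

lemma jointContent_apply {n : ℕ} (b₀ b : Fin n → ℕ) (β c : ℕ) :
    jointContent b₀ b β c = #{j | b₀ j = β ∧ b j = c} := by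
  rw [jointContent, Finsupp.finsetSum_apply, Finsupp.finsetSum_apply, card_filter]
  refine sum_congr rfl fun j _ => ?_
  by_cases h : b₀ j = β
  · simp [h, Finsupp.single_apply]
  · simp [h]

lemma jointContent_eq_iff {n : ℕ} (b₀ b b' : Fin n → ℕ) :
    jointContent b₀ b = jointContent b₀ b' ↔
      ∀ β c, #{j | b₀ j = β ∧ b j = c} = #{j | b₀ j = β ∧ b' j = c} := by
  simp only [Finsupp.ext_iff, jointContent_apply]

lemma jointContent_degree {n : ℕ} (b₀ b : Fin n → ℕ) (β : ℕ) :
    (jointContent b₀ b β).degree = content b₀ β := by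
  rw [jointContent, Finsupp.finsetSum_apply, map_sum, content, Finsupp.finsetSum_apply]
  refine sum_congr rfl fun j _ => ?_
  by_cases h : b₀ j = β
  · simp [h]
  · simp [h]

lemma sum_jointContent {n : ℕ} (b₀ b : Fin n → ℕ) (D : Finset ℕ) (hD : ∀ j, b₀ j ∈ D) :
    ∑ β ∈ D, jointContent b₀ b β = content b := by
  simp only [jointContent, Finsupp.finsetSum_apply]
  rw [sum_comm, content]
  refine sum_congr rfl fun j _ => ?_
  rw [sum_eq_single_of_mem _ (hD j)]
  · simp
  · intro β _ hβ
    simp [hβ.symm]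

lemma exists_content_eq_of_fintype {ι : Type*} [Fintype ι] (α : ℕ →₀ ℕ)
    (h : α.degree = Fintype.card ι) : ∃ b : ι → ℕ, content b = α := by
  obtain ⟨b, hb⟩ := exists_content_eq α h
  refine ⟨b ∘ Fintype.equivFin ι, ?_⟩
  rw [← hb]
  exact (Fintype.equivFin ι).sum_comp fun j => Finsupp.single (b j) 1

/-- Words on the different fibers of `b₀` can be chosen independently and glued. -/
lemma exists_jointContent_eq {n : ℕ} (b₀ : Fin n → ℕ) (l : ℕ →₀ ℕ →₀ ℕ)
    (hl : ∀ β, (l β).degree = content b₀ β) : ∃ b, jointContent b₀ b = l := by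
  have h : ∀ β, ∃ b : {j // b₀ j = β} → ℕ, content b = l β := fun β =>
    exists_content_eq_of_fintype _ (by rw [hl, content_apply, Fintype.card_subtype])
  choose b hb using h
  refine ⟨fun j => b (b₀ j) ⟨j, rfl⟩, ?_⟩
  ext β c
  rw [jointContent_apply, ← hb, content_apply]
  symm
  refine card_bij (fun x _ => x) (fun x hx => ?_) (fun _ _ _ _ h => Subtype.ext h) fun j hj => ?_
  · obtain ⟨j, rfl⟩ := x
    simpa using hx
  · obtain ⟨rfl, hj⟩ := (mem_filter.1 hj).2
    exact ⟨⟨j, rfl⟩, by simpa using hj, rfl⟩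

section

variable {n m : ℕ}

/-- The factor of a block labelled `β` in the generating function of the meets with `K`. -/
def blockSeries (a₀ a : Fin m ↪ ℕ) (b₀ : Fin n → ℕ) (β : ℕ) : MvPowerSeries ℕ ℚ := fun δ =>
  if δ.degree = content b₀ β then ∏ i, (if a₀ i = β then (δ (a i) : ℚ) + 1 else 1) else 0

lemma blockSeries_ferm (a₀ a : Fin m ↪ ℕ) (b₀ : Fin n → ℕ) (i : Fin m) :
    blockSeries a₀ a b₀ (a₀ i) = markedComplete (content b₀ (a₀ i)) (a i) := by
  funext δ
  simp [blockSeries, markedComplete]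

lemma blockSeries_bos (a₀ a : Fin m ↪ ℕ) (b₀ : Fin n → ℕ) {β : ℕ} (h : β ∉ univ.map a₀) :
    blockSeries a₀ a b₀ β = complete (content b₀ β) := by
  funext δ
  have : ∀ i, a₀ i ≠ β := fun i hi => h (mem_map.2 ⟨i, mem_univ i, hi⟩)
  simp [blockSeries, complete, this]

/-- The words are grouped by the way their content `α` is distributed over the fibers of `b₀`.
Within a group the factors `l (a₀ i) (a i) + 1` are constant and, by orbit counting, the orders of
the stabilizers add up to the same number for every nonempty group. What remains is a product over
blocks, summed over the decompositions of `α`: a coefficient of a product of series. -/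
lemma sum_blockFactorial_meet (a₀ a : Fin m ↪ ℕ) (b₀ : Fin n → ℕ) (α : ℕ →₀ ℕ) :
    ∑ b ∈ fnWords n α, (((ofMonomial a₀ b₀).meet (ofMonomial a b)).blockFactorial : ℚ) =
      contentFactorial (content b₀) * MvPowerSeries.coeff α
        (∏ β ∈ univ.map a₀ ∪ (content b₀).support, blockSeries a₀ a b₀ β) := by
  classical
  set D := univ.map a₀ ∪ (content b₀).support with hD
  have hbD : ∀ j, b₀ j ∈ D := fun j => mem_union_right _ ((mem_support_content _ _).2 ⟨j, rfl⟩)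
  have hmaps : ∀ b ∈ fnWords n α, jointContent b₀ b ∈ D.finsuppAntidiag α := by
    intro b hb
    rw [mem_finsuppAntidiag, sum_jointContent b₀ b D hbD, mem_fnWords.1 hb]
    refine ⟨rfl, fun β hβ => ?_⟩
    by_contra hβD
    refine Finsupp.mem_support_iff.1 hβ (Finsupp.ext fun c => ?_)
    rw [jointContent_apply, Finsupp.zero_apply, card_eq_zero, filter_eq_empty_iff]
    rintro j - ⟨rfl, -⟩
    exact hβD (hbD j)
  have hH : #{π : Equiv.Perm (Fin n) | b₀ ∘ π = b₀} = contentFactorial (content b₀) := by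
    rw [card_perm_comp_eq b₀ (content b₀).support fun j => (mem_support_content _ _).2 ⟨j, rfl⟩]
    simp only [contentFactorial, content_apply]
  rw [← sum_fiberwise_of_maps_to hmaps, MvPowerSeries.coeff_prod, mul_sum]
  refine sum_congr rfl fun l hl => ?_
  rw [mem_finsuppAntidiag] at hl
  have hterm : ∀ b ∈ (fnWords n α).filter (fun b => jointContent b₀ b = l),
      (((ofMonomial a₀ b₀).meet (ofMonomial a b)).blockFactorial : ℚ) =
        #{π : Equiv.Perm (Fin n) | b₀ ∘ π = b₀ ∧ b ∘ π = b} *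
          ∏ i, ((l (a₀ i) (a i) : ℚ) + 1) := by
    intro b hb
    rw [blockFactorial_meet_ofMonomial, card_stabilizer_meet, ← (mem_filter.1 hb).2]
    simp only [jointContent_apply]
    push_cast
    rfl
  rw [sum_congr rfl hterm, ← sum_mul]
  -- A distribution `l` comes from a word exactly when each part has the size of its fiber;
  -- otherwise the group is empty and one factor on the right is zero.
  by_cases hex : ∃ b, jointContent b₀ b = l
  · obtain ⟨b₁, hb₁⟩ := hex
    have hY := sum_card_stabilizer b₀ b₁ ((fnWords n α).filter fun b => jointContent b₀ b = l)
      (fun b => by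
        rw [← jointContent_eq_iff, hb₁, mem_filter, mem_fnWords]
        refine ⟨fun h => h.2, fun h => ⟨?_, h⟩⟩
        rw [← sum_jointContent b₀ b D hbD, h, hl.1])
    rw [hH] at hY
    rw [← hY]
    push_cast
    congr 1
    have hc : ∀ β, MvPowerSeries.coeff (l β) (blockSeries a₀ a b₀ β) =
        ∏ i, (if a₀ i = β then (l β (a i) : ℚ) + 1 else 1) := fun β => by
      change blockSeries a₀ a b₀ β (l β) = _
      rw [blockSeries, if_pos]
      rw [← hb₁, jointContent_degree]
    simp only [hc]
    rw [prod_comm]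
    refine prod_congr rfl fun i _ => ?_
    rw [prod_eq_single_of_mem (a₀ i) (mem_union_left _ (mem_map_of_mem _ (mem_univ i)))]
    · simp
    · intro β _ hβ
      rw [if_neg hβ.symm]
  · rw [sum_eq_zero, zero_mul]
    swap
    · intro b hb
      exact (hex ⟨b, (mem_filter.1 hb).2⟩).elim
    have : ∃ β, (l β).degree ≠ content b₀ β := by
      by_contra h
      push Not at h
      exact hex (exists_jointContent_eq b₀ l h)
    obtain ⟨β, hβ⟩ := this
    have hβD : β ∈ D := by
      by_contra h
      refine hβ ?_
      rw [Finsupp.notMem_support_iff.1 fun h' => h (hl.2 h'),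
        Finsupp.notMem_support_iff.1 fun h' => h (mem_union_right _ h'), map_zero]
    rw [prod_eq_zero hβD, mul_zero]
    change blockSeries a₀ a b₀ β (l β) = 0
    rw [blockSeries, if_neg hβ]

lemma degree_eq_of_coeff_blockSeries_ne_zero (a₀ a : Fin m ↪ ℕ) (b₀ : Fin n → ℕ) (α : ℕ →₀ ℕ)
    (h : MvPowerSeries.coeff α
      (∏ β ∈ univ.map a₀ ∪ (content b₀).support, blockSeries a₀ a b₀ β) ≠ 0) :
    α.degree = n := by
  classical
  rw [MvPowerSeries.coeff_prod] at h
  obtain ⟨l, hl, hne⟩ := exists_ne_zero_of_sum_ne_zero h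
  rw [mem_finsuppAntidiag] at hl
  refine Eq.trans ?_ (degree_content b₀)
  rw [← hl.1, map_sum, Finsupp.degree_apply (content b₀)]
  rw [sum_subset (subset_union_right (s₁ := univ.map a₀)) fun c _ hc =>
    Finsupp.notMem_support_iff.1 hc]
  refine sum_congr rfl fun β hβ => ?_
  by_contra hd
  refine hne (prod_eq_zero hβ ?_)
  change blockSeries a₀ a b₀ β (l β) = 0
  rw [blockSeries, if_neg hd]

lemma prod_blockSeries (a₀ a : Fin m ↪ ℕ) (b₀ : Fin n → ℕ) :
    ∏ β ∈ univ.map a₀ ∪ (content b₀).support, blockSeries a₀ a b₀ β =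
      (∏ i, markedComplete ((ofMonomial a₀ b₀).blockType.1 i) (a i)) *
        ((ofMonomial a₀ b₀).blockType.2.map complete).prod := by
  rw [blockType_ofMonomial, ← union_sdiff_self_eq_union, prod_union disjoint_sdiff, prod_map,
    contentType, Multiset.map_map]
  congr 1
  · exact prod_congr rfl fun i _ => blockSeries_ferm a₀ a b₀ i
  · exact prod_congr rfl fun β hβ => blockSeries_bos a₀ a b₀ (mem_sdiff.1 hβ).2

/-- The image of `h_K` under `ρ`, up to a factor, in terms of the block sizes of `K`. -/
def typeProduct (t : (Fin m → ℕ) × Multiset ℕ) : SuperSeries := fun S =>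
  if h : S.card = m then
    (Matrix.of fun i j => markedComplete (t.1 i) (S.orderEmbOfFin h j)).det *
      (t.2.map complete).prod
  else 0

/-- The product of the factorials of a sequence and a multiset. -/
def typeFactorial (t : (Fin m → ℕ) × Multiset ℕ) : ℕ :=
  (∏ i, (t.1 i)!) * (t.2.map Nat.factorial).prod

/-- The Leibniz formula for the determinant is the antisymmetrization over the orders of the `θ`'s.
-/
lemma scCoeff_typeProduct (t : (Fin m → ℕ) × Multiset ℕ) (a : Fin m ↪ ℕ) (α : ℕ →₀ ℕ) :
    scCoeff (typeProduct t) a α = ∑ σ, sgn σ * MvPowerSeries.coeff α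
      ((∏ i, markedComplete (t.1 i) (reindex a σ i)) * (t.2.map complete).prod) := by
  refine Eq.trans ?_ (altCoeff_altSum (fun a => MvPowerSeries.coeff α
    ((∏ i, markedComplete (t.1 i) (a i)) * (t.2.map complete).prod)) a)
  rw [scCoeff]
  congr 1
  funext S
  rw [typeProduct]
  split_ifs with h
  · have hdet : (Matrix.of fun i j => markedComplete (t.1 i) (S.orderEmbOfFin h j)).det =
        ∑ σ : Equiv.Perm (Fin m), Equiv.Perm.sign σ •
          ∏ i, markedComplete (t.1 i) (S.orderEmbOfFin h (σ i)) := by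
      rw [← Matrix.det_transpose, Matrix.det_apply]
      rfl
    change MvPowerSeries.coeff α (_ * (t.2.map complete).prod) = _
    rw [hdet, sum_mul, map_sum]
    refine sum_congr rfl fun σ _ => ?_
    rw [smul_mul_assoc, Units.smul_def, map_zsmul, zsmul_eq_mul, sgn]
    rfl
  · rfl

/-- The sum over the words with given content turns each term of the alternating sum into a
coefficient of a product of series. In particular the image depends only on the block sizes of `K`.
-/
lemma rho_homogeneousFn (K : PartialSetSupercomposition n m) :
    rho (homogeneousFn K) = (typeFactorial K.blockType : ℚ) • typeProduct K.blockType := by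
  obtain ⟨a₀, b₀, rfl⟩ := K.exists_eq_ofMonomial
  refine superSeries_ext fun m' a α => ?_
  rw [scCoeff_smul]
  by_cases hm : m' = m
  · subst hm
    rw [scCoeff_typeProduct]
    simp only [← prod_blockSeries]
    by_cases hα : α.degree = n
    · rw [scCoeff_rho _ _ _ hα]
      simp only [ncCoeff_homogeneousFn]
      rw [sum_comm, mul_sum]
      refine sum_congr rfl fun σ _ => ?_
      rw [← mul_sum, sum_blockFactorial_meet, contentFactorial_eq_contentType a₀,
        ← blockType_ofMonomial, mul_left_comm]
      rfl
    · rw [scCoeff_rho _ _ _ rfl, sum_eq_zero, sum_eq_zero, mul_zero]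
      · intro σ _
        rw [mul_eq_zero]
        right
        by_contra h
        exact hα (degree_eq_of_coeff_blockSeries_ne_zero a₀ (reindex a σ) b₀ α h)
      · intro b _
        exact ncCoeff_eq_zero_of_hasBidegree (hasBidegree_homogeneousFn _)
          (fun h => hα (Prod.mk.inj h).1) _ _
  · rw [scCoeff_rho _ _ _ rfl, sum_eq_zero, scCoeff, altCoeff, typeProduct,
      dif_neg (by simpa using hm)]
    · have h0 : (0 : MvPowerSeries ℕ ℚ) α = 0 := rfl
      rw [h0, mul_zero, mul_zero]
    · intro b _
      exact ncCoeff_eq_zero_of_hasBidegree (hasBidegree_homogeneousFn _)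
        (fun h => hm (Prod.mk.inj h).2) _ _

end

/-! ### The products `h_Λ` -/

lemma symMonomialFn_apply {n m : ℕ} (Λ : Superpartition n m) (S : Finset ℕ) (h : S.card = m)
    (α : ℕ →₀ ℕ) : SuperSeries.monomialFn Λ S α =
      (typeAction n m).orbitSign (contentType (enumEmb S h) α) Λ := by
  rw [← scCoeff_symMonomialFn, scCoeff, altCoeff_enumEmb (fun S => SuperSeries.monomialFn Λ S α)]

/-- With at most one `θ` there is nothing to sort, and every exponent of degree `n` has exactly one
type, with sign `1`. -/
lemma sum_orbitSign_of_subsingleton {n m : ℕ} [Subsingleton (Fin m)]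
    (F : (Fin m → ℕ) × Multiset ℕ → ℚ) (a : Fin m ↪ ℕ) (α : ℕ →₀ ℕ) :
    ∑ Λ : Superpartition n m, F (Λ.anti, Λ.sym) * (typeAction n m).orbitSign (contentType a α) Λ =
      if α.degree = n then F (contentType a α) else 0 := by
  split_ifs with h
  · refine ((typeAction n m).eq_sum_orbitSign (F := F) (typeAction_P_contentType a h)
      fun σ => ?_).symm
    have : σ = 1 := Subsingleton.elim _ _
    rw [this, sgn_one, one_mul, (typeAction n m).act_one]
  · exact sum_eq_zero fun Λ _ => by rw [orbitSign_eq_zero_of_degree_ne Λ a h, mul_zero]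

lemma SuperSeries.sum_apply {ι : Type*} (s : Finset ι) (f : ι → SuperSeries) (S : Finset ℕ)
    (α : ℕ →₀ ℕ) : (∑ i ∈ s, f i) S α = ∑ i ∈ s, f i S α := by
  rw [Finset.sum_apply]
  exact Finset.sum_apply α s fun i => f i S

lemma hTilde_apply (k : ℕ) (S : Finset ℕ) : SuperSeries.hTilde k S =
    if h : S.card = 1 then markedComplete k (S.orderEmbOfFin h 0) else 0 := by
  funext α
  rw [SuperSeries.hTilde, SuperSeries.sum_apply]
  have hsmul : ∀ Λ : Superpartition k 1,
      (((Λ.anti 0 : ℚ) + 1) • SuperSeries.monomialFn Λ) S α =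
        ((Λ.anti 0 : ℚ) + 1) * SuperSeries.monomialFn Λ S α := fun _ => rfl
  simp only [hsmul]
  split_ifs with h
  · simp only [symMonomialFn_apply _ S h]
    exact sum_orbitSign_of_subsingleton (fun t => (t.1 0 : ℚ) + 1) (enumEmb S h) α
  · refine sum_eq_zero fun Λ _ => ?_
    rw [SuperSeries.monomialFn, dif_neg h, mul_zero]

lemma hPlain_apply (r : ℕ) (S : Finset ℕ) :
    SuperSeries.hPlain r S = if S = ∅ then complete r else 0 := by
  funext α
  rw [SuperSeries.hPlain, SuperSeries.sum_apply]
  split_ifs with h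
  · simp only [symMonomialFn_apply _ S (card_eq_zero.2 h)]
    refine Eq.trans ?_ (sum_orbitSign_of_subsingleton (n := r) (fun _ => 1)
      (enumEmb S (card_eq_zero.2 h)) α)
    simp only [one_mul]
  · refine sum_eq_zero fun Λ _ => ?_
    rw [SuperSeries.monomialFn, dif_neg fun h' => h (card_eq_zero.1 h')]

lemma foldr_hPlain (l : List ℕ) (S : Finset ℕ) :
    (l.map SuperSeries.hPlain).foldr SuperSeries.mul SuperSeries.one S =
      if S = ∅ then (l.map complete).prod else 0 := by
  induction l generalizing S with
  | nil => rfl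
  | cons r l ih =>
    rw [List.map_cons, List.foldr_cons, SuperSeries.mul, sum_eq_single ∅]
    · simp only [sdiff_empty, empty_product, filter_empty, card_empty, pow_zero, one_mul, ih,
        hPlain_apply, if_true, List.map_cons, List.prod_cons, mul_ite, mul_zero]
    · intro T _ hT
      rw [hPlain_apply, if_neg hT, zero_mul, mul_zero]
    · exact fun h => absurd (empty_mem_powerset S) h

/-- Moving the `j`th `θ` to the front passes the `j` smaller ones; this is the sign `(-1)^j` in the
expansion of a determinant along its first row. -/
lemma card_inversions_singleton {m : ℕ} (S : Finset ℕ) (h : S.card = m) (j : Fin m) :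
    #{p ∈ {S.orderEmbOfFin h j} ×ˢ (S \ {S.orderEmbOfFin h j}) | p.2 < p.1} = (j : ℕ) := by
  rw [← Fin.card_Iio j]
  symm
  refine card_bij (fun i _ => (S.orderEmbOfFin h j, S.orderEmbOfFin h i)) (fun i hi => ?_)
    (fun i _ i' _ hii => by simpa using hii) fun p hp => ?_
  · have hlt := (S.orderEmbOfFin h).strictMono (mem_Iio.1 hi)
    rw [mem_filter, mem_product, mem_singleton, mem_sdiff, mem_singleton]
    exact ⟨⟨rfl, orderEmbOfFin_mem _ _ _, hlt.ne⟩, hlt⟩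
  · rw [mem_filter, mem_product, mem_singleton, mem_sdiff] at hp
    obtain ⟨x, y⟩ := p
    obtain ⟨⟨rfl, hy, -⟩, hlt⟩ := hp
    have hy' : y ∈ univ.map (enumEmb S h) := by
      rw [map_enumEmb]
      exact hy
    obtain ⟨i, -, rfl⟩ := mem_map.1 hy'
    exact ⟨i, mem_Iio.2 ((S.orderEmbOfFin h).lt_iff_lt.1 hlt), rfl⟩

lemma orderEmbOfFin_sdiff_singleton {m : ℕ} (S : Finset ℕ) (h : S.card = m + 1) (j : Fin (m + 1))
    (h' : (S \ {S.orderEmbOfFin h j}).card = m) (i : Fin m) :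
    (S \ {S.orderEmbOfFin h j}).orderEmbOfFin h' i = S.orderEmbOfFin h (j.succAbove i) := by
  refine (congrFun (orderEmbOfFin_unique h' (f := fun i => S.orderEmbOfFin h (j.succAbove i))
    (fun i => ?_) ?_) i).symm
  · rw [mem_sdiff, mem_singleton]
    exact ⟨orderEmbOfFin_mem _ _ _, fun he =>
      Fin.succAbove_ne j i ((S.orderEmbOfFin h).injective he)⟩
  · exact (S.orderEmbOfFin h).strictMono.comp (Fin.strictMono_succAbove j)

/-- Multiplication by `h̃_k` is a Laplace expansion. -/
lemma hTilde_mul_typeProduct {m : ℕ} (k : ℕ) (A : Fin m → ℕ) (s : Multiset ℕ) :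
    SuperSeries.mul (SuperSeries.hTilde k) (typeProduct (A, s)) =
      typeProduct (Fin.cons k A, s) := by
  funext S
  rw [SuperSeries.mul, typeProduct]
  split_ifs with h
  · rw [Matrix.det_succ_row_zero, sum_mul]
    symm
    -- `h̃_k` contains a single `θ`, so only singletons `T = {c_j}` contribute, one for each column
    -- of the first row.
    refine sum_of_injOn (fun j => {S.orderEmbOfFin h j}) ?_ ?_ ?_ ?_
    · intro i _ j _ hij
      exact (S.orderEmbOfFin h).injective (singleton_injective hij)
    · intro j _
      rw [mem_coe, mem_powerset, singleton_subset_iff]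
      exact orderEmbOfFin_mem _ _ _
    · intro T hT hTn
      rw [hTilde_apply, dif_neg, zero_mul, mul_zero]
      intro h1
      obtain ⟨c, rfl⟩ := card_eq_one.1 h1
      have hc : c ∈ S := singleton_subset_iff.1 (mem_powerset.1 hT)
      rw [← map_enumEmb S h] at hc
      obtain ⟨j, -, rfl⟩ := mem_map.1 hc
      exact hTn ⟨j, mem_coe.2 (mem_univ j), rfl⟩
    · intro j _
      have h' : (S \ {S.orderEmbOfFin h j}).card = m := by
        rw [card_sdiff_of_subset (singleton_subset_iff.2 (orderEmbOfFin_mem _ _ _)), h,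
          card_singleton, Nat.add_sub_cancel]
      rw [card_inversions_singleton, hTilde_apply, dif_pos (card_singleton _), typeProduct,
        dif_pos h', mul_assoc, mul_assoc]
      congr 1
      have h0 : ({S.orderEmbOfFin h j} : Finset ℕ).orderEmbOfFin (card_singleton _) 0 =
          S.orderEmbOfFin h j := by
        simp
      rw [h0]
      congr 1
      congr 2
      ext1 i i'
      rw [Matrix.submatrix_apply, Matrix.of_apply, Matrix.of_apply, orderEmbOfFin_sdiff_singleton]
      rfl
  · refine sum_eq_zero fun T hT => ?_
    rw [hTilde_apply]
    split_ifs with h1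
    · rw [typeProduct, dif_neg, mul_zero, mul_zero]
      intro h2
      refine h ?_
      rw [card_sdiff_of_subset (mem_powerset.1 hT), h1] at h2
      have := card_le_card (mem_powerset.1 hT)
      omega
    · rw [zero_mul, mul_zero]

lemma foldr_hTilde {m : ℕ} (A : Fin m → ℕ) (s : Multiset ℕ) (g : SuperSeries)
    (hg : ∀ S, g S = if S = ∅ then (s.map complete).prod else 0) :
    (List.ofFn fun i => SuperSeries.hTilde (A i)).foldr SuperSeries.mul g = typeProduct (A, s) := by
  induction m with
  | zero =>
    funext S
    rw [List.ofFn_zero, List.foldr_nil, hg, typeProduct]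
    by_cases h : S = ∅
    · rw [if_pos h, dif_pos (card_eq_zero.2 h), Matrix.det_isEmpty, one_mul]
    · rw [if_neg h, dif_neg fun h' => h (card_eq_zero.1 h')]
  | succ m ih =>
    rw [List.ofFn_succ, List.foldr_cons, ih fun i => A i.succ, hTilde_mul_typeProduct]
    congr
    exact Fin.cons_self_tail A

lemma symHomogeneousFn_eq {n m : ℕ} (Λ : Superpartition n m) :
    SuperSeries.homogeneousFn Λ = typeProduct (Λ.anti, Λ.sym) := by
  rw [SuperSeries.homogeneousFn, List.foldr_append]
  refine foldr_hTilde _ _ _ fun S => ?_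
  rw [foldr_hPlain]
  congr 1
  conv_rhs => rw [← Multiset.sort_eq Λ.sym (fun a b => b ≤ a), Multiset.map_coe,
    Multiset.prod_coe]

/-- Reordering the fermionic sizes permutes the rows of the determinant. -/
lemma typeProduct_comp {m : ℕ} (A : Fin m → ℕ) (s : Multiset ℕ) (σ : Equiv.Perm (Fin m)) :
    typeProduct (A ∘ σ, s) = sgn σ • typeProduct (A, s) := by
  funext S
  rw [Pi.smul_apply, typeProduct, typeProduct]
  split_ifs with h
  · have hM : (Matrix.of fun i j => markedComplete ((A ∘ σ) i) (S.orderEmbOfFin h j)) =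
        (Matrix.of fun i j => markedComplete (A i) (S.orderEmbOfFin h j)).submatrix σ id := rfl
    dsimp only
    rw [hM, Matrix.det_permute, mul_assoc, sgn, Algebra.smul_def]
    congr 1
    simp
  · rw [smul_zero]

/-- Repeated fermionic sizes give equal rows; this is why `ρ` kills the `h_I` without a type. -/
lemma typeProduct_eq_zero {m : ℕ} {A : Fin m → ℕ} (h : ¬ Function.Injective A) (s : Multiset ℕ) :
    typeProduct (A, s) = 0 := by
  simp only [Function.Injective, not_forall] at h
  obtain ⟨i, j, hij, hne⟩ := h
  funext S
  rw [typeProduct]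
  split_ifs with hS
  · rw [Matrix.det_zero_of_row_eq hne, zero_mul]
    · rfl
    · funext k
      simp only [Matrix.of_apply, hij]
  · rfl

lemma typeAction_P_blockType {n m : ℕ} (K : PartialSetSupercomposition n m) :
    (typeAction n m).P K.blockType := by
  obtain ⟨a, b, rfl⟩ := K.exists_eq_ofMonomial
  rw [blockType_ofMonomial]
  exact typeAction_P_contentType a (degree_content b)

lemma SetSuperpartition.HasType.unique {n m : ℕ} {I : SetSuperpartition n m}
    {Λ Ω : Superpartition n m} (h : I.HasType Λ) (h' : I.HasType Ω) : Λ = Ω := by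
  obtain ⟨σ, hσ, -⟩ := h.exists_act_eq
  obtain ⟨τ, hτ, -⟩ := h'.exists_act_eq
  have h1 := ((typeAction n m).key_injective_of_act_eq hσ).2
  rw [← ((typeAction n m).key_injective_of_act_eq hτ).2] at h1
  exact (typeAction n m).incl_injective (by rw [← hσ, ← hτ, h1])

/-- Sorting the rows of the determinant into the order of `Λ` costs the sign of the sorting
permutation, which is `(-1)^{ε(I)}`. -/
lemma SetSuperpartition.HasType.rho_homogeneousFn {n m : ℕ} {I : SetSuperpartition n m}
    {Λ : Superpartition n m} (h : I.HasType Λ) :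
    rho (homogeneousFn I.toPartialSetSupercomposition) =
      ((Λ.factorial : ℚ) * (-1) ^ I.epsilon) • SuperSeries.homogeneousFn Λ := by
  obtain ⟨σ, hσ, hs⟩ := h.exists_act_eq
  have h1 : I.blockType.1 ∘ σ = Λ.anti := congrArg Prod.fst hσ
  have h2 : I.blockType.2 = Λ.sym := congrArg Prod.snd hσ
  have hf : typeFactorial I.blockType = Λ.factorial := by
    rw [typeFactorial, Superpartition.factorial, h2, ← h1]
    congr 1
    exact (Equiv.prod_comp σ fun i => (I.blockType.1 i)!).symm
  have hp : typeProduct I.blockType = sgn σ • SuperSeries.homogeneousFn Λ := by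
    rw [symHomogeneousFn_eq, ← h1, ← h2, typeProduct_comp, smul_smul, sgn_mul_self, one_smul]
  rw [_root_.rho_homogeneousFn, hf, hp, smul_smul, hs]

lemma SetSuperpartition.rho_homogeneousFn_eq_zero {n m : ℕ} {I : SetSuperpartition n m}
    (h : ∀ Λ, ¬ I.HasType Λ) : rho (homogeneousFn I.toPartialSetSupercomposition) = 0 := by
  have : typeProduct I.blockType = 0 := by
    refine typeProduct_eq_zero (fun hinj => ?_) _
    obtain ⟨Λ, hΛ⟩ := (typeAction n m).exists_act_eq (typeAction_P_blockType _)
      (t := I.blockType) fun i j hij => by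
        have h' : I.blockType.1 i = I.blockType.1 j := by
          simpa [typeAction] using hij
        exact hinj h'
    exact h Λ (hasType_of_act_eq hΛ)
  rw [_root_.rho_homogeneousFn, this, smul_zero]

/-! ### The complete homogeneous basis of `sSym` and the form on it -/

lemma exists_blockType_eq {n m : ℕ} (Λ : Superpartition n m) :
    ∃ K : PartialSetSupercomposition n m, K.blockType = (Λ.anti, Λ.sym) := by
  obtain ⟨⟨a, α⟩, h⟩ := exists_contentType_eq Λ
  obtain ⟨b, rfl⟩ := exists_content_eq α (n := n) (by
    rw [degree_eq_contentType a, h]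
    exact Λ.sum_eq)
  exact ⟨ofMonomial a b, by rw [blockType_ofMonomial, h]⟩

lemma factorial_ne_zero {n m : ℕ} (Λ : Superpartition n m) : (Λ.factorial : ℚ) ≠ 0 :=
  Nat.cast_ne_zero.2 (factorial_pos Λ).ne'

/-- A preimage is a multiple of `h_K` for any `K` with fermionic sizes already in the order of `Λ`;
`K` need not be a set superpartition, so no sign appears. -/
lemma exists_symHomogeneousFn_eq_rho {n m : ℕ} (Λ : Superpartition n m) :
    ∃ f ∈ sNCSym, HasBidegree n m f ∧ SuperSeries.homogeneousFn Λ = rho f := by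
  obtain ⟨K, hK⟩ := exists_blockType_eq Λ
  refine ⟨(Λ.factorial : ℚ)⁻¹ • homogeneousFn K,
    Submodule.smul_mem _ _ (homogeneousFn_mem_sNCSym K), fun S w h => ?_, ?_⟩
  · exact hasBidegree_homogeneousFn K S w fun h' => h (by
      change (Λ.factorial : ℚ)⁻¹ * homogeneousFn K S w = 0
      rw [h', mul_zero])
  · rw [map_smul, rho_homogeneousFn, hK, ← symHomogeneousFn_eq]
    exact (inv_smul_smul₀ (factorial_ne_zero Λ) _).symm

lemma symHomogeneousFn_mem_sSym {n m : ℕ} (Λ : Superpartition n m) :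
    SuperSeries.homogeneousFn Λ ∈ sSym := by
  obtain ⟨f, hf, -, h⟩ := exists_symHomogeneousFn_eq_rho Λ
  rw [h]
  exact Submodule.mem_map_of_mem hf

/-- The complete homogeneous function as an element of `sSym`. -/
def symHomogeneous (Λ : BidegSuperpartition) : sSym :=
  ⟨SuperSeries.homogeneousFn Λ.2, symHomogeneousFn_mem_sSym _⟩

/-- The restriction of `ρ` to `sNCSym`. -/
def rhoSym : sNCSym →ₗ[ℚ] sSym := rho.restrict fun _ hf => Submodule.mem_map_of_mem hf

lemma rhoSym_ncHomogeneous {n m : ℕ} {I : SetSuperpartition n m} {Λ : Superpartition n m}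
    (h : I.HasType Λ) : rhoSym (ncHomogeneous ⟨(n, m), I⟩) =
      ((Λ.factorial : ℚ) * (-1) ^ I.epsilon) • symHomogeneous ⟨(n, m), Λ⟩ :=
  Subtype.ext h.rho_homogeneousFn

lemma rhoSym_ncHomogeneous_eq_zero {n m : ℕ} {I : SetSuperpartition n m}
    (h : ∀ Λ, ¬ I.HasType Λ) : rhoSym (ncHomogeneous ⟨(n, m), I⟩) = 0 :=
  Subtype.ext (I.rho_homogeneousFn_eq_zero h)

/-- The matrix of the `h_Λ` in the `m_Ω`, in one bidegree. -/
def symMatrix (d : ℕ × ℕ) : Matrix (Superpartition d.1 d.2) (Superpartition d.1 d.2) ℚ :=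
  fun Λ Ω => symDual ⟨d, Ω⟩ (symHomogeneous ⟨d, Λ⟩)

lemma blockFamily_symMatrix (Λ : BidegSuperpartition) :
    blockFamily symMonomialBasis symMatrix Λ = symHomogeneous Λ := by
  obtain ⟨⟨n, m⟩, Λ⟩ := Λ
  apply Subtype.ext
  refine superSeries_ext fun m' a α => ?_
  simp only [blockFamily, AddSubmonoidClass.coe_finsetSum, SetLike.val_smul, scCoeff_sum,
    scCoeff_smul, symMonomialBasis_apply]
  by_cases h : (α.degree, m') = (n, m)
  · obtain ⟨hα, rfl⟩ := Prod.mk.inj h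
    exact (scCoeff_eq_sum (symHomogeneousFn_mem_sSym Λ) a hα).symm
  · rw [sum_eq_zero fun Ω _ => by
      rw [symMonomial, scCoeff_symMonomialFn_of_ne _ a rfl h, mul_zero]]
    obtain ⟨f, -, hf, hΛ⟩ := exists_symHomogeneousFn_eq_rho Λ
    change 0 = scCoeff (SuperSeries.homogeneousFn Λ) a α
    rw [hΛ, scCoeff_rho _ _ _ rfl]
    exact (sum_eq_zero fun b _ => ncCoeff_eq_zero_of_hasBidegree hf h a b).symm

/-- The sum of the `m_K` over all `K` of type `Λ`, as an element of `sNCSym`. -/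
def ncTypeSumSym (Λ : BidegSuperpartition) : sNCSym :=
  ⟨ncTypeSum Λ.2, ncTypeSum_mem_sNCSym Λ.2⟩

lemma rhoSym_ncTypeSumSym {n m : ℕ} (Λ : Superpartition n m) :
    ((Λ.factorial : ℚ) / n !) • rhoSym (ncTypeSumSym ⟨(n, m), Λ⟩) = symMonomial ⟨(n, m), Λ⟩ := by
  apply Subtype.ext
  change ((Λ.factorial : ℚ) / n !) • rho (ncTypeSum Λ) = SuperSeries.monomialFn Λ
  have h2 : (n ! : ℚ) ≠ 0 := by positivity
  rw [rho_ncTypeSum, smul_smul, div_mul_div_cancel₀ h2, div_self (factorial_ne_zero Λ), one_smul]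

lemma hasBidegree_ncTypeSum {n m : ℕ} (Λ : Superpartition n m) : HasBidegree n m (ncTypeSum Λ) :=
  hasBidegree_formalSum _

/-- Up to a factor `m_Λ` is the image of a combination of the `h_J`, and `ρ` sends each `h_J` to a
multiple of some `h_Ω` or to `0`. -/
lemma symMonomial_mem_span {n m : ℕ} (Λ : Superpartition n m) : symMonomial ⟨(n, m), Λ⟩ ∈
    Submodule.span ℚ (Set.range fun Ω : Superpartition n m => symHomogeneous ⟨(n, m), Ω⟩) := by
  rw [← rhoSym_ncTypeSumSym]
  obtain ⟨c, hc⟩ := eq_sum_ncHomogeneous_of_hasBidegree (n := n) (m := m)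
    (f := ncTypeSumSym ⟨(n, m), Λ⟩) (hasBidegree_ncTypeSum Λ)
  rw [hc, map_sum]
  refine Submodule.smul_mem _ _ (Submodule.sum_mem _ fun J _ => ?_)
  rw [map_smul]
  refine Submodule.smul_mem _ _ ?_
  by_cases h : ∃ Ω, J.HasType Ω
  · obtain ⟨Ω, hΩ⟩ := h
    rw [rhoSym_ncHomogeneous hΩ]
    exact Submodule.smul_mem _ _ (Submodule.subset_span ⟨Ω, rfl⟩)
  · rw [rhoSym_ncHomogeneous_eq_zero fun Ω hΩ => h ⟨Ω, hΩ⟩]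
    exact Submodule.zero_mem _

/-- In one bidegree the matrix is square, so expressing the `m_Λ` through the `h_Ω` supplies a
one-sided inverse, which suffices. -/
lemma isUnit_symMatrix (d : ℕ × ℕ) : IsUnit (symMatrix d) := by
  obtain ⟨n, m⟩ := d
  have h : ∀ Λ : Superpartition n m, ∃ c : Superpartition n m → ℚ,
      ∑ Ω, c Ω • symHomogeneous ⟨(n, m), Ω⟩ = symMonomial ⟨(n, m), Λ⟩ := fun Λ =>
    (Submodule.mem_span_range_iff_exists_fun ℚ).1 (symMonomial_mem_span Λ)
  choose C hC using h
  refine (Matrix.isUnit_iff_isUnit_det _).2 (Matrix.isUnit_det_of_left_inverse (B := Matrix.of C) ?_)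
  ext Λ Ω
  have h1 := congrArg (symDual ⟨(n, m), Ω⟩) (hC Λ)
  rw [symDual_symMonomial, map_sum] at h1
  rw [Matrix.mul_apply, Matrix.one_apply]
  simp only [map_smul, smul_eq_mul] at h1
  refine h1.trans ?_
  simp [eq_comm]

/-- The complete homogeneous basis of `sSym`. -/
def symHomogeneousBasis : Module.Basis BidegSuperpartition ℚ sSym :=
  blockBasis symMonomialBasis symMatrix isUnit_symMatrix

@[simp] lemma symHomogeneousBasis_apply (Λ : BidegSuperpartition) :
    symHomogeneousBasis Λ = symHomogeneous Λ := by
  rw [symHomogeneousBasis, blockBasis_apply, blockFamily_symMatrix]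

lemma isSymForm_iff (B : LinearMap.BilinForm ℚ sSym) : IsSymForm B ↔
    ∀ Λ Ω, B (symMonomialBasis Λ) (symHomogeneousBasis Ω) =
      if Λ = Ω then (-1 : ℚ) ^ (Λ.1.2.choose 2) else 0 := by
  simp only [symMonomialBasis_apply, symHomogeneousBasis_apply]
  constructor
  · intro h Λ Ω
    have := h Λ Ω (symMonomial Λ) (symHomogeneous Ω) rfl rfl
    split_ifs with hΛ
    · exact this.1 hΛ
    · exact this.2 hΛ
  · intro h Λ Ω f g hf hg
    have hf' : f = symMonomial Λ := Subtype.ext hf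
    have hg' : g = symHomogeneous Ω := Subtype.ext hg
    rw [hf', hg', h]
    exact ⟨fun h => if_pos h, fun h => if_neg h⟩

lemma existsUnique_isSymForm : ∃! B : LinearMap.BilinForm ℚ sSym, IsSymForm B := by
  simp only [isSymForm_iff]
  exact existsUnique_bilinForm symMonomialBasis symHomogeneousBasis _

/-! ### The lifting map -/

lemma isLifting_iff (L : sSym →ₗ[ℚ] sNCSym) : IsLifting L ↔
    ∀ Λ, L (symMonomialBasis Λ) = ((Λ.2.factorial : ℚ) / (Λ.1.1)!) • ncTypeSumSym Λ := by
  simp only [symMonomialBasis_apply]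
  constructor
  · rintro h ⟨⟨n, m⟩, Λ⟩
    apply Subtype.ext
    rw [h n m Λ (symMonomial ⟨(n, m), Λ⟩) rfl, ← ncTypeSum_eq_sum]
    rfl
  · intro h n m Λ f hf
    have hf' : f = symMonomial ⟨(n, m), Λ⟩ := Subtype.ext hf
    rw [hf', h, ← ncTypeSum_eq_sum]
    rfl

lemma existsUnique_isLifting : ∃! L : sSym →ₗ[ℚ] sNCSym, IsLifting L := by
  simp only [isLifting_iff]
  refine ⟨symMonomialBasis.constr ℚ fun Λ =>
    ((Λ.2.factorial : ℚ) / (Λ.1.1)!) • ncTypeSumSym Λ, fun Λ => ?_, fun L hL => ?_⟩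
  · rw [Module.Basis.constr_basis]
  · refine symMonomialBasis.ext fun Λ => ?_
    rw [Module.Basis.constr_basis, hL]

lemma IsLifting.rhoSym_apply {L : sSym →ₗ[ℚ] sNCSym} (hL : IsLifting L) (f : sSym) :
    rhoSym (L f) = f := by
  have h : rhoSym.comp L = LinearMap.id := symMonomialBasis.ext fun Λ => by
    rw [LinearMap.comp_apply, (isLifting_iff L).1 hL, map_smul, LinearMap.id_apply,
      symMonomialBasis_apply]
    exact rhoSym_ncTypeSumSym Λ.2
  exact LinearMap.congr_fun h f

lemma IsNCForm.apply_ncTypeSumSym {B : LinearMap.BilinForm ℚ sNCSym} (hB : IsNCForm B) {n m : ℕ}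
    (Λ : Superpartition n m) (J : SetSuperpartition n m) [Decidable (J.HasType Λ)] :
    B (ncTypeSumSym ⟨(n, m), Λ⟩) (ncHomogeneous ⟨(n, m), J⟩) =
      if J.HasType Λ then (-1) ^ J.epsilon * ((-1 : ℚ) ^ (m.choose 2) * n !) else 0 := by
  classical
  have h : ncTypeSumSym ⟨(n, m), Λ⟩ = ∑ I : SetSuperpartition n m with I.HasType Λ,
      (-1 : ℚ) ^ I.epsilon • ncMonomial ⟨(n, m), I⟩ := by
    apply Subtype.ext
    simp only [AddSubmonoidClass.coe_finsetSum, SetLike.val_smul]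
    exact ncTypeSum_eq_sum Λ
  rw [h, map_sum, LinearMap.sum_apply]
  simp only [map_smul, LinearMap.smul_apply, hB.apply_monomial_homogeneous, smul_eq_mul]
  have hJ : ∀ I : SetSuperpartition n m,
      ((⟨(n, m), I⟩ : BidegSetSuperpartition) = ⟨(n, m), J⟩) ↔ I = J := fun I => by simp
  simp only [hJ, mul_ite, mul_zero, sum_ite_eq', mem_filter, mem_univ, true_and]

/-- The lifting map is adjoint to `ρ`. -/
lemma IsLifting.apply_eq {B : LinearMap.BilinForm ℚ sNCSym} {B' : LinearMap.BilinForm ℚ sSym}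
    {L : sSym →ₗ[ℚ] sNCSym} (hB : IsNCForm B) (hB' : IsSymForm B') (hL : IsLifting L)
    (f : sSym) (g : sNCSym) : B (L f) g = B' f (rhoSym g) := by
  classical
  have h : LinearMap.comp B L = LinearMap.compl₂ B' rhoSym := by
    refine symMonomialBasis.ext fun Λ => ncHomogeneousBasis.ext fun J => ?_
    have hB'' := fun Ω => (isSymForm_iff B').1 hB' Λ Ω
    rw [LinearMap.comp_apply, LinearMap.compl₂_apply, (isLifting_iff L).1 hL, map_smul,
      LinearMap.smul_apply, ncHomogeneousBasis_apply]
    simp only [symHomogeneousBasis_apply] at hB''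
    obtain ⟨⟨n, m⟩, Λ⟩ := Λ
    obtain ⟨e, J⟩ := J
    by_cases hde : (n, m) = e
    · subst hde
      have hn : (n ! : ℚ) ≠ 0 := by positivity
      rw [hB.apply_ncTypeSumSym]
      -- The factor `Λ!/n!` of the lifting map turns the `n!` in the form on `sNCSym` into the `Λ!`
      -- in `ρ(h_J)`, and `(-1)^{ε(J)}` occurs on both sides.
      by_cases hJ : ∃ Ω, J.HasType Ω
      · obtain ⟨Ω, hΩ⟩ := hJ
        rw [rhoSym_ncHomogeneous hΩ, map_smul, hB'']
        by_cases hΛ : Λ = Ω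
        · subst hΛ
          rw [if_pos hΩ, if_pos rfl]
          simp only [smul_eq_mul]
          field_simp
        · rw [if_neg fun h => hΛ (h.unique hΩ), if_neg (by simpa using hΛ), smul_zero, smul_zero]
      · rw [if_neg fun h => hJ ⟨Λ, h⟩, rhoSym_ncHomogeneous_eq_zero fun Ω hΩ => hJ ⟨Ω, hΩ⟩,
          map_zero, smul_zero]
    · obtain ⟨n', m'⟩ := e
      rw [hB.apply_eq_zero_of_hasBidegree (n := n) (m := m) (n' := n') (m' := m')
        (hasBidegree_ncTypeSum Λ) (hasBidegree_homogeneousFn J.toPartialSetSupercomposition) hde,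
        smul_zero]
      by_cases hJ : ∃ Ω, J.HasType Ω
      · obtain ⟨Ω, hΩ⟩ := hJ
        rw [rhoSym_ncHomogeneous hΩ, map_smul, hB'',
          if_neg fun h' => hde (congrArg Sigma.fst h'), smul_zero]
      · rw [rhoSym_ncHomogeneous_eq_zero fun Ω hΩ => hJ ⟨Ω, hΩ⟩, map_zero]
  exact LinearMap.congr_fun (LinearMap.congr_fun h f) g

end

theorem mainTheorem8 :
    -- the functions named below lie in the two spaces
    (∀ (n m : ℕ) (I : SetSuperpartition n m),
      monomialFn I.toPartialSetSupercomposition ∈ sNCSym ∧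
        homogeneousFn I.toPartialSetSupercomposition ∈ sNCSym) ∧
    (∀ (n m : ℕ) (Λ : Superpartition n m),
      SuperSeries.monomialFn Λ ∈ sSym ∧ SuperSeries.homogeneousFn Λ ∈ sSym) ∧
    -- the two bilinear forms and the lifting map are well defined
    (∃! B : LinearMap.BilinForm ℚ sNCSym, IsNCForm B) ∧
    (∃! B' : LinearMap.BilinForm ℚ sSym, IsSymForm B') ∧
    (∃! L : sSym →ₗ[ℚ] sNCSym, IsLifting L) ∧
    -- the form on `sNCSym` is an inner product
    (∀ B : LinearMap.BilinForm ℚ sNCSym, IsNCForm B →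
      B.IsSymm ∧ B.Nondegenerate ∧
      (∀ (n m n' m' : ℕ) (f g : sNCSym), HasBidegree n m f → HasBidegree n' m' g →
        (n, m) ≠ (n', m') → B f g = 0) ∧
      (∀ (n m : ℕ) (f : sNCSym), HasBidegree n m f → f ≠ 0 →
        0 < (-1) ^ (m.choose 2) * B f f)) ∧
    -- the lifting map is a right inverse of `ρ` and an isometry
    (∀ (B : LinearMap.BilinForm ℚ sNCSym) (B' : LinearMap.BilinForm ℚ sSym)
      (L : sSym →ₗ[ℚ] sNCSym), IsNCForm B → IsSymForm B' → IsLifting L →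
      (∀ f : sSym, rho (L f) = f) ∧ ∀ f g : sSym, B (L f) (L g) = B' f g) := by
  exact ⟨fun n m I => ⟨monomialFn_mem_sNCSym _, homogeneousFn_mem_sNCSym _⟩,
    fun n m Λ => ⟨symMonomialFn_mem_sSym Λ, symHomogeneousFn_mem_sSym Λ⟩,
    existsUnique_isNCForm, existsUnique_isSymForm, existsUnique_isLifting,
    fun B hB => ⟨hB.isSymm, hB.nondegenerate,
      fun n m n' m' f g hf hg h => hB.apply_eq_zero_of_hasBidegree hf hg h,
      fun n m f hf h0 => hB.pos hf h0⟩,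
    fun B B' L hB hB' hL => ⟨fun f => congrArg Subtype.val (hL.rhoSym_apply f),
      -- By adjunction one lifting map moves to the other side as `ρ`, where it cancels the second
      -- one.
      fun f g => by rw [IsLifting.apply_eq hB hB' hL, hL.rhoSym_apply]⟩⟩
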